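/- Let $\ell:\mathbb R\to(0,\infty)$ be $1$-periodic, continuous, and $C^\infty$ on $[0,1]$ up to the endpoints, so that its derivatives may jump only at integer times. Write $\ell_0=\ell(0)$, and $\dot\ell^\pm,\ddot\ell^\pm$ for the one-sided derivatives at $0^\pm$ (at $t=0$ put $\dot\ell=\dot\ell^+$). A ball bounces elastically between a fixed wall and a moving wall at distance $\ell(t)$ from it. Let $f$ be its collision map on $\{(t,v): t\in\mathbb R/\mathbb Z,\ v>-\dot\ell(t)\}$, where $t$ is the time of a collision with the moving wall and $v$ the velocity just after it; for large $v$, $$f(t,v)=(t+\delta t,\ v-2\dot\ell(t+\delta t)),\qquad \delta t=\frac{\ell(t)+\ell(t+\delta t)}{v}.$$ Let $S=\{t=0\}$, let $R$ be the strip between $S$ (included) and $fS$ (excluded), and let $F$ be the first return map of $f$ to $R$. Put $$\mathcal J=\int_0^1\ell(s)^{-2}\,ds,\qquad \Delta=\mathcal J\ell_0(\dot\ell^+-\dot\ell^-),\qquad \Delta_1=\tfrac12\mathcal J^2\ell_0^3(\ddot\ell^+-\ddot\ell^-).$$ Then there are $v_1\ge v_0>0$, constants $c,C>0$ and smooth coordinates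 $(\tau,I)$, with smooth inverse, on $R\cap\{v>v_0\}$, with $cv\le I\le Cv$, such that $$(v+\dot\ell(t))\,dt\wedge dv=\frac{4}{\mathcal J}\,d\tau\wedge dI,$$ and such that at the points of $R$ with $v>v_1$ the map $F$ is defined, has values in $R\cap\{v>v_0\}$, and is given in these coordinates by $$F(\tau,I)=\hat F(\tau,I)+F_1(\tau,I)+r(\tau,I),$$ where $\hat F(\tau,I)=(\bar\tau,\ I+\Delta(\bar\tau-\tfrac12))$ with $\bar\tau=\tau-I \bmod 1\in[0,1)$, and $F_1(\tau,I)=I^{-1}\bigl(0,\ \Delta_1((\bar\tau-\tfrac12)^2-\tfrac1{12})\bigr)$. On each of the sets $\{\lfloor\tau-I\rfloor=n\}$, $n\in\mathbb Z$, the remainder $r$ is $C^5$, and $r$ and its derivatives up to order $5$ are bounded there by $CI^{-2}$, with $C$ independent of $n$. -/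

import Mathlib

open Set
open scoped ContDiff

noncomputable section

/-- Admissible distance `ℓ` between the walls: positive, `1`-periodic, and smooth up to the
endpoints on the period `[0,1]`.  Thus `ℓ` is Lipschitz, and its derivatives may jump only at
integer times. -/
structure IsWallMotion (ℓ : ℝ → ℝ) : Prop where
  pos : ∀ t, 0 < ℓ t
  periodic : ∀ t, ℓ (t + 1) = ℓ t
  smooth : ∃ g : ℝ → ℝ, ContDiff ℝ ∞ g ∧ EqOn ℓ g (Icc 0 1)

/-- `ℓ̇ (t)`.  This is the derivative of `ℓ` at non-integer `t`, and the right
derivative `ℓ̇⁺` at the singular (integer) times. -/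
def wallSpeed (ℓ : ℝ → ℝ) (t : ℝ) : ℝ := derivWithin ℓ (Ici t) t

/-- The one-sided derivative of order `k` of `ℓ` at `0⁺`. -/
def derivPlus (ℓ : ℝ → ℝ) (k : ℕ) : ℝ := iteratedDerivWithin k ℓ (Icc 0 1) 0

/-- The one-sided derivative of order `k` of `ℓ` at `0⁻`. -/
def derivMinus (ℓ : ℝ → ℝ) (k : ℕ) : ℝ := iteratedDerivWithin k ℓ (Icc (-1) 0) 0

/-- `𝒥 = ∫₀¹ ℓ(s)⁻² ds`. -/
def wallJ (ℓ : ℝ → ℝ) : ℝ := ∫ s in (0 : ℝ)..1, (ℓ s ^ 2)⁻¹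

/-- `Δ = 𝒥 ℓ₀ (ℓ̇⁺ - ℓ̇⁻)`. -/
def wallDelta (ℓ : ℝ → ℝ) : ℝ := wallJ ℓ * ℓ 0 * (derivPlus ℓ 1 - derivMinus ℓ 1)

/-- `Δ₁ = ½ 𝒥² ℓ₀³ (ℓ̈⁺ - ℓ̈⁻)`. -/
def wallDelta₁ (ℓ : ℝ → ℝ) : ℝ :=
  1 / 2 * wallJ ℓ ^ 2 * ℓ 0 ^ 3 * (derivPlus ℓ 2 - derivMinus ℓ 2)

/-- The collision space: pairs `(t, v)`, where `t` is the time modulo `1` of a collision with the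
moving wall (the circle is represented by `[0,1)`) and `v > -ℓ̇ (t)` is the velocity of the ball
just after the collision. -/
def collisionSpace (ℓ : ℝ → ℝ) : Set (ℝ × ℝ) :=
  {x | x.1 ∈ Ico (0 : ℝ) 1 ∧ -wallSpeed ℓ x.1 < x.2}

/-- Time until the next collision with the moving wall.  Put the fixed wall at `0` and the moving
wall at `-ℓ`; the ball that leaves the moving wall at time `t` with velocity `v`, and bounces
elastically off the fixed wall, is at `-|ℓ t - v s|` at time `t + s`.  For large `v` the only
`s > 0` in the set is the solution of `s = (ℓ t + ℓ (t + s)) / v`. -/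
def flightTime (ℓ : ℝ → ℝ) (x : ℝ × ℝ) : ℝ :=
  sInf {s : ℝ | 0 < s ∧ |ℓ x.1 - x.2 * s| = ℓ (x.1 + s)}

/-- The collision map `f`.  If the ball meets the fixed wall first (always so for large `v`), it
comes back with velocity `-v` and `f (t, v) = (t + δt mod 1, v - 2 ℓ̇ (t + δt))`; if it is caught
by the moving wall before that, it comes with velocity `v`. -/
def collisionMap (ℓ : ℝ → ℝ) (x : ℝ × ℝ) : ℝ × ℝ :=
  (Int.fract (x.1 + flightTime ℓ x),
    (if ℓ x.1 < x.2 * flightTime ℓ x then x.2 else -x.2)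
      - 2 * wallSpeed ℓ (x.1 + flightTime ℓ x))

/-- The singularity line `S = {t = 0}`. -/
def singularityLine (ℓ : ℝ → ℝ) : Set (ℝ × ℝ) := {x ∈ collisionSpace ℓ | x.1 = 0}

/-- The strip `R` between `S` (included) and `f S` (excluded). -/
def strip (ℓ : ℝ → ℝ) : Set (ℝ × ℝ) :=
  {x ∈ collisionSpace ℓ | ∃ y ∈ collisionMap ℓ '' singularityLine ℓ, y.2 = x.2 ∧ x.1 < y.1}

/-- The first time `n ≥ 1` at which the orbit of `x` under `f` is in `A` (`0` if there is none). -/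
def firstReturnTime {X : Type*} (f : X → X) (A : Set X) (x : X) : ℕ :=
  sInf {n : ℕ | 0 < n ∧ f^[n] x ∈ A}

/-- The first return map of `f` to `A`. -/
def firstReturn {X : Type*} (f : X → X) (A : Set X) (x : X) : X :=
  f^[firstReturnTime f A x] x

/-- The map `F̂ (τ, I) = (τ̄, I + Δ (τ̄ - 1/2))` with `τ̄ = τ - I mod 1`. -/
def normalForm (Δ : ℝ) (p : ℝ × ℝ) : ℝ × ℝ :=
  (Int.fract (p.1 - p.2), p.2 + Δ * (Int.fract (p.1 - p.2) - 1 / 2))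

/-- The correction `F₁ (τ, I) = I⁻¹ (0, Δ₁ ((τ̄ - 1/2)² - 1/12))` with `τ̄ = τ - I mod 1`. -/
def normalFormCorrection (Δ₁ : ℝ) (p : ℝ × ℝ) : ℝ × ℝ :=
  p.2⁻¹ • ((0 : ℝ), Δ₁ * ((Int.fract (p.1 - p.2) - 1 / 2) ^ 2 - 1 / 12))

/-- The remainder `r = F - F̂ - F₁`, where `F` is the first return map to the strip, written in the
coordinates `(τ, I) = Φ (t, v)`. -/
def remainder (ℓ : ℝ → ℝ) (Φ : PartialEquiv (ℝ × ℝ) (ℝ × ℝ)) (p : ℝ × ℝ) : ℝ × ℝ :=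
  Φ (firstReturn (collisionMap ℓ) (strip ℓ) (Φ.symm p))
    - (normalForm (wallDelta ℓ) p + normalFormCorrection (wallDelta₁ ℓ) p)

/-- The part with `v > v₁` of the coordinate domain on which `⌊τ - I⌋ = n`; on it the function
`τ - I mod 1` is smooth. -/
def piece (Φ : PartialEquiv (ℝ × ℝ) (ℝ × ℝ)) (v₁ : ℝ) (n : ℤ) : Set (ℝ × ℝ) :=
  {p ∈ Φ.target | v₁ < (Φ.symm p).2 ∧ ⌊p.1 - p.2⌋ = n}

end

/-! Between two integer times the wall moves smoothly, and a fast ball then has an adiabatic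
invariant. On one period `ℓ` is replaced by a smooth positive extension `g`. In the coordinates
`angleAction`, with action I = (J/2)√(g²u² + (2/3)g³g̈), u the velocity relative to the wall, and
angle a = I·J⁻¹∫₀ᵗ g⁻², a collision is (a, I) ↦ (a + 1, I) + I⁻³e(a/I, 1/I), where e is smooth up to
1/I = 0 (`exists_step_normal_form`). A period takes about I collisions, so the errors, derivatives
included, add up to O(I⁻²) (`exists_iterate_shiftMap_bound`).

The kick comes from the flight that passes an integer time. The collision that ends it is compared
with the one that would take place if the wall went on along `g` past t = 1. Both have the same
arrival speed and the same bounce off the fixed wall, hence the same phase s up to O(I⁻²). The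
expansions of the two actions in inverse powers of the velocity then differ by Δ(s - 1/2) + Δ₁I⁻¹((s
- 1/2)² - 1/12) + O(I⁻²) (`exists_crossing_normal_form`). The angle at t = 1 equals I, so s = a - I
after the last virtual collision. The first return is therefore `crossMap` after m steps of
`shiftMap e`, with m the first index for which a - I ≥ 0 (`IsWallMotion.exists_return`).

The index m jumps across the curves `slack e m = 0`, which are only O(m⁻²)-close to the lines a + m
= I of the normal form. A remainder that is small and smooth on the exact pieces ⌊τ - I⌋ = n
requires curves and lines to coincide. `exists_straightening` supplies an area-preserving R, with R
- id = O(m⁻²), that moves the curves onto the lines and keeps the sign of the angle. The coordinates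
are (τ, I) = R ∘ `angleAction`; `det_fderiv_angleAction` gives the area form and `jetO_return_sub`
the bound for the remainder. -/

open Filter Topology

/-! ### Pointwise bounds on jets -/

section Jets

variable {E F G : Type*} [NormedAddCommGroup E] [NormedSpace ℝ E] [NormedAddCommGroup F]
  [NormedSpace ℝ F] [NormedAddCommGroup G] [NormedSpace ℝ G]

/-- `f` is `C^K` at `x`, with derivatives of order `0, …, K` bounded by `C`. -/
def JetBound (K : ℕ) (f : E → F) (x : E) (C : ℝ) : Prop :=
  ContDiffAt ℝ K f x ∧ ∀ k ≤ K, ‖iteratedFDeriv ℝ k f x‖ ≤ C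

/-- `f` is `C^K` at `x`, with derivatives of order `1, …, K` bounded by `C`. -/
def DerivBound (K : ℕ) (f : E → F) (x : E) (C : ℝ) : Prop :=
  ContDiffAt ℝ K f x ∧ ∀ k, 1 ≤ k → k ≤ K → ‖iteratedFDeriv ℝ k f x‖ ≤ C

variable {K : ℕ} {f g : E → F} {x : E} {C D : ℝ}

theorem JetBound.nonneg (h : JetBound K f x C) : 0 ≤ C :=
  (norm_nonneg _).trans (h.2 0 (Nat.zero_le _))

theorem JetBound.norm_le (h : JetBound K f x C) : ‖f x‖ ≤ C := by
  simpa using h.2 0 (Nat.zero_le _)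

theorem JetBound.mono (h : JetBound K f x C) (hCD : C ≤ D) : JetBound K f x D :=
  ⟨h.1, fun k hk => (h.2 k hk).trans hCD⟩

theorem DerivBound.mono (h : DerivBound K f x C) (hCD : C ≤ D) : DerivBound K f x D :=
  ⟨h.1, fun k hk hk' => (h.2 k hk hk').trans hCD⟩

theorem JetBound.derivBound (h : JetBound K f x C) : DerivBound K f x C :=
  ⟨h.1, fun k _ hk => h.2 k hk⟩

theorem JetBound.congr (h : JetBound K f x C) (hfg : g =ᶠ[𝓝 x] f) : JetBound K g x C :=
  ⟨h.1.congr_of_eventuallyEq hfg, fun k hk => by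
    rw [(hfg.iteratedFDeriv ℝ k).eq_of_nhds]; exact h.2 k hk⟩

theorem DerivBound.congr (h : DerivBound K f x C) (hfg : g =ᶠ[𝓝 x] f) : DerivBound K g x C :=
  ⟨h.1.congr_of_eventuallyEq hfg, fun k hk hk' => by
    rw [(hfg.iteratedFDeriv ℝ k).eq_of_nhds]; exact h.2 k hk hk'⟩

theorem JetBound.add (hf : JetBound K f x C) (hg : JetBound K g x D) :
    JetBound K (fun y => f y + g y) x (C + D) := by
  refine ⟨hf.1.add hg.1, fun k hk => ?_⟩
  have hk' : (k : ℕ∞ω) ≤ K := by exact_mod_cast hk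
  have := iteratedFDeriv_add_apply (hf.1.of_le hk') (hg.1.of_le hk')
  change ‖iteratedFDeriv ℝ k (f + g) x‖ ≤ _
  rw [this]
  exact (norm_add_le _ _).trans (add_le_add (hf.2 k hk) (hg.2 k hk))

theorem DerivBound.add (hf : DerivBound K f x C) (hg : DerivBound K g x D) :
    DerivBound K (fun y => f y + g y) x (C + D) := by
  refine ⟨hf.1.add hg.1, fun k hk0 hk => ?_⟩
  have hk' : (k : ℕ∞ω) ≤ K := by exact_mod_cast hk
  have := iteratedFDeriv_add_apply (hf.1.of_le hk') (hg.1.of_le hk')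
  change ‖iteratedFDeriv ℝ k (f + g) x‖ ≤ _
  rw [this]
  exact (norm_add_le _ _).trans (add_le_add (hf.2 k hk0 hk) (hg.2 k hk0 hk))

theorem JetBound.clm_comp (L : F →L[ℝ] G) (hf : JetBound K f x C) :
    JetBound K (fun y => L (f y)) x (‖L‖ * C) := by
  refine ⟨L.contDiff.contDiffAt.comp x hf.1, fun k hk => ?_⟩
  have hk' : (k : ℕ∞ω) ≤ K := by exact_mod_cast hk
  exact (L.norm_iteratedFDeriv_comp_left hf.1 hk').trans
    (mul_le_mul_of_nonneg_left (hf.2 k hk) (norm_nonneg _))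

theorem JetBound.neg (hf : JetBound K f x C) : JetBound K (fun y => - f y) x C := by
  refine ⟨hf.1.neg, fun k hk => ?_⟩
  change ‖iteratedFDeriv ℝ k (-f) x‖ ≤ _
  rw [iteratedFDeriv_neg_apply, norm_neg]
  exact hf.2 k hk

theorem JetBound.sub (hf : JetBound K f x C) (hg : JetBound K g x D) :
    JetBound K (fun y => f y - g y) x (C + D) := by
  simpa [sub_eq_add_neg] using hf.add hg.neg

theorem JetBound.prodMk {g : E → G} (hf : JetBound K f x C) (hg : JetBound K g x C) :
    JetBound K (fun y => (f y, g y)) x C := by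
  refine ⟨hf.1.prodMk hg.1, fun k hk => ?_⟩
  have hk' : (k : ℕ∞ω) ≤ K := by exact_mod_cast hk
  rw [iteratedFDeriv_prodMk hf.1 hg.1 hk', ContinuousMultilinearMap.opNorm_prod]
  exact max_le (hf.2 k hk) (hg.2 k hk)

/-- A `C^K` map at a point is `C^K` on an open neighbourhood, on which iterated derivatives
may be computed within the neighbourhood. -/
theorem ContDiffAt.exists_isOpen {n : ℕ} (hf : ContDiffAt ℝ n f x) :
    ∃ u, IsOpen u ∧ x ∈ u ∧ ContDiffOn ℝ n f u := by
  obtain ⟨u, hu, hfu⟩ := hf.contDiffOn le_rfl (by simp)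
  obtain ⟨v, hvu, hv, hxv⟩ := mem_nhds_iff.1 hu
  exact ⟨v, hv, hxv, hfu.mono (hvu.trans (by simp))⟩

theorem JetBound.mul {f g : E → ℝ} (hf : JetBound K f x C) (hg : JetBound K g x D) :
    JetBound K (fun y => f y * g y) x (2 ^ K * (C * D)) := by
  refine ⟨hf.1.mul hg.1, fun k hk => ?_⟩
  obtain ⟨u, hu, hxu, hfu⟩ := hf.1.exists_isOpen
  obtain ⟨v, hv, hxv, hgv⟩ := hg.1.exists_isOpen
  have huv : IsOpen (u ∩ v) := hu.inter hv
  have hx : x ∈ u ∩ v := ⟨hxu, hxv⟩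
  have hk' : (k : ℕ∞ω) ≤ K := by exact_mod_cast hk
  have key := norm_iteratedFDerivWithin_mul_le (hfu.mono inter_subset_left)
    (hgv.mono inter_subset_right) huv.uniqueDiffOn hx hk'
  simp only [iteratedFDerivWithin_of_isOpen _ huv hx] at key
  refine key.trans ?_
  have h1 : ∀ i ∈ Finset.range (k + 1), (k.choose i : ℝ) * ‖iteratedFDeriv ℝ i f x‖ *
      ‖iteratedFDeriv ℝ (k - i) g x‖ ≤ (k.choose i : ℝ) * (C * D) := by
    intro i hi
    have hik : i ≤ k := Nat.lt_succ_iff.1 (Finset.mem_range.1 hi)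
    rw [mul_assoc]
    exact mul_le_mul_of_nonneg_left (mul_le_mul (hf.2 i (hik.trans hk))
      (hg.2 _ ((Nat.sub_le _ _).trans hk)) (norm_nonneg _) hf.nonneg) (Nat.cast_nonneg _)
  refine (Finset.sum_le_sum h1).trans ?_
  rw [← Finset.sum_mul, ← Nat.cast_sum, Nat.sum_range_choose]
  push_cast
  exact mul_le_mul_of_nonneg_right (pow_le_pow_right₀ (by norm_num) hk)
    (mul_nonneg hf.nonneg hg.nonneg)

theorem norm_iteratedFDeriv_comp_le_of_contDiffAt {g : F → G} {f : E → F} {n : ℕ} {x : E}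
    (hg : ContDiffAt ℝ n g (f x)) (hf : ContDiffAt ℝ n f x) {C D : ℝ}
    (hC : ∀ i ≤ n, ‖iteratedFDeriv ℝ i g (f x)‖ ≤ C)
    (hD : ∀ i, 1 ≤ i → i ≤ n → ‖iteratedFDeriv ℝ i f x‖ ≤ D ^ i) :
    ‖iteratedFDeriv ℝ n (g ∘ f) x‖ ≤ n.factorial * C * D ^ n := by
  obtain ⟨v, hv, hxv, hgv⟩ := hg.exists_isOpen
  obtain ⟨u, hu, hxu, hfu⟩ := hf.exists_isOpen
  have hw : IsOpen (u ∩ f ⁻¹' v) := hfu.continuousOn.isOpen_inter_preimage hu hv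
  have hxw : x ∈ u ∩ f ⁻¹' v := ⟨hxu, hxv⟩
  have key := norm_iteratedFDerivWithin_comp_le (n := n) (C := C) (D := D) hgv
    (hfu.mono inter_subset_left) le_rfl
    hv.uniqueDiffOn hw.uniqueDiffOn (fun y hy => hy.2) hxw
    (fun i hi => by rw [iteratedFDerivWithin_of_isOpen _ hv hxv]; exact hC i hi)
    (fun i hi hi' => by rw [iteratedFDerivWithin_of_isOpen _ hw hxw]; exact hD i hi hi')
  rwa [iteratedFDerivWithin_of_isOpen _ hw hxw] at key

/-- Only derivatives of positive order of the inner map enter. This is the reason for `DerivBound`: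
maps such as p ↦ p + (m, 0) have values that grow with m, but uniformly bounded derivatives. -/
theorem JetBound.comp {g : F → G} (hg : JetBound K g (f x) C) (hf : DerivBound K f x D)
    (hD : 1 ≤ D) : JetBound K (fun y => g (f y)) x (K.factorial * C * D ^ K) := by
  refine ⟨hg.1.comp x hf.1, fun k hk => ?_⟩
  have hk' : (k : ℕ∞ω) ≤ K := by exact_mod_cast hk
  refine (norm_iteratedFDeriv_comp_le_of_contDiffAt (hg.1.of_le hk') (hf.1.of_le hk') (C := C)
    (D := D) (fun i hi => hg.2 i (hi.trans hk)) (fun i hi hi' => ?_)).trans ?_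
  · exact (hf.2 i hi (hi'.trans hk)).trans (le_self_pow₀ hD (by omega))
  · have := hg.nonneg
    gcongr

theorem DerivBound.affine (L : E →L[ℝ] F) (c : F) (hL : ‖L‖ ≤ C) :
    DerivBound K (fun y => L y + c) x C := by
  refine ⟨(L.contDiff.add contDiff_const).contDiffAt, fun k hk0 hk => ?_⟩
  have hC : 0 ≤ C := (norm_nonneg _).trans hL
  have hfd : fderiv ℝ (fun y => L y + c) = fun _ => L := by
    ext1 y
    exact (L.hasFDerivAt.add_const c).fderiv
  obtain ⟨j, rfl⟩ : ∃ j, k = j + 1 := ⟨k - 1, by omega⟩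
  rw [← norm_iteratedFDeriv_fderiv, hfd]
  rcases Nat.eq_zero_or_pos j with rfl | hj
  · simpa using hL
  · rw [iteratedFDeriv_const_of_ne (by omega)]
    simpa using hC

/-- If `φ = A + ε ∘ φ` with `A` affine of norm at most `1` and `ε` small, then the derivatives of
`φ` are bounded. -/
theorem DerivBound.of_eq_add_comp {φ A : E → F} {ε : F → F} {κ : ℝ}
    (hφ : ContDiffAt ℝ K φ x) (hA : DerivBound K A x 1) (hε : JetBound K ε (φ x) κ)
    (h : φ =ᶠ[𝓝 x] fun y => A y + ε (φ y)) (hκ : K.factorial * κ ≤ 1 / 2) :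
    DerivBound K φ x (2 ^ K) := by
  set B : ℕ → ℝ := fun i => ‖iteratedFDeriv ℝ i φ x‖ with hB
  have hB0 : ∀ i, 0 ≤ B i := fun i => norm_nonneg _
  have step : ∀ D : ℝ, 1 ≤ D → (∀ i, 1 ≤ i → i ≤ K → B i ≤ D ^ i) →
      ∀ i, 1 ≤ i → i ≤ K → B i ≤ 1 + D ^ i / 2 := by
    intro D hD hDi i hi hiK
    have hk' : (i : ℕ∞ω) ≤ K := by exact_mod_cast hiK
    have hεφ : ContDiffAt ℝ i (ε ∘ φ) x := (hε.1.comp x hφ).of_le hk'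
    have e1 : iteratedFDeriv ℝ i φ x = iteratedFDeriv ℝ i A x + iteratedFDeriv ℝ i (ε ∘ φ) x := by
      rw [(h.iteratedFDeriv ℝ i).eq_of_nhds]
      exact iteratedFDeriv_add_apply (hA.1.of_le hk') hεφ
    have e2 := norm_iteratedFDeriv_comp_le_of_contDiffAt (hε.1.of_le hk') (hφ.of_le hk') (C := κ)
      (D := D) (fun j hj => hε.2 j (hj.trans hiK)) (fun j hj hj' => hDi j hj (hj'.trans hiK))
    have e3 : (i.factorial : ℝ) * κ ≤ 1 / 2 := le_trans (mul_le_mul_of_nonneg_right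
      (by exact_mod_cast Nat.factorial_le hiK) hε.nonneg) hκ
    have e4 : (i.factorial : ℝ) * κ * D ^ i ≤ 1 / 2 * D ^ i :=
      mul_le_mul_of_nonneg_right e3 (by positivity)
    calc B i = ‖iteratedFDeriv ℝ i A x + iteratedFDeriv ℝ i (ε ∘ φ) x‖ := by rw [hB]; simp only [e1]
      _ ≤ 1 + 1 / 2 * D ^ i := (norm_add_le _ _).trans (add_le_add (hA.2 i hi hiK) (e2.trans e4))
      _ = 1 + D ^ i / 2 := by ring
  have main : ∀ i, 1 ≤ i → i ≤ K → B i ≤ 2 ^ i := by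
    rcases Nat.eq_zero_or_pos K with rfl | hK
    · intro i h1 h2; omega
    -- The best geometric bound is D₀ = max B_i^(1/i). If it exceeded 2, `step` at the maximising
    -- index would give D₀^i₀ ≤ 1 + D₀^i₀ / 2, that is D₀^i₀ ≤ 2, a contradiction.
    obtain ⟨i₀, hi₀, hmax⟩ := Finset.exists_max_image (Finset.Icc 1 K)
      (fun i => B i ^ ((i : ℝ)⁻¹)) ⟨1, Finset.mem_Icc.2 ⟨le_rfl, hK⟩⟩
    rw [Finset.mem_Icc] at hi₀
    set D₀ := B i₀ ^ ((i₀ : ℝ)⁻¹) with hD₀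
    have hroot : ∀ i, 1 ≤ i → (B i ^ ((i : ℝ)⁻¹)) ^ i = B i := fun i hi =>
      Real.rpow_inv_natCast_pow (hB0 i) (by omega)
    have hle : ∀ i, 1 ≤ i → i ≤ K → B i ≤ (max 2 D₀) ^ i := by
      intro i h1 h2
      rw [← hroot i h1]
      exact pow_le_pow_left₀ (Real.rpow_nonneg (hB0 i) _)
        ((hmax i (Finset.mem_Icc.2 ⟨h1, h2⟩)).trans (le_max_right _ _)) i
    rcases le_or_gt D₀ 2 with h2 | h2
    · rwa [max_eq_left h2] at hle
    · exfalso
      rw [max_eq_right h2.le] at hle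
      have h3 := step D₀ (by linarith) hle i₀ hi₀.1 hi₀.2
      rw [← hroot i₀ hi₀.1, ← hD₀] at h3
      have h4 : D₀ ≤ D₀ ^ i₀ := le_self_pow₀ (by linarith) (by omega)
      linarith
  refine ⟨hφ, fun k hk hk' => (main k hk hk').trans (pow_le_pow_right₀ (by norm_num) hk')⟩

end Jets

/-! ### Smooth dependence on parameters -/

/-- Differentiation under the integral yields an integral of the same kind with values in linear
maps. The target space is therefore quantified inside the induction on the order. -/
theorem contDiff_intervalIntegral_of_contDiff {E : Type} [NormedAddCommGroup E] [NormedSpace ℝ E]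
    [FiniteDimensional ℝ E] : ∀ (n : ℕ) {F : Type} [NormedAddCommGroup F] [NormedSpace ℝ F]
    [CompleteSpace F] {G : E × ℝ → F}, ContDiff ℝ ∞ G →
      ContDiff ℝ n (fun x => ∫ r in (0 : ℝ)..1, G (x, r)) := by
  have key : ∀ {F : Type} [NormedAddCommGroup F] [NormedSpace ℝ F]
    [CompleteSpace F] {G : E × ℝ → F}, ContDiff ℝ ∞ G → ∀ x₀,
      HasFDerivAt (fun x => ∫ r in (0 : ℝ)..1, G (x, r))
        (∫ r in (0 : ℝ)..1, (fderiv ℝ G (x₀, r)).comp (ContinuousLinearMap.inl ℝ E ℝ)) x₀ := by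
    intro F _ _ _ G hG x₀
    have hcont : Continuous fun p : E × ℝ =>
        (fderiv ℝ G p).comp (ContinuousLinearMap.inl ℝ E ℝ) :=
      (hG.continuous_fderiv (by simp)).clm_comp continuous_const
    obtain ⟨b, hb⟩ := ((isCompact_closedBall x₀ 1).prod
      (isCompact_Icc (a := (0:ℝ)) (b := 1))).exists_bound_of_continuousOn hcont.continuousOn
    refine intervalIntegral.hasFDerivAt_integral_of_dominated_of_fderiv_le
      (F' := fun x r => (fderiv ℝ G (x, r)).comp (ContinuousLinearMap.inl ℝ E ℝ))
      (bound := fun _ => b) (Metric.closedBall_mem_nhds x₀ one_pos) ?_ ?_ ?_ ?_ ?_ ?_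
    · exact Eventually.of_forall fun x =>
        (hG.continuous.comp (by fun_prop)).aestronglyMeasurable
    · exact (hG.continuous.comp (by fun_prop : Continuous fun r : ℝ => (x₀, r))).intervalIntegrable _ _
    · exact (hcont.comp (by fun_prop : Continuous fun r : ℝ => (x₀, r))).aestronglyMeasurable
    · refine Eventually.of_forall fun r hr x hx => hb (x, r) ⟨hx, ?_⟩
      rw [uIoc_of_le zero_le_one] at hr
      exact ⟨hr.1.le, hr.2⟩
    · exact intervalIntegrable_const
    · refine Eventually.of_forall fun r hr x hx => ?_
      have h1 : HasFDerivAt G (fderiv ℝ G (x, r)) (x, r) :=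
        (hG.differentiable (by simp) (x, r)).hasFDerivAt
      exact h1.comp x (hasFDerivAt_prodMk_left x r)
  intro n
  induction n with
  | zero =>
    intro F _ _ _ G hG
    rw [Nat.cast_zero, contDiff_zero]
    exact continuous_iff_continuousAt.2 fun x => (key hG x).continuousAt
  | succ n ih =>
    intro F _ _ _ G hG
    rw [Nat.cast_succ, contDiff_succ_iff_hasFDerivAt (𝕜 := ℝ)]
    exact ⟨_, ih ((hG.fderiv_right (m := ∞) (by simp)).clm_comp contDiff_const), key hG⟩

/-- Taylor's formula with a remainder that depends smoothly on the base point. -/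
theorem exists_taylor_remainder {γ : ℝ → ℝ} (hγ : ContDiff ℝ ∞ γ) (n : ℕ) :
    ∃ ρ : ℝ × ℝ → ℝ, ContDiff ℝ ∞ ρ ∧ ∀ t δ, γ (t + δ) =
      ∑ k ∈ Finset.range (n + 1), (k.factorial : ℝ)⁻¹ * iteratedDeriv k γ t * δ ^ k
        + δ ^ (n + 1) * ρ (t, δ) := by
  have hd : ContDiff ℝ ∞ (iteratedDeriv (n + 1) γ) := by
    rw [iteratedDeriv_eq_iterate]
    exact hγ.iterate_deriv (n + 1)
  refine ⟨fun p => (n.factorial : ℝ)⁻¹ *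
    ∫ r in (0 : ℝ)..1, (1 - r) ^ n * iteratedDeriv (n + 1) γ (p.1 + r * p.2), ?_, ?_⟩
  · refine contDiff_const.mul (contDiff_infty.2 fun m => ?_)
    exact contDiff_intervalIntegral_of_contDiff (E := ℝ × ℝ) m
      (G := fun q => (1 - q.2) ^ n * iteratedDeriv (n + 1) γ (q.1.1 + q.2 * q.1.2)) (by fun_prop)
  · intro t δ
    have := map_add_eq_sum_add_integral_iteratedFDeriv (n := n) (f := γ) (x := t) (y := δ)
      (fun r _ => (hγ.of_le (by exact_mod_cast le_top)).contDiffAt)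
    rw [this]
    have e : ∀ k y, iteratedFDeriv ℝ k γ y (fun _ => δ) = iteratedDeriv k γ y * δ ^ k := by
      intro k y
      have := iteratedFDeriv_apply_eq_iteratedDeriv_mul_prod (n := k) (f := γ) (x := y)
        (m := fun _ => δ) (𝕜 := ℝ)
      simpa [mul_comm] using this
    simp only [e, smul_eq_mul]
    congr 1
    · exact Finset.sum_congr rfl fun k _ => by ring
    · have : ∀ r : ℝ, (1 - r) ^ n * (iteratedDeriv (n + 1) γ (t + r * δ) * δ ^ (n + 1)) =
        δ ^ (n + 1) * ((1 - r) ^ n * iteratedDeriv (n + 1) γ (t + r * δ)) := fun r => by ring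
      simp only [this, intervalIntegral.integral_const_mul]
      ring

/-! ### Inverse functions near compact sets, and cut-offs -/

section Inverse

variable {E : Type*} [NormedAddCommGroup E] [NormedSpace ℝ E] [FiniteDimensional ℝ E]

theorem exists_openPartialHomeomorph_of_injOn {f : E → E} {U : Set E} (hU : IsOpen U)
    (hf : ContDiffOn ℝ ∞ f U) (inj : InjOn f U) (hdet : ∀ x ∈ U, (fderiv ℝ f x).det ≠ 0) :
    ∃ Φ : OpenPartialHomeomorph E E, Φ.source = U ∧ (∀ x, Φ x = f x) ∧
      ContDiffOn ℝ ∞ Φ.symm Φ.target := by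
  have : CompleteSpace E := FiniteDimensional.complete ℝ E
  have hat : ∀ x ∈ U, ContDiffAt ℝ ∞ f x := fun x hx => hf.contDiffAt (hU.mem_nhds hx)
  have hder : ∀ x (hx : x ∈ U), HasFDerivAt f
      (((fderiv ℝ f x).toContinuousLinearEquivOfDetNeZero (hdet x hx) : E ≃L[ℝ] E) : E →L[ℝ] E) x := by
    intro x hx
    rw [ContinuousLinearMap.coe_toContinuousLinearEquivOfDetNeZero]
    exact ((hat x hx).differentiableAt (by simp)).hasFDerivAt
  have hopen : ∀ V ⊆ U, IsOpen V → IsOpen (f '' V) := by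
    intro V hVU hV
    rw [isOpen_iff_mem_nhds]
    rintro _ ⟨x, hx, rfl⟩
    have h1 := ((hat x (hVU hx)).hasStrictFDerivAt' (hder x (hVU hx)) (by simp)).map_nhds_eq_of_equiv
    rw [← h1]
    exact image_mem_map (hV.mem_nhds hx)
  let e : PartialEquiv E E := inj.toPartialEquiv f U
  let Φ : OpenPartialHomeomorph E E := OpenPartialHomeomorph.ofContinuousOpenRestrict e
    hf.continuousOn (by
      intro V hV
      obtain ⟨W, hW, rfl⟩ := isOpen_induced_iff.1 hV
      have : e.source.domRestrict e '' (Subtype.val ⁻¹' W) = f '' (U ∩ W) := by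
        ext y
        constructor
        · rintro ⟨⟨x, hx⟩, hxW, rfl⟩
          exact ⟨x, ⟨hx, hxW⟩, rfl⟩
        · rintro ⟨x, ⟨hx, hxW⟩, rfl⟩
          exact ⟨⟨x, hx⟩, hxW, rfl⟩
      rw [this]
      exact hopen _ inter_subset_left (hU.inter hW)) hU
  refine ⟨Φ, rfl, fun x => rfl, fun y hy => ?_⟩
  have hsx : Φ.symm y ∈ U := Φ.map_target hy
  exact (Φ.contDiffAt_symm hy (hder _ hsx) (hat _ hsx)).contDiffWithinAt

/-- Injectivity on a compact set together with local invertibility along it extends to a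
neighbourhood. The compact set will be a segment at infinite velocity, where the maps are explicit;
the neighbourhood covers all large velocities. -/
theorem exists_openPartialHomeomorph_near_isCompact {f : E → E} {O k : Set E} (hO : IsOpen O)
    (hf : ContDiffOn ℝ ∞ f O) (hk : IsCompact k) (hkO : k ⊆ O) (inj : InjOn f k)
    (hdet : ∀ x ∈ k, (fderiv ℝ f x).det ≠ 0) :
    ∃ Φ : OpenPartialHomeomorph E E, k ⊆ Φ.source ∧ Φ.source ⊆ O ∧ (∀ x, Φ x = f x) ∧
      ContDiffOn ℝ ∞ Φ.symm Φ.target := by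
  have : CompleteSpace E := FiniteDimensional.complete ℝ E
  have hat : ∀ x ∈ O, ContDiffAt ℝ ∞ f x := fun x hx => hf.contDiffAt (hO.mem_nhds hx)
  obtain ⟨U, hU, hkU, hUinj⟩ := inj.exists_isOpen_superset hk
    (fun x hx => (hat x (hkO hx)).continuousAt) (fun x hx => by
      have hder : HasFDerivAt f
          (((fderiv ℝ f x).toContinuousLinearEquivOfDetNeZero (hdet x hx) : E ≃L[ℝ] E) : E →L[ℝ] E)
          x := by
        rw [ContinuousLinearMap.coe_toContinuousLinearEquivOfDetNeZero]
        exact ((hat x (hkO hx)).differentiableAt (by simp)).hasFDerivAt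
      have hs := (hat x (hkO hx)).hasStrictFDerivAt' hder (by simp)
      refine ⟨(hs.toOpenPartialHomeomorph f).source, (hs.toOpenPartialHomeomorph f).open_source.mem_nhds
        hs.mem_toOpenPartialHomeomorph_source, (hs.toOpenPartialHomeomorph f).injOn⟩)
  have hdc : ContinuousOn (fun x => (fderiv ℝ f x).det) O :=
    ContinuousLinearMap.continuous_det.comp_continuousOn
      (hf.continuousOn_fderiv_of_isOpen hO (by simp))
  have hV : IsOpen (O ∩ (fun x => (fderiv ℝ f x).det) ⁻¹' {0}ᶜ) :=
    hdc.isOpen_inter_preimage hO isOpen_compl_singleton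
  obtain ⟨Φ, h1, h2, h3⟩ := exists_openPartialHomeomorph_of_injOn (hU.inter hV)
    (hf.mono (inter_subset_right.trans inter_subset_left)) (hUinj.mono inter_subset_left)
    (fun x hx => hx.2.2)
  refine ⟨Φ, ?_, ?_, h2, h3⟩
  · rw [h1]; exact fun x hx => ⟨hkU hx, hkO hx, hdet x hx⟩
  · rw [h1]; exact fun x hx => hx.2.1

open scoped Manifold in
theorem exists_contDiff_cutoff {k O : Set E} (hk : IsCompact k) (hO : IsOpen O) (hkO : k ⊆ O) :
    ∃ χ : E → ℝ, ContDiff ℝ ∞ χ ∧ HasCompactSupport χ ∧ tsupport χ ⊆ O ∧ (∀ᶠ x in 𝓝ˢ k, χ x = 1) ∧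
      ∀ x, χ x ∈ Icc (0 : ℝ) 1 := by
  have : ProperSpace E := FiniteDimensional.proper ℝ E
  obtain ⟨L, hL, hkL, hLO⟩ := exists_compact_between hk hO hkO
  obtain ⟨χ, h1, h2, h3⟩ := exists_contMDiffMap_one_nhds_of_subset_interior (n := (⊤ : ℕ∞)) 𝓘(ℝ, E)
    hk.isClosed hkL
  have hsub : tsupport χ ⊆ L := closure_minimal (fun x hx => by
    by_contra h; exact hx (h2 x h)) hL.isClosed
  exact ⟨χ, χ.contMDiff.contDiff, hL.of_isClosed_subset (isClosed_tsupport _) hsub,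
    hsub.trans hLO, h1, h3⟩

/-- Error terms arise only near infinite velocity. Cutting them off makes them smooth on the whole
space, so that later compositions carry no domains. -/
theorem exists_contDiff_extension {F : Type*} [NormedAddCommGroup F] [NormedSpace ℝ F]
    {f : E → F} {k O : Set E} (hk : IsCompact k)
    (hO : IsOpen O) (hkO : k ⊆ O) (hf : ContDiffOn ℝ ∞ f O) :
    ∃ f' : E → F, ContDiff ℝ ∞ f' ∧ HasCompactSupport f' ∧ ∀ᶠ x in 𝓝ˢ k, f' x = f x := by
  obtain ⟨χ, h1, h2, h3, h4, -⟩ := exists_contDiff_cutoff hk hO hkO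
  refine ⟨fun x => χ x • f x, contDiff_iff_contDiffAt.2 fun x => ?_, h2.smul_right, ?_⟩
  · by_cases hx : x ∈ O
    · exact h1.contDiffAt.smul (hf.contDiffAt (hO.mem_nhds hx))
    · have : x ∉ tsupport χ := fun h => hx (h3 h)
      have h0 : (fun x => χ x • f x) =ᶠ[𝓝 x] fun _ => 0 := by
        filter_upwards [notMem_tsupport_iff_eventuallyEq.1 this] with y hy
        simp [hy]
      exact contDiffAt_const.congr_of_eventuallyEq h0
  · filter_upwards [h4] with x hx
    simp [hx]

end Inverse

theorem det_prod_real (L : ℝ × ℝ →L[ℝ] ℝ × ℝ) :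
    L.det = (L (1, 0)).1 * (L (0, 1)).2 - (L (0, 1)).1 * (L (1, 0)).2 := by
  rw [ContinuousLinearMap.det, ← LinearMap.det_toMatrix (Module.Basis.finTwoProd ℝ),
    Matrix.det_fin_two]
  simp [LinearMap.toMatrix_apply]

/-! ### Approximate action and angle of a ball next to a smooth moving wall -/

/-- The correction that turns `g² u²` into an adiabatic invariant of second order. -/
noncomputable def actionCorrection (g : ℝ → ℝ) (t : ℝ) : ℝ := 2 / 3 * g t ^ 3 * deriv (deriv g) t

/-- The integral `∫₀ᵗ g⁻²`. -/
noncomputable def conformalTime (g : ℝ → ℝ) (t : ℝ) : ℝ := ∫ s in (0 : ℝ)..t, (g s ^ 2)⁻¹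

/-- The approximate action at time `t` and relative velocity `u`. -/
noncomputable def wallAction (g : ℝ → ℝ) (J t u : ℝ) : ℝ :=
  J / 2 * √(g t ^ 2 * u ^ 2 + actionCorrection g t)

/-- The approximate angle and action of a collision at time `x.1` with outgoing velocity `x.2`. -/
noncomputable def angleAction (g : ℝ → ℝ) (J : ℝ) (x : ℝ × ℝ) : ℝ × ℝ :=
  (wallAction g J x.1 (x.2 + deriv g x.1) * (J⁻¹ * conformalTime g x.1),
    wallAction g J x.1 (x.2 + deriv g x.1))

section SmoothWall

variable {g : ℝ → ℝ}

theorem contDiff_actionCorrection (hg : ContDiff ℝ ∞ g) : ContDiff ℝ ∞ (actionCorrection g) := by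
  have h1 : ContDiff ℝ ∞ (deriv (deriv g)) := hg.iterate_deriv 2
  unfold actionCorrection
  fun_prop

theorem continuous_inv_sq (hg : Continuous g) (h0 : ∀ t, g t ≠ 0) :
    Continuous fun s => (g s ^ 2)⁻¹ :=
  (hg.pow 2).inv₀ fun t => pow_ne_zero 2 (h0 t)

theorem hasDerivAt_conformalTime (hg : Continuous g) (h0 : ∀ t, g t ≠ 0) (t : ℝ) :
    HasDerivAt (conformalTime g) (g t ^ 2)⁻¹ t :=
  (continuous_inv_sq hg h0).integral_hasStrictDerivAt 0 t |>.hasDerivAt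

theorem deriv_conformalTime (hg : Continuous g) (h0 : ∀ t, g t ≠ 0) :
    deriv (conformalTime g) = fun t => (g t ^ 2)⁻¹ :=
  funext fun t => (hasDerivAt_conformalTime hg h0 t).deriv

theorem contDiff_conformalTime (hg : ContDiff ℝ ∞ g) (h0 : ∀ t, g t ≠ 0) :
    ContDiff ℝ ∞ (conformalTime g) := by
  rw [contDiff_infty_iff_deriv]
  refine ⟨fun t => (hasDerivAt_conformalTime hg.continuous h0 t).differentiableAt, ?_⟩
  rw [deriv_conformalTime hg.continuous h0]
  exact (hg.pow 2).inv fun t => pow_ne_zero 2 (h0 t)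

theorem strictMono_conformalTime (hg : Continuous g) (h0 : ∀ t, g t ≠ 0) :
    StrictMono (conformalTime g) :=
  strictMono_of_deriv_pos fun t => by
    rw [deriv_conformalTime hg h0]
    have := h0 t
    positivity

@[simp] theorem conformalTime_zero : conformalTime g 0 = 0 := by simp [conformalTime]

/-- `δ` times the relative velocity after the first of two collisions at times `t` and `t + δ`. -/
noncomputable def departure (g : ℝ → ℝ) (p : ℝ × ℝ) : ℝ := g p.1 + g (p.1 + p.2) + p.2 * deriv g p.1

/-- `δ` times the relative velocity after the second of two collisions at times `t` and `t + δ`. -/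
noncomputable def arrival (g : ℝ → ℝ) (p : ℝ × ℝ) : ℝ :=
  g p.1 + g (p.1 + p.2) - p.2 * deriv g (p.1 + p.2)

/-- The square of `2 δ / J` times the action after the first collision. -/
noncomputable def departureSq (g : ℝ → ℝ) (p : ℝ × ℝ) : ℝ :=
  g p.1 ^ 2 * departure g p ^ 2 + p.2 ^ 2 * actionCorrection g p.1

/-- The square of `2 δ / J` times the action after the second collision. -/
noncomputable def arrivalSq (g : ℝ → ℝ) (p : ℝ × ℝ) : ℝ :=
  g (p.1 + p.2) ^ 2 * arrival g p ^ 2 + p.2 ^ 2 * actionCorrection g (p.1 + p.2)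

theorem taylor_three {γ : ℝ → ℝ} (hγ : ContDiff ℝ ∞ γ) :
    ∃ ρ : ℝ × ℝ → ℝ, ContDiff ℝ ∞ ρ ∧ ∀ t δ, γ (t + δ) = γ t + deriv γ t * δ +
      deriv (deriv γ) t / 2 * δ ^ 2 + deriv (deriv (deriv γ)) t / 6 * δ ^ 3 + δ ^ 4 * ρ (t, δ) := by
  obtain ⟨ρ, h1, h2⟩ := exists_taylor_remainder hγ 3
  refine ⟨ρ, h1, fun t δ => ?_⟩
  rw [h2]
  simp only [Finset.sum_range_succ, Finset.sum_range_zero, iteratedDeriv_succ, iteratedDeriv_zero,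
    Nat.factorial]
  push_cast
  ring

theorem taylor_two {γ : ℝ → ℝ} (hγ : ContDiff ℝ ∞ γ) :
    ∃ ρ : ℝ × ℝ → ℝ, ContDiff ℝ ∞ ρ ∧ ∀ t δ, γ (t + δ) = γ t + deriv γ t * δ +
      deriv (deriv γ) t / 2 * δ ^ 2 + δ ^ 3 * ρ (t, δ) := by
  obtain ⟨ρ, h1, h2⟩ := exists_taylor_remainder hγ 2
  refine ⟨ρ, h1, fun t δ => ?_⟩
  rw [h2]
  simp only [Finset.sum_range_succ, Finset.sum_range_zero, iteratedDeriv_succ, iteratedDeriv_zero,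
    Nat.factorial]
  push_cast
  ring

theorem taylor_one {γ : ℝ → ℝ} (hγ : ContDiff ℝ ∞ γ) :
    ∃ ρ : ℝ × ℝ → ℝ, ContDiff ℝ ∞ ρ ∧ ∀ t δ, γ (t + δ) = γ t + deriv γ t * δ +
      δ ^ 2 * ρ (t, δ) := by
  obtain ⟨ρ, h1, h2⟩ := exists_taylor_remainder hγ 1
  refine ⟨ρ, h1, fun t δ => ?_⟩
  rw [h2]
  simp only [Finset.sum_range_succ, Finset.sum_range_zero, iteratedDeriv_succ, iteratedDeriv_zero,
    Nat.factorial]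
  push_cast
  ring

theorem deriv_actionCorrection (hg : ContDiff ℝ ∞ g) (t : ℝ) :
    deriv (actionCorrection g) t = 2 / 3 * (3 * g t ^ 2 * deriv g t * deriv (deriv g) t +
      g t ^ 3 * deriv (deriv (deriv g)) t) := by
  have h2 : ContDiff ℝ ∞ (deriv (deriv g)) := hg.iterate_deriv 2
  have e0 : HasDerivAt g (deriv g t) t := (hg.differentiable (by simp) t).hasDerivAt
  have e2 : HasDerivAt (deriv (deriv g)) (deriv (deriv (deriv g)) t) t :=
    (h2.differentiable (by simp) t).hasDerivAt
  have := (((e0.pow 3).const_mul (2 / 3)).mul e2).deriv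
  change deriv (actionCorrection g) t = _ at this
  rw [this]
  simp
  ring

/-- The action is invariant under a collision up to an error of third order. -/
theorem exists_arrivalSq_sub_departureSq (hg : ContDiff ℝ ∞ g) :
    ∃ q : ℝ × ℝ → ℝ, ContDiff ℝ ∞ q ∧ ∀ p, arrivalSq g p - departureSq g p = p.2 ^ 4 * q p := by
  have c1 : ContDiff ℝ ∞ (deriv g) := hg.iterate_deriv 1
  have c2 : ContDiff ℝ ∞ (deriv (deriv g)) := hg.iterate_deriv 2
  have c3 : ContDiff ℝ ∞ (deriv (deriv (deriv g))) := hg.iterate_deriv 3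
  have ck := contDiff_actionCorrection hg
  obtain ⟨r0, hr0, e0⟩ := taylor_three hg
  obtain ⟨r1, hr1, e1⟩ := taylor_two c1
  obtain ⟨r2, hr2, e2⟩ := taylor_one ck
  -- Here `h` is the difference quotient of g over δ. The difference g(t+δ)·arrival - g(t)·departure
  -- is the error of the trapezoidal rule for (g²)˙ on [t, t+δ], equal to δ³(d0 + δ d1), while the
  -- corresponding sum is 4g² + δ s. The leading term 4g² d0 δ³ of the product is cancelled by δ³
  -- times the derivative of `actionCorrection`, which determines that correction.
  let h1 : ℝ × ℝ → ℝ := fun p => deriv (deriv g) p.1 / 2 + deriv (deriv (deriv g)) p.1 / 6 * p.2 +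
    p.2 ^ 2 * r0 p
  let h : ℝ × ℝ → ℝ := fun p => deriv g p.1 + p.2 * h1 p
  let d0 : ℝ × ℝ → ℝ := fun p => - g p.1 * deriv (deriv (deriv g)) p.1 / 6
    - deriv g p.1 * deriv (deriv g) p.1 / 2
  let d1 : ℝ × ℝ → ℝ := fun p => g p.1 * (2 * r0 p - r1 p) - h1 p * deriv (deriv g) p.1 / 2 +
    h p * (- deriv (deriv (deriv g)) p.1 / 3 + p.2 * (r0 p - r1 p))
  let s : ℝ × ℝ → ℝ := fun p => h p * (g (p.1 + p.2) + 3 * g p.1) + g p.1 * deriv g p.1 -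
    g (p.1 + p.2) * deriv g (p.1 + p.2)
  have hh1 : ContDiff ℝ ∞ h1 := by fun_prop
  have hh : ContDiff ℝ ∞ h := by fun_prop
  have hd0 : ContDiff ℝ ∞ d0 := by fun_prop
  have hd1 : ContDiff ℝ ∞ d1 := by fun_prop
  have hs : ContDiff ℝ ∞ s := by fun_prop
  refine ⟨fun p => 4 * g p.1 ^ 2 * d1 p + (d0 p + p.2 * d1 p) * s p + r2 p, by fun_prop, ?_⟩
  rintro ⟨t, δ⟩
  simp only [arrivalSq, departureSq, arrival, departure, d1, d0, s, h, h1]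
  rw [e2 t δ, deriv_actionCorrection hg, e1 t δ, e0 t δ]
  simp only [actionCorrection]
  ring

theorem exists_conformalTime_sub (hg : ContDiff ℝ ∞ g) (h0 : ∀ t, g t ≠ 0) :
    ∃ p r : ℝ × ℝ → ℝ, ContDiff ℝ ∞ p ∧ ContDiff ℝ ∞ r ∧
      (∀ x, conformalTime g (x.1 + x.2) - conformalTime g x.1 = x.2 * p x) ∧
      ∀ x, p x = (g x.1)⁻¹ ^ 2 - deriv g x.1 * (g x.1)⁻¹ ^ 3 * x.2 +
        (deriv g x.1 ^ 2 * (g x.1)⁻¹ ^ 4 - deriv (deriv g) x.1 * (g x.1)⁻¹ ^ 3 / 3) * x.2 ^ 2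
        + x.2 ^ 3 * r x := by
  have c1 : ContDiff ℝ ∞ (deriv g) := hg.iterate_deriv 1
  have c2 : ContDiff ℝ ∞ (deriv (deriv g)) := hg.iterate_deriv 2
  have ci : ContDiff ℝ ∞ fun t => (g t)⁻¹ := hg.inv h0
  obtain ⟨r, hr, er⟩ := taylor_three (contDiff_conformalTime hg h0)
  have d0 : ∀ t, HasDerivAt g (deriv g t) t := fun t => (hg.differentiable (by simp) t).hasDerivAt
  have d1 : ∀ t, HasDerivAt (deriv g) (deriv (deriv g) t) t :=
    fun t => (c1.differentiable (by simp) t).hasDerivAt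
  have t1 := deriv_conformalTime hg.continuous h0
  have t2 : deriv (deriv (conformalTime g)) = fun t => -2 * deriv g t * (g t ^ 3)⁻¹ := by
    rw [t1]
    ext t
    have := ((d0 t).pow 2).inv (pow_ne_zero 2 (h0 t))
    refine this.deriv.trans ?_
    have := h0 t
    simp
    field_simp
  have t3 : deriv (deriv (deriv (conformalTime g))) = fun t =>
      6 * deriv g t ^ 2 * (g t ^ 4)⁻¹ - 2 * deriv (deriv g) t * (g t ^ 3)⁻¹ := by
    rw [t2]
    ext t
    have := ((d1 t).const_mul (-2)).mul (((d0 t).pow 3).inv (pow_ne_zero 3 (h0 t)))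
    refine this.deriv.trans ?_
    have := h0 t
    simp
    field_simp
    ring
  refine ⟨fun x => (g x.1)⁻¹ ^ 2 - deriv g x.1 * (g x.1)⁻¹ ^ 3 * x.2 +
        (deriv g x.1 ^ 2 * (g x.1)⁻¹ ^ 4 - deriv (deriv g) x.1 * (g x.1)⁻¹ ^ 3 / 3) * x.2 ^ 2
        + x.2 ^ 3 * r x, r, ?_, hr, ?_, fun x => rfl⟩
  · have : ContDiff ℝ ∞ fun x : ℝ × ℝ => (g x.1)⁻¹ := ci.comp contDiff_fst
    fun_prop
  · rintro ⟨t, δ⟩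
    simp only
    rw [er t δ, t3, t2, t1]
    simp only [inv_pow]
    ring

/-- A collision increases the angle by one up to an error of third order. -/
theorem exists_departureSq_mul_sq (hg : ContDiff ℝ ∞ g) (h0 : ∀ t, g t ≠ 0) :
    ∃ p q : ℝ × ℝ → ℝ, ContDiff ℝ ∞ p ∧ ContDiff ℝ ∞ q ∧
      (∀ x, conformalTime g (x.1 + x.2) - conformalTime g x.1 = x.2 * p x) ∧
      (∀ t, p (t, 0) = (g t ^ 2)⁻¹) ∧
      ∀ x, departureSq g x * p x ^ 2 - 4 = x.2 ^ 3 * q x := by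
  have c1 : ContDiff ℝ ∞ (deriv g) := hg.iterate_deriv 1
  have c2 : ContDiff ℝ ∞ (deriv (deriv g)) := hg.iterate_deriv 2
  have c3 : ContDiff ℝ ∞ (deriv (deriv (deriv g))) := hg.iterate_deriv 3
  have ci : ContDiff ℝ ∞ fun t => (g t)⁻¹ := hg.inv h0
  obtain ⟨p, r3, hp, hr3, e3, ep⟩ := exists_conformalTime_sub hg h0
  obtain ⟨r0, hr0, e0⟩ := taylor_three hg
  let i : ℝ × ℝ → ℝ := fun x => (g x.1)⁻¹
  have hi : ContDiff ℝ ∞ i := ci.comp contDiff_fst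
  have hig : ∀ x, i x * g x.1 = 1 := fun x => inv_mul_cancel₀ (h0 _)
  let α : ℝ × ℝ → ℝ := fun x => deriv (deriv (deriv g)) x.1 / 6 + x.2 * r0 x
  let a2 : ℝ × ℝ → ℝ := fun x => deriv (deriv g) x.1 / 2
  let b0 : ℝ × ℝ → ℝ := fun x => 4 * g x.1 ^ 4
  let b1 : ℝ × ℝ → ℝ := fun x => 8 * g x.1 ^ 3 * deriv g x.1
  let b2 : ℝ × ℝ → ℝ := fun x => 4 * g x.1 ^ 2 * deriv g x.1 ^ 2 +
    8 / 3 * g x.1 ^ 3 * deriv (deriv g) x.1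
  let b3 : ℝ × ℝ → ℝ := fun x => g x.1 ^ 2 * (4 * g x.1 * α x + 4 * deriv g x.1 * a2 x +
    x.2 * (a2 x ^ 2 + 4 * deriv g x.1 * α x) + x.2 ^ 2 * (2 * a2 x * α x) + x.2 ^ 3 * α x ^ 2)
  let p0 : ℝ × ℝ → ℝ := fun x => i x ^ 2
  let p1 : ℝ × ℝ → ℝ := fun x => - deriv g x.1 * i x ^ 3
  let p2 : ℝ × ℝ → ℝ := fun x => deriv g x.1 ^ 2 * i x ^ 4 - deriv (deriv g) x.1 * i x ^ 3 / 3
  let c0 : ℝ × ℝ → ℝ := fun x => p0 x ^ 2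
  let c1' : ℝ × ℝ → ℝ := fun x => 2 * p0 x * p1 x
  let c2' : ℝ × ℝ → ℝ := fun x => p1 x ^ 2 + 2 * p0 x * p2 x
  let c3' : ℝ × ℝ → ℝ := fun x => 2 * p0 x * r3 x + 2 * p1 x * p2 x +
    x.2 * (p2 x ^ 2 + 2 * p1 x * r3 x) + x.2 ^ 2 * (2 * p2 x * r3 x) + x.2 ^ 3 * r3 x ^ 2
  have hα : ContDiff ℝ ∞ α := by fun_prop
  have ha2 : ContDiff ℝ ∞ a2 := by fun_prop
  have hb0 : ContDiff ℝ ∞ b0 := by fun_prop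
  have hb1 : ContDiff ℝ ∞ b1 := by fun_prop
  have hb2 : ContDiff ℝ ∞ b2 := by fun_prop
  have hb3 : ContDiff ℝ ∞ b3 := by fun_prop
  have hp0 : ContDiff ℝ ∞ p0 := by fun_prop
  have hp1 : ContDiff ℝ ∞ p1 := by fun_prop
  have hp2 : ContDiff ℝ ∞ p2 := by fun_prop
  have hc0 : ContDiff ℝ ∞ c0 := by fun_prop
  have hc1 : ContDiff ℝ ∞ c1' := by fun_prop
  have hc2 : ContDiff ℝ ∞ c2' := by fun_prop
  have hc3 : ContDiff ℝ ∞ c3' := by fun_prop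
  refine ⟨p, fun x => b0 x * c3' x + b1 x * c2' x + b2 x * c1' x + b3 x * c0 x +
    x.2 * (b1 x * c3' x + b2 x * c2' x + b3 x * c1' x) + x.2 ^ 2 * (b2 x * c3' x + b3 x * c2' x) +
    x.2 ^ 3 * (b3 x * c3' x), hp, by fun_prop, e3, fun t => by simp [ep], ?_⟩
  intro x
  have eB : departureSq g x = b0 x + b1 x * x.2 + b2 x * x.2 ^ 2 + x.2 ^ 3 * b3 x := by
    simp only [departureSq, departure, actionCorrection, b0, b1, b2, b3, a2, α]
    rw [e0 x.1 x.2]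
    ring
  have eC : p x ^ 2 = c0 x + c1' x * x.2 + c2' x * x.2 ^ 2 + x.2 ^ 3 * c3' x := by
    rw [ep]
    change (i x ^ 2 - deriv g x.1 * i x ^ 3 * x.2 +
        (deriv g x.1 ^ 2 * i x ^ 4 - deriv (deriv g) x.1 * i x ^ 3 / 3) * x.2 ^ 2
        + x.2 ^ 3 * r3 x) ^ 2 = _
    simp only [c0, c1', c2', c3', p0, p1, p2]
    ring
  -- The expansion of `departureSq`·p² in δ begins 4 + 0·δ + 0·δ². The δ² term vanishes because of
  -- the coefficient 8/3 in `b2`, to which `actionCorrection` contributes 2/3: the same correction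
  -- serves angle and action.
  have z0 : b0 x * c0 x = 4 := by
    simp only [b0, c0, p0]
    linear_combination 4 * ((i x * g x.1) ^ 3 + (i x * g x.1) ^ 2 + i x * g x.1 + 1) * hig x
  have z1 : b0 x * c1' x + b1 x * c0 x = 0 := by
    simp only [b0, b1, c0, c1', p0, p1]
    linear_combination (-8 * i x ^ 4 * g x.1 ^ 3 * deriv g x.1) * hig x
  have z2 : b0 x * c2' x + b1 x * c1' x + b2 x * c0 x = 0 := by
    have := h0 x.1
    simp only [b0, b1, b2, c0, c1', c2', p0, p1, p2, i]
    field_simp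
    ring
  rw [eB, eC]
  linear_combination z0 + x.2 * z1 + x.2 ^ 2 * z2

theorem exists_pos_of_eventually_nhdsSet {a b : ℝ} (hab : a ≤ b) {P : ℝ × ℝ → Prop}
    (h : ∀ᶠ x in 𝓝ˢ (Icc a b ×ˢ {(0 : ℝ)}), P x) :
    ∃ ε > 0, ∀ x y, x ∈ Ioo (a - ε) (b + ε) → |y| < ε → P (x, y) := by
  obtain ⟨U, hU, hKU, hUP⟩ := mem_nhdsSet_iff_exists.1 h
  obtain ⟨ε, hε, hs⟩ := (isCompact_Icc.prod isCompact_singleton).exists_thickening_subset_open hU hKU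
  refine ⟨ε, hε, fun x y hx hy => hUP (hs ?_)⟩
  rw [Metric.mem_thickening_iff]
  refine ⟨(max a (min x b), 0), ⟨⟨le_max_left _ _, max_le hab (min_le_right _ _)⟩, rfl⟩, ?_⟩
  rw [Prod.dist_eq, max_lt_iff]
  constructor
  · rw [Real.dist_eq, abs_lt]
    rcases le_total x b with h1 | h1
    · rw [min_eq_left h1]
      rcases le_total a x with h2 | h2
      · rw [max_eq_right h2]; constructor <;> linarith
      · rw [max_eq_left h2]; constructor <;> linarith [hx.1]
    · rw [min_eq_right h1, max_eq_right hab]; constructor <;> linarith [hx.2]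
  · simpa [Real.dist_eq] using hy

/-- In the coordinates `angleAction`, a collision is a unit shift of the angle up to an error of
third order. -/
theorem exists_step_normal_form (hg : ContDiff ℝ ∞ g) (hpos : ∀ t, 0 < g t) {J : ℝ} (hJ : 0 < J)
    {c : ℝ} (hc : 0 < c) :
    ∃ e : ℝ × ℝ → ℝ × ℝ, ContDiff ℝ ∞ e ∧ HasCompactSupport e ∧ ∃ ε > 0, ∀ a I, 0 < I → I⁻¹ < ε →
      a / I ∈ Ioo (-ε) (J⁻¹ * conformalTime g 1 + ε) →
      ∃ t δ, t ∈ Ioo (-c) (1 + c) ∧ 0 < δ ∧ δ < c ∧ 0 < departure g (t, δ) ∧ 0 < arrival g (t, δ) ∧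
        angleAction g J (t, (g t + g (t + δ)) / δ) = (a, I) ∧
        angleAction g J (t + δ, (g t + g (t + δ)) / δ - 2 * deriv g (t + δ)) =
          (a + 1, I) + (I⁻¹ ^ 3) • e (a / I, I⁻¹) := by
  have h0 : ∀ t, g t ≠ 0 := fun t => (hpos t).ne'
  have c1 : ContDiff ℝ ∞ (deriv g) := hg.iterate_deriv 1
  have ck := contDiff_actionCorrection hg
  have cθ := contDiff_conformalTime hg h0
  obtain ⟨q4, hq4, eq4⟩ := exists_arrivalSq_sub_departureSq hg
  obtain ⟨p, q3, hp, hq3, ep, ep0, eq3⟩ := exists_departureSq_mul_sq hg h0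
  have cdep : ContDiff ℝ ∞ (departure g) := by unfold departure; fun_prop
  have carr : ContDiff ℝ ∞ (arrival g) := by unfold arrival; fun_prop
  have cdS : ContDiff ℝ ∞ (departureSq g) := by unfold departureSq; fun_prop
  have caS : ContDiff ℝ ∞ (arrivalSq g) := by unfold arrivalSq; fun_prop
  -- Collisions are parametrised by (t, δ), the time and the duration of flight, rather than (t, v):
  -- everything is then smooth across δ = 0, which stands for infinite velocity.
  let O₁ : Set (ℝ × ℝ) := {x | 0 < departureSq g x ∧ 0 < arrivalSq g x ∧ 0 < departure g x ∧
    0 < arrival g x ∧ x.1 ∈ Ioo (-c) (1 + c) ∧ |x.2| < c}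
  have hO₁ : IsOpen O₁ :=
    (isOpen_lt continuous_const cdS.continuous).inter <|
    (isOpen_lt continuous_const caS.continuous).inter <|
    (isOpen_lt continuous_const cdep.continuous).inter <|
    (isOpen_lt continuous_const carr.continuous).inter <|
    (isOpen_Ioo.preimage continuous_fst).inter
      (isOpen_lt (f := fun x : ℝ × ℝ => |x.2|) (by fun_prop) continuous_const)
  let N : ℝ × ℝ → ℝ := fun x => √(departureSq g x)
  let N' : ℝ × ℝ → ℝ := fun x => √(arrivalSq g x)
  have hN : ContDiffOn ℝ ∞ N O₁ := cdS.contDiffOn.sqrt fun x hx => hx.1.ne'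
  have hN' : ContDiffOn ℝ ∞ N' O₁ := caS.contDiffOn.sqrt fun x hx => hx.2.1.ne'
  let O : Set (ℝ × ℝ) := O₁ ∩ (fun x => N x * p x + 2) ⁻¹' (Ioi 0)
  have hO : IsOpen O := by
    refine ContinuousOn.isOpen_inter_preimage ?_ hO₁ isOpen_Ioi
    exact (hN.continuousOn.mul hp.continuous.continuousOn).add continuousOn_const
  have hNO : ContDiffOn ℝ ∞ N O := hN.mono inter_subset_left
  have hN'O : ContDiffOn ℝ ∞ N' O := hN'.mono inter_subset_left
  have Npos : ∀ x ∈ O, 0 < N x := fun x hx => Real.sqrt_pos.2 hx.1.1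
  have N'pos : ∀ x ∈ O, 0 < N' x := fun x hx => Real.sqrt_pos.2 hx.1.2.1
  let h : ℝ × ℝ → ℝ := fun x => 2 / (J * N x)
  have hh : ContDiffOn ℝ ∞ h O := contDiffOn_const.div (contDiffOn_const.mul hNO)
    fun x hx => (mul_pos hJ (Npos x hx)).ne'
  -- In terms of (t, δ) this is (a/I, 1/I). It is a diffeomorphism near δ = 0, so functions of (t,
  -- δ) become smooth functions of (a/I, 1/I).
  let P : ℝ × ℝ → ℝ × ℝ := fun x => (J⁻¹ * conformalTime g x.1, x.2 * h x)
  have hP : ContDiffOn ℝ ∞ P O := by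
    refine ContDiffOn.prodMk ?_ (contDiff_snd.contDiffOn.mul hh)
    exact (contDiff_const.mul (cθ.comp contDiff_fst)).contDiffOn
  have mono : StrictMono fun t => J⁻¹ * conformalTime g t :=
    (strictMono_conformalTime hg.continuous h0).const_mul (inv_pos.2 hJ)
  let k : Set (ℝ × ℝ) := Icc 0 1 ×ˢ {(0 : ℝ)}
  have hk : IsCompact k := isCompact_Icc.prod isCompact_singleton
  have dep0 : ∀ t, departure g (t, 0) = 2 * g t := fun t => by simp [departure]; ring
  have arr0 : ∀ t, arrival g (t, 0) = 2 * g t := fun t => by simp [arrival]; ring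
  have dS0 : ∀ t, departureSq g (t, 0) = 4 * g t ^ 4 := fun t => by
    simp [departureSq, dep0]; ring
  have aS0 : ∀ t, arrivalSq g (t, 0) = 4 * g t ^ 4 := fun t => by
    simp [arrivalSq, arr0]; ring
  have hkO : k ⊆ O := by
    rintro ⟨t, δ⟩ ⟨ht, hδ⟩
    simp only [mem_singleton_iff] at hδ
    subst hδ
    have := hpos t
    have h1 := ht.1
    have h2 := ht.2
    refine ⟨⟨?_, ?_, ?_, ?_, ?_, ?_⟩, ?_⟩
    · rw [dS0]; positivity
    · rw [aS0]; positivity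
    · rw [dep0]; positivity
    · rw [arr0]; positivity
    · constructor <;> simp only at h1 h2 ⊢ <;> linarith
    · simpa using hc
    · simp only [mem_preimage, mem_Ioi, ep0]
      have : 0 ≤ N (t, 0) := Real.sqrt_nonneg _
      positivity
  obtain ⟨Φ, hkΦ, hΦO, eΦ, hΦs⟩ := exists_openPartialHomeomorph_near_isCompact hO hP hk hkO
    (by
      rintro ⟨t, δ⟩ ⟨-, hδ⟩ ⟨t', δ'⟩ ⟨-, hδ'⟩ heq
      simp only [mem_singleton_iff] at hδ hδ'
      have := mono.injective (congrArg Prod.fst heq)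
      simp only at this
      rw [hδ, hδ', this])
    (by
      rintro ⟨t, δ⟩ hx
      have hδ : δ = 0 := hx.2
      subst hδ
      have hxO := hkO hx
      have d1 : HasFDerivAt (fun x : ℝ × ℝ => J⁻¹ * conformalTime g x.1)
          ((J⁻¹ * (g t ^ 2)⁻¹) • ContinuousLinearMap.fst ℝ ℝ ℝ) (t, 0) :=
        HasDerivAt.comp_hasFDerivAt (h₂ := fun s => J⁻¹ * conformalTime g s) (f := Prod.fst)
          (t, (0 : ℝ)) ((hasDerivAt_conformalTime hg.continuous h0 t).const_mul J⁻¹) hasFDerivAt_fst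
      have d2 : HasFDerivAt (fun x : ℝ × ℝ => x.2 * h x) ((0 : ℝ) • fderiv ℝ h (t, 0) +
          h (t, 0) • ContinuousLinearMap.snd ℝ ℝ ℝ) (t, 0) :=
        hasFDerivAt_snd.mul
          ((hh.contDiffAt (hO.mem_nhds hxO)).differentiableAt (by simp)).hasFDerivAt
      have d := d1.prodMk d2
      change (fderiv ℝ P (t, 0)).det ≠ 0
      rw [show fderiv ℝ P (t, 0) = _ from d.fderiv, det_prod_real]
      have := Npos _ hxO
      have := h0 t
      simp [h, hJ.ne', this, (Npos _ hxO).ne'])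
  have hsm : ∀ {F : ℝ × ℝ → ℝ}, ContDiffOn ℝ ∞ F O →
      ContDiffOn ℝ ∞ (fun y => F (Φ.symm y)) Φ.target := fun {F} hF =>
    hF.comp hΦs fun y hy => hΦO (Φ.map_target hy)
  -- Both errors come from rationalising a difference of square roots: N' - N = (N'² - N²)/(N' + N)
  -- for the action and Np - 2 = (N²p² - 4)/(Np + 2) for the angle.
  let eI : ℝ × ℝ → ℝ := fun x => J / 2 * (q4 x / (N' x + N x))
  let ea : ℝ × ℝ → ℝ := fun x => eI x * (J⁻¹ * conformalTime g (x.1 + x.2)) +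
    q3 x / (2 * (N x * p x + 2))
  have heI : ContDiffOn ℝ ∞ eI O := contDiffOn_const.mul (hq4.contDiffOn.div (hN'O.add hNO)
    fun x hx => (add_pos (N'pos x hx) (Npos x hx)).ne')
  have hea : ContDiffOn ℝ ∞ ea O := by
    refine (heI.mul (contDiff_const.mul (cθ.comp (contDiff_fst.add contDiff_snd))).contDiffOn).add
      (hq3.contDiffOn.div (contDiffOn_const.mul ((hNO.mul hp.contDiffOn).add contDiffOn_const))
      fun x hx => ?_)
    have : 0 < N x * p x + 2 := hx.2
    positivity
  have hsc : ContDiffOn ℝ ∞ (fun x => (J * N x / 2) ^ 3) O :=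
    ((contDiffOn_const.mul hNO).div_const 2).pow 3
  -- The factor (JN/2)³ equals (δI)³ and converts the errors of order δ³ into I⁻³e.
  obtain ⟨e, he1, he2, he3⟩ := exists_contDiff_extension (k := Φ '' k)
    (f := fun y => ((J * N (Φ.symm y) / 2) ^ 3) • (ea (Φ.symm y), eI (Φ.symm y)))
    (hk.image_of_continuousOn (Φ.continuousOn.mono hkΦ)) Φ.open_target
    (by rintro _ ⟨x, hx, rfl⟩; exact Φ.map_source (hkΦ hx))
    ((hsm hsc).smul ((hsm hea).prodMk (hsm heI)))
  have htar : ∀ᶠ y in 𝓝ˢ (Φ '' k), y ∈ Φ.target := Φ.open_target.mem_nhdsSet.2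
    (by rintro _ ⟨x, hx, rfl⟩; exact Φ.map_source (hkΦ hx))
  have hsub : Icc 0 (J⁻¹ * conformalTime g 1) ×ˢ {(0 : ℝ)} ⊆ Φ '' k := by
    rintro ⟨θ, η⟩ ⟨hθ, hη⟩
    simp only [mem_singleton_iff] at hη
    obtain ⟨t, ht, htθ⟩ := intermediate_value_Icc (zero_le_one (α := ℝ))
      (f := fun t => J⁻¹ * conformalTime g t)
      (continuous_const.mul cθ.continuous).continuousOn (by simpa using hθ)
    refine ⟨(t, 0), ⟨ht, rfl⟩, ?_⟩
    rw [eΦ]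
    simp only [P, zero_mul, hη]
    exact Prod.ext htθ rfl
  have hθ1 : 0 ≤ J⁻¹ * conformalTime g 1 := by
    have := mono.monotone (zero_le_one (α := ℝ))
    simpa using this
  obtain ⟨ε, hε, hεP⟩ := exists_pos_of_eventually_nhdsSet hθ1
    ((he3.and htar).filter_mono (nhdsSet_mono hsub))
  refine ⟨e, he1, he2, ε, hε, fun a I hI hIε haI => ?_⟩
  have hIi : 0 < I⁻¹ := inv_pos.2 hI
  obtain ⟨k1, k2⟩ := hεP (a / I) I⁻¹ (by simpa using haI) (by rwa [abs_of_pos hIi])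
  obtain ⟨⟨t, δ⟩, hx⟩ : ∃ x, Φ.symm (a / I, I⁻¹) = x := ⟨_, rfl⟩
  rw [hx] at k1
  have hxO : (t, δ) ∈ O := hx ▸ hΦO (Φ.map_target k2)
  have hPx : P (t, δ) = (a / I, I⁻¹) := by rw [← eΦ, ← hx]; exact Φ.right_inv k2
  have hNx := Npos _ hxO
  have hN'x := N'pos _ hxO
  have hθ : J⁻¹ * conformalTime g t = a / I := congrArg Prod.fst hPx
  have hη : δ * (2 / (J * N (t, δ))) = I⁻¹ := congrArg Prod.snd hPx
  have hδ : 0 < δ := by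
    by_contra hcon
    have : δ * (2 / (J * N (t, δ))) ≤ 0 :=
      mul_nonpos_of_nonpos_of_nonneg (not_lt.1 hcon) (by positivity)
    linarith
  have hδI : δ = I⁻¹ * (J * N (t, δ) / 2) := by rw [← hη]; field_simp
  have hI' : I = J / 2 * (N (t, δ) / δ) := by
    rw [← inv_inv I, ← hη]; field_simp
  obtain ⟨⟨o1, o2, o3, o4, o5, o6⟩, o7⟩ := hxO
  have act1 : wallAction g J t ((g t + g (t + δ)) / δ + deriv g t) = I := by
    rw [hI', wallAction]
    congr 1
    rw [← Real.sqrt_sq hδ.le, ← Real.sqrt_div' _ (sq_nonneg δ), Real.sqrt_sq hδ.le]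
    congr 1
    simp only [departureSq, departure]
    field_simp
  have act2 : wallAction g J (t + δ) ((g t + g (t + δ)) / δ - 2 * deriv g (t + δ) +
      deriv g (t + δ)) = J / 2 * (N' (t, δ) / δ) := by
    rw [wallAction]
    congr 1
    rw [← Real.sqrt_sq hδ.le, ← Real.sqrt_div' _ (sq_nonneg δ), Real.sqrt_sq hδ.le]
    congr 1
    simp only [arrivalSq, arrival]
    field_simp
    ring
  have sN : N (t, δ) ^ 2 = departureSq g (t, δ) := Real.sq_sqrt o1.le
  have sN' : N' (t, δ) ^ 2 = arrivalSq g (t, δ) := Real.sq_sqrt o2.le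
  have dI : J / 2 * (N' (t, δ) / δ) - I = δ ^ 3 * eI (t, δ) := by
    have := eq4 (t, δ)
    rw [← sN, ← sN'] at this
    simp only at this
    rw [hI']
    simp only [eI]
    have h3 : N' (t, δ) + N (t, δ) ≠ 0 := by positivity
    field_simp
    linear_combination this
  have da : J / 2 * (N' (t, δ) / δ) * (J⁻¹ * conformalTime g (t + δ)) - a - 1 =
      δ ^ 3 * ea (t, δ) := by
    have e1 := eq3 (t, δ)
    rw [← sN] at e1
    simp only at e1
    have e2 := ep (t, δ)
    simp only at e2
    have ea' : a = I * (J⁻¹ * conformalTime g t) := by rw [hθ]; field_simp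
    have e3 : J / 2 * (N' (t, δ) / δ) = I + δ ^ 3 * eI (t, δ) := by linarith
    have o7' : N (t, δ) * p (t, δ) + 2 ≠ 0 := (show 0 < N (t, δ) * p (t, δ) + 2 from o7).ne'
    have e4 : I * (J⁻¹ * (conformalTime g (t + δ) - conformalTime g t)) - 1 =
        δ ^ 3 * (q3 (t, δ) / (2 * (N (t, δ) * p (t, δ) + 2))) := by
      rw [e2, hI']
      field_simp
      linear_combination e1
    simp only [ea]
    rw [e3, ea']
    linear_combination e4
  refine ⟨t, δ, o5, hδ, by simpa [abs_of_pos hδ] using o6, o3, o4, ?_, ?_⟩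
  · simp only [angleAction, act1, hθ]
    rw [mul_div_cancel₀ _ hI.ne']
  · simp only [angleAction, act2]
    rw [k1]
    have e5 : δ ^ 3 = I⁻¹ ^ 3 * (J * N (t, δ) / 2) ^ 3 := by
      conv_lhs => rw [hδI]
      ring
    refine Prod.ext ?_ ?_
    · simp only [Prod.fst_add, Prod.smul_fst, smul_eq_mul]
      linear_combination da + ea (t, δ) * e5
    · simp only [Prod.snd_add, Prod.smul_snd, smul_eq_mul]
      linear_combination dI + eI (t, δ) * e5

end SmoothWall

/-! ### Crossing a singular time -/

/-- The phase of a collision at time `x.2 * x.1`, for a ball that arrives with speed `1 / x.2`. -/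
noncomputable def impactPhase (γ : ℝ → ℝ) (x : ℝ × ℝ) : ℝ :=
  (x.1 - γ (x.2 * x.1) + γ 0) / (2 * γ 0)

theorem contDiff_impactPhase {γ : ℝ → ℝ} (hγ : ContDiff ℝ ∞ γ) : ContDiff ℝ ∞ (impactPhase γ) := by
  unfold impactPhase
  fun_prop

theorem impactPhase_zero {γ : ℝ → ℝ} (t : ℝ) : impactPhase γ (t, 0) = (2 * γ 0)⁻¹ * t := by
  simp [impactPhase]
  ring

/-- Angle and action of a collision shortly after time `0`, expanded in the inverse velocity. -/
theorem exists_collision_expansion {γ : ℝ → ℝ} (hγ : ContDiff ℝ ∞ γ) (hpos : ∀ t, 0 < γ t)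
    {J : ℝ} (hJ : 0 < J) :
    ∃ (O : Set (ℝ × ℝ)) (M M₁ S Y : ℝ × ℝ → ℝ), IsOpen O ∧ (∀ t, (t, (0 : ℝ)) ∈ O) ∧
      ContDiffOn ℝ ∞ M O ∧ ContDiffOn ℝ ∞ M₁ O ∧ ContDiffOn ℝ ∞ S O ∧ ContDiffOn ℝ ∞ Y O ∧
      (∀ x ∈ O, 0 < M x) ∧ (∀ x ∈ O, M x = γ 0 + x.2 * M₁ x) ∧
      ∀ v T, 0 < v → (v * T, v⁻¹) ∈ O →
        angleAction γ J (T, v - 2 * deriv γ T) =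
          (impactPhase γ (v * T, v⁻¹) + v⁻¹ ^ 2 * S (v * T, v⁻¹), J / 2 * M (v * T, v⁻¹) * v) ∧
        J / 2 * M (v * T, v⁻¹) * v = J / 2 * (γ 0 * v +
          2 * γ 0 * deriv γ 0 * (impactPhase γ (v * T, v⁻¹) - 1 / 2) +
          2 * v⁻¹ * γ 0 ^ 2 * deriv (deriv γ) 0 *
            ((impactPhase γ (v * T, v⁻¹) - 1 / 2) ^ 2 - 1 / 12)) + v⁻¹ ^ 2 * Y (v * T, v⁻¹) := by
  have h0 : ∀ t, γ t ≠ 0 := fun t => (hpos t).ne'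
  have c1 : ContDiff ℝ ∞ (deriv γ) := hγ.iterate_deriv 1
  have ck := contDiff_actionCorrection hγ
  obtain ⟨ρ, hρ, eρ⟩ := taylor_two hγ
  obtain ⟨ρ₁, hρ₁, eρ₁⟩ := taylor_one c1
  obtain ⟨ρk, hρk, eρk⟩ := exists_taylor_remainder ck 0
  obtain ⟨p, r, hp, hr, ep, epr⟩ := exists_conformalTime_sub hγ h0
  set l := γ 0 with hl
  set γ₁ := deriv γ 0 with hγ₁
  set γ₂ := deriv (deriv γ) 0 with hγ₂
  have hl0 : 0 < l := hpos 0
  let f₃ : ℝ × ℝ → ℝ := fun x => x.1 ^ 3 * ρ (0, x.2 * x.1)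
  let u₃ : ℝ × ℝ → ℝ := fun x => x.1 ^ 2 * ρ₁ (0, x.2 * x.1)
  let k₁ : ℝ × ℝ → ℝ := fun x => x.1 * ρk (0, x.2 * x.1)
  let f₁ : ℝ × ℝ → ℝ := fun x => γ₁ * x.1
  let f₂ : ℝ × ℝ → ℝ := fun x => γ₂ * x.1 ^ 2 / 2
  let e₁ : ℝ × ℝ → ℝ := fun x => f₁ x - l * γ₁
  let e₂ : ℝ × ℝ → ℝ := fun x => f₂ x - f₁ x * γ₁ - l * γ₂ * x.1
  let e₃ : ℝ × ℝ → ℝ := fun x => f₃ x - γ₁ * f₂ x - γ₂ * x.1 * f₁ x - l * u₃ x +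
    x.2 * (-γ₁ * f₃ x - γ₂ * x.1 * f₂ x - u₃ x * f₁ x) +
    x.2 ^ 2 * (- γ₂ * x.1 * f₃ x - u₃ x * f₂ x) - x.2 ^ 3 * f₃ x * u₃ x
  -- Chosen so that `actionCorrection γ 0` = 2lκ; under the square root it shifts M by κ/v² to
  -- leading order. This constant is the source of the 1/12 in the correction term.
  let κ : ℝ := l ^ 2 * γ₂ / 3
  let V : ℝ × ℝ → ℝ := fun x => γ (x.2 * x.1) * (1 - x.2 * deriv γ (x.2 * x.1))
  let D : ℝ × ℝ → ℝ := fun x => V x ^ 2 + x.2 ^ 2 * actionCorrection γ (x.2 * x.1)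
  -- The expansion of M in x.2 = 1/v up to second order, with coefficients depending on x.1 = vT;
  -- `eD` and `eM` show that the error is of third order.
  let Mc : ℝ × ℝ → ℝ := fun x => l + x.2 * e₁ x + x.2 ^ 2 * (e₂ x + κ)
  let num : ℝ × ℝ → ℝ := fun x => e₃ x * (V x + Mc x) -
    κ * (2 * e₁ x + x.2 * (2 * e₂ x + κ) + x.2 ^ 2 * e₃ x) + k₁ x
  let M : ℝ × ℝ → ℝ := fun x => √(D x)
  have hf₃ : ContDiff ℝ ∞ f₃ := by fun_prop
  have hu₃ : ContDiff ℝ ∞ u₃ := by fun_prop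
  have hk₁ : ContDiff ℝ ∞ k₁ := by fun_prop
  have hf₁ : ContDiff ℝ ∞ f₁ := by fun_prop
  have hf₂ : ContDiff ℝ ∞ f₂ := by fun_prop
  have he₁ : ContDiff ℝ ∞ e₁ := by fun_prop
  have he₂ : ContDiff ℝ ∞ e₂ := by fun_prop
  have he₃ : ContDiff ℝ ∞ e₃ := by fun_prop
  have hV : ContDiff ℝ ∞ V := by fun_prop
  have hD : ContDiff ℝ ∞ D := by fun_prop
  have hMc : ContDiff ℝ ∞ Mc := by fun_prop
  have hnum : ContDiff ℝ ∞ num := by fun_prop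
  have hMcont : Continuous M := hD.continuous.sqrt
  let O : Set (ℝ × ℝ) := {x | 0 < D x ∧ 0 < M x + Mc x}
  have hO : IsOpen O := (isOpen_lt continuous_const hD.continuous).inter
    (isOpen_lt continuous_const (hMcont.add hMc.continuous))
  have hM : ContDiffOn ℝ ∞ M O := hD.contDiffOn.sqrt fun x hx => hx.1.ne'
  let R : ℝ × ℝ → ℝ := fun x => num x / (M x + Mc x)
  have hR : ContDiffOn ℝ ∞ R O := hnum.contDiffOn.div (hM.add hMc.contDiffOn) fun x hx => hx.2.ne'
  have eV : ∀ x, V x = l + x.2 * e₁ x + x.2 ^ 2 * e₂ x + x.2 ^ 3 * e₃ x := by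
    intro x
    have a1 := eρ 0 (x.2 * x.1)
    have a2 := eρ₁ 0 (x.2 * x.1)
    rw [zero_add] at a1 a2
    simp only [V, a1, a2]
    simp only [e₁, e₂, e₃, f₁, f₂, f₃, u₃, ← hl, ← hγ₁, ← hγ₂]
    ring
  have eD : ∀ x, D x = Mc x ^ 2 + x.2 ^ 3 * num x := by
    intro x
    have a1 := eρk 0 (x.2 * x.1)
    rw [zero_add] at a1
    simp only [Finset.sum_range_succ, Finset.sum_range_zero, iteratedDeriv_zero, Nat.factorial]
      at a1
    have a2 : actionCorrection γ 0 = 2 * l * κ := by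
      simp only [actionCorrection, κ, ← hl, ← hγ₂]
      ring
    simp only [D, a1, a2]
    simp only [num, Mc, eV, k₁]
    push_cast
    ring
  have eM : ∀ x ∈ O, M x = Mc x + x.2 ^ 3 * R x := by
    intro x hx
    have h1 : M x ^ 2 = D x := Real.sq_sqrt hx.1.le
    have h2 : M x + Mc x ≠ 0 := hx.2.ne'
    have h3 : (M x - Mc x) * (M x + Mc x) = x.2 ^ 3 * num x := by
      linear_combination h1 + eD x
    simp only [R]
    field_simp
    linear_combination h3
  let w : ℝ × ℝ → ℝ := fun x => f₂ x + x.2 * f₃ x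
  let d : ℝ × ℝ → ℝ := fun x => γ₁ * x.1 + x.2 * w x
  have hw : ContDiff ℝ ∞ w := by fun_prop
  have hd : ContDiff ℝ ∞ d := by fun_prop
  have eA : ∀ x, 2 * l * impactPhase γ x = x.1 - x.2 * d x := by
    intro x
    have a1 := eρ 0 (x.2 * x.1)
    rw [zero_add] at a1
    simp only [impactPhase, ← hl]
    rw [mul_div_cancel₀ _ (by positivity), a1]
    simp only [d, w, f₂, f₃, ← hl, ← hγ₁, ← hγ₂]
    ring
  let P : ℝ × ℝ → ℝ := fun x => p (0, x.2 * x.1)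
  have hP : ContDiff ℝ ∞ P := by fun_prop
  let P₂ : ℝ × ℝ → ℝ := fun x => (γ₁ ^ 2 * l⁻¹ ^ 4 - γ₂ * l⁻¹ ^ 3 / 3) * x.1 ^ 2 +
    x.2 * x.1 ^ 3 * r (0, x.2 * x.1)
  have hP₂ : ContDiff ℝ ∞ P₂ := by fun_prop
  have eP : ∀ x, P x = l⁻¹ ^ 2 - γ₁ * l⁻¹ ^ 3 * (x.2 * x.1) + x.2 ^ 2 * P₂ x := by
    intro x
    simp only [P, epr, P₂, ← hl, ← hγ₁, ← hγ₂]
    ring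
  let M₂ : ℝ × ℝ → ℝ := fun x => e₂ x + κ + x.2 * R x
  have hM₂ : ContDiffOn ℝ ∞ M₂ O :=
    (he₂.add contDiff_const).contDiffOn.add (contDiff_snd.contDiffOn.mul hR)
  refine ⟨O, M, fun x => e₁ x + x.2 * M₂ x,
    fun x => x.1 / 2 * (M x * P₂ x + e₁ x * (- γ₁ * l⁻¹ ^ 3 * x.1) +
      M₂ x * (l⁻¹ ^ 2 - γ₁ * l⁻¹ ^ 3 * (x.2 * x.1))) + (2 * l)⁻¹ * w x,
    fun x => J / 2 * (R x + γ₁ * w x - γ₂ * (-x.1 * d x + x.2 * d x ^ 2 / 2 + l * d x)),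
    hO, ?_, hM, ?_, ?_, ?_, ?_, ?_, ?_⟩
  · intro t
    have h1 : D (t, 0) = l ^ 2 := by simp [D, V, ← hl]
    have h2 : M (t, 0) = l := by simp only [M, h1]; exact Real.sqrt_sq hl0.le
    refine ⟨by rw [h1]; positivity, ?_⟩
    rw [h2]
    simp only [Mc]
    simpa using hl0
  · exact he₁.contDiffOn.add (contDiff_snd.contDiffOn.mul hM₂)
  · refine ContDiffOn.add (ContDiffOn.mul (contDiff_fst.contDiffOn.div_const 2) (((hM.mul
      hP₂.contDiffOn).add (ContDiff.contDiffOn (by fun_prop))).add (hM₂.mul (ContDiff.contDiffOn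
      (by fun_prop))))) (ContDiff.contDiffOn (by fun_prop))
  · exact contDiffOn_const.mul ((hR.add (ContDiff.contDiffOn (by fun_prop))).sub
      (ContDiff.contDiffOn (by fun_prop)))
  · exact fun x hx => Real.sqrt_pos.2 hx.1
  · intro x hx
    rw [eM x hx]
    simp only [Mc, M₂]
    ring
  · intro v T hv hx
    set x : ℝ × ℝ := (v * T, v⁻¹) with hxdef
    have hvi : x.2 * v = 1 := inv_mul_cancel₀ hv.ne'
    have hT : x.2 * x.1 = T := by
      simp only [x]; field_simp
    have hT' : v * T = x.1 := rfl
    have hv' : v⁻¹ = x.2 := rfl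
    have act : wallAction γ J T (v - 2 * deriv γ T + deriv γ T) = J / 2 * M x * v := by
      rw [wallAction, mul_assoc]
      congr 1
      simp only [M]
      have hsq : √(D x) * v = √(v ^ 2 * D x) := by
        rw [Real.sqrt_mul (sq_nonneg v), Real.sqrt_sq hv.le, mul_comm]
      rw [hsq]
      congr 1
      simp only [D, V, hT]
      have : v * x.2 = 1 := by rw [mul_comm]; exact hvi
      linear_combination (γ T ^ 2 * deriv γ T * (2 * v - v * x.2 * deriv γ T - deriv γ T) -
        actionCorrection γ T * (v * x.2 + 1)) * this
    have eM' : M x = l + x.2 * e₁ x + x.2 ^ 2 * M₂ x := by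
      rw [eM x hx]
      simp only [Mc, M₂]
      ring
    constructor
    · refine Prod.ext ?_ act
      simp only [angleAction, act]
      have e5 := ep (0, T)
      simp only [zero_add, conformalTime_zero, sub_zero] at e5
      have e6 : p (0, T) = P x := by simp only [P, hT]
      rw [e5, e6]
      have e7 := eA x
      have e8 : impactPhase γ x = (2 * l)⁻¹ * (x.1 - x.2 * d x) := by
        rw [← e7]; field_simp
      rw [e8]
      have e9 : J / 2 * M x * v * (J⁻¹ * (T * P x)) = x.1 / 2 * (M x * P x) := by
        simp only [x]; field_simp
      rw [e9, hv']
      have e10 : l * l⁻¹ = 1 := mul_inv_cancel₀ hl0.ne'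
      have e11 : (2 * l)⁻¹ = l⁻¹ / 2 := by rw [mul_inv]; ring
      rw [e11]
      have e12 : M x * P x = M x * x.2 ^ 2 * P₂ x + (l + x.2 * e₁ x + x.2 ^ 2 * M₂ x) *
        (l⁻¹ ^ 2 - γ₁ * l⁻¹ ^ 3 * (x.2 * x.1)) := by
        rw [← eM', eP x]; ring
      rw [e12]
      simp only [d, e₁, f₁]
      generalize l⁻¹ = i at *
      linear_combination (x.1 / 2 * (i - γ₁ * i ^ 2 * x.2 * x.1 - x.2 * γ₁ * i)) * e10
    · rw [hv']
      have e7 := eA x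
      have e13 : M x = l + x.2 * (2 * l * γ₁ * (impactPhase γ x - 1 / 2)) +
        x.2 ^ 2 * (2 * l ^ 2 * γ₂ * ((impactPhase γ x - 1 / 2) ^ 2 - 1 / 12)) +
        x.2 ^ 3 * (R x + γ₁ * w x - γ₂ * (-x.1 * d x + x.2 * d x ^ 2 / 2 + l * d x)) := by
        -- Up to the factor 2l²γ₂ this is the second Bernoulli polynomial φ² - φ + 1/6 in the phase
        -- φ, written in terms of 2lφ = x.1 - x.2·d.
        have e14 : 2 * l ^ 2 * γ₂ * ((impactPhase γ x - 1 / 2) ^ 2 - 1 / 12) =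
          γ₂ * ((2 * l * impactPhase γ x) ^ 2 / 2 - l * (2 * l * impactPhase γ x) + l ^ 2 / 3) := by
          ring
        have e15 : 2 * l * γ₁ * (impactPhase γ x - 1 / 2) =
          γ₁ * (2 * l * impactPhase γ x - l) := by ring
        rw [e14, e15, e7, eM x hx]
        simp only [Mc, e₁, e₂, f₁, d, κ, w, f₂]
        ring
      rw [e13]
      linear_combination (J / 2 * (2 * l * γ₁ * (impactPhase γ x - 1 / 2)) +
        J / 2 * x.2 * (2 * l ^ 2 * γ₂ * ((impactPhase γ x - 1 / 2) ^ 2 - 1 / 12)) + J / 2 * x.2 ^ 2 *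
        (R x + γ₁ * w x - γ₂ * (-x.1 * d x + x.2 * d x ^ 2 / 2 + l * d x))) * hvi

theorem det_fderiv_mk_snd_mul {φ h : ℝ × ℝ → ℝ} {t c : ℝ} (hφ : DifferentiableAt ℝ φ (t, 0))
    (hh : DifferentiableAt ℝ h (t, 0)) (hc : ∀ s, φ (s, 0) = c * s) :
    (fderiv ℝ (fun x => (φ x, x.2 * h x)) (t, 0)).det = c * h (t, 0) := by
  have d2 : HasFDerivAt (fun x : ℝ × ℝ => x.2 * h x) ((0 : ℝ) • fderiv ℝ h (t, 0) +
      h (t, 0) • ContinuousLinearMap.snd ℝ ℝ ℝ) (t, 0) := hasFDerivAt_snd.mul hh.hasFDerivAt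
  have d := hφ.hasFDerivAt.prodMk d2
  have e1 : fderiv ℝ φ (t, 0) (1, 0) = c := by
    have a1 : HasDerivAt (fun s : ℝ => φ (s, 0)) (fderiv ℝ φ (t, 0) (1, 0)) t :=
      HasFDerivAt.comp_hasDerivAt (f := fun s : ℝ => (s, (0 : ℝ))) t hφ.hasFDerivAt
        ((hasDerivAt_id t).prodMk (hasDerivAt_const t 0))
    have a2 : HasDerivAt (fun s : ℝ => φ (s, 0)) c t := by
      simp only [hc]
      simpa using (hasDerivAt_id t).const_mul c
    exact a1.unique a2
  rw [d.fderiv, det_prod_real]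
  simp [e1]

/-- The jump of the action when the law of motion of the wall changes from `γ` to `γ'`: here `s` and
`I` are the angle and the action of the collision that would have taken place with `γ`. -/
theorem exists_crossing_normal_form {γ γ' : ℝ → ℝ} (hγ : ContDiff ℝ ∞ γ) (hpos : ∀ t, 0 < γ t)
    (hγ' : ContDiff ℝ ∞ γ') (hpos' : ∀ t, 0 < γ' t) (h0 : γ' 0 = γ 0) {J : ℝ} (hJ : 0 < J)
    {B : ℝ} :
    ∃ C : ℝ × ℝ → ℝ × ℝ, ContDiff ℝ ∞ C ∧ HasCompactSupport C ∧ ∃ ε > 0, ∀ v T T', 0 < v →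
      v⁻¹ < ε → v * T ∈ Icc 0 B → v * T' ∈ Icc 0 B → v * T - γ T = v * T' - γ' T' →
      ∃ s I, 0 < I ∧ angleAction γ J (T, v - 2 * deriv γ T) = (s, I) ∧
        angleAction γ' J (T', v - 2 * deriv γ' T') =
          (s, I + J * γ 0 * (deriv γ' 0 - deriv γ 0) * (s - 1 / 2) +
            I⁻¹ * (1 / 2 * J ^ 2 * γ 0 ^ 3 * (deriv (deriv γ') 0 - deriv (deriv γ) 0) *
              ((s - 1 / 2) ^ 2 - 1 / 12))) + (I⁻¹ ^ 2) • C (s, I⁻¹) := by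
  obtain ⟨O, M, M₁, S, Y, hO, hO0, hM, hM₁, hS, hY, Mpos, eM, key⟩ :=
    exists_collision_expansion hγ hpos hJ
  obtain ⟨O', M', M₁', S', Y', hO', hO0', hM', hM₁', hS', hY', Mpos', eM', key'⟩ :=
    exists_collision_expansion hγ' hpos' hJ
  have hl := hpos 0
  let k : Set (ℝ × ℝ) := Icc 0 B ×ˢ {(0 : ℝ)}
  have hk : IsCompact k := isCompact_Icc.prod isCompact_singleton
  have hkO : k ⊆ O := by rintro ⟨t, δ⟩ ⟨-, hδ⟩; rw [mem_singleton_iff] at hδ; subst hδ; exact hO0 t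
  have hkO' : k ⊆ O' := by
    rintro ⟨t, δ⟩ ⟨-, hδ⟩; rw [mem_singleton_iff] at hδ; subst hδ; exact hO0' t
  let h : ℝ × ℝ → ℝ := fun x => 2 / (J * M x)
  have hh : ContDiffOn ℝ ∞ h O := contDiffOn_const.div (contDiffOn_const.mul hM)
    fun x hx => (mul_pos hJ (Mpos x hx)).ne'
  let b : ℝ × ℝ → ℝ := fun x => impactPhase γ x + x.2 ^ 2 * S x
  have hb : ContDiffOn ℝ ∞ b O :=
    (contDiff_impactPhase hγ).contDiffOn.add ((contDiff_snd.pow 2).contDiffOn.mul hS)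
  have hB : ContDiffOn ℝ ∞ (fun x => (b x, x.2 * h x)) O :=
    hb.prodMk (contDiff_snd.contDiffOn.mul hh)
  have hb0 : ∀ t, b (t, 0) = (2 * γ 0)⁻¹ * t := fun t => by simp [b, impactPhase_zero]
  obtain ⟨Φ, hkΦ, hΦO, eΦ, hΦs⟩ := exists_openPartialHomeomorph_near_isCompact hO hB hk hkO
    (by
      rintro ⟨t, δ⟩ ⟨-, hδ⟩ ⟨t', δ'⟩ ⟨-, hδ'⟩ heq
      simp only [mem_singleton_iff] at hδ hδ'
      subst hδ hδ'
      have := congrArg Prod.fst heq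
      simp only [hb0] at this
      rw [mul_right_inj' (by positivity)] at this
      rw [this])
    (by
      rintro ⟨t, δ⟩ hx
      have hδ : δ = 0 := hx.2
      subst hδ
      rw [det_fderiv_mk_snd_mul ((hb.contDiffAt (hO.mem_nhds (hkO hx))).differentiableAt (by simp))
        ((hh.contDiffAt (hO.mem_nhds (hkO hx))).differentiableAt (by simp)) hb0]
      have := Mpos _ (hkO hx)
      simp only [h]
      positivity)
  have hA' : ContDiffOn ℝ ∞ (fun x : ℝ × ℝ => (impactPhase γ' x, x.2 * (1 : ℝ))) O' :=
    (contDiff_impactPhase hγ').contDiffOn.prodMk (by fun_prop)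
  obtain ⟨Ψ, hkΨ, hΨO, eΨ, hΨs⟩ := exists_openPartialHomeomorph_near_isCompact hO' hA' hk hkO'
    (by
      rintro ⟨t, δ⟩ ⟨-, hδ⟩ ⟨t', δ'⟩ ⟨-, hδ'⟩ heq
      simp only [mem_singleton_iff] at hδ hδ'
      subst hδ hδ'
      have := congrArg Prod.fst heq
      simp only [impactPhase_zero] at this
      rw [mul_right_inj' (by rw [h0]; positivity)] at this
      rw [this])
    (by
      rintro ⟨t, δ⟩ hx
      have hδ : δ = 0 := hx.2
      subst hδ
      rw [det_fderiv_mk_snd_mul (c := (2 * γ' 0)⁻¹) (h := fun _ => 1)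
        ((contDiff_impactPhase hγ').differentiable (by simp) _)
        (differentiableAt_const _) (fun s => impactPhase_zero s), h0]
      positivity)
  -- From (s, 1/I), `X` recovers the scaled data (vT, 1/v) of the virtual collision. Through the
  -- common phase and velocity, `X'` then recovers the data of the real one.
  let X : ℝ × ℝ → ℝ × ℝ := Φ.symm
  have hXO : ∀ y ∈ Φ.target, X y ∈ O := fun y hy => hΦO (Φ.map_target hy)
  let A : ℝ × ℝ → ℝ × ℝ := fun x => (impactPhase γ x, x.2)
  have hA : ContDiff ℝ ∞ A := (contDiff_impactPhase hγ).prodMk contDiff_snd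
  let W : Set (ℝ × ℝ) := Φ.target ∩ (fun y => A (X y)) ⁻¹' Ψ.target
  have hW : IsOpen W := (hA.continuous.comp_continuousOn hΦs.continuousOn).isOpen_inter_preimage
    Φ.open_target Ψ.open_target
  let X' : ℝ × ℝ → ℝ × ℝ := fun y => Ψ.symm (A (X y))
  have hX'O : ∀ y ∈ W, X' y ∈ O' := fun y hy => hΨO (Ψ.map_target hy.2)
  have cX : ContDiffOn ℝ ∞ X W := hΦs.mono inter_subset_left
  have cX' : ContDiffOn ℝ ∞ X' W := hΨs.comp (hA.comp_contDiffOn cX) fun y hy => hy.2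
  have hOW : ∀ {F : ℝ × ℝ → ℝ}, ContDiffOn ℝ ∞ F O → ContDiffOn ℝ ∞ (fun y => F (X y)) W :=
    fun hF => hF.comp cX fun y hy => hXO y hy.1
  have hOW' : ∀ {F : ℝ × ℝ → ℝ}, ContDiffOn ℝ ∞ F O' → ContDiffOn ℝ ∞ (fun y => F (X' y)) W :=
    fun hF => hF.comp cX' fun y hy => hX'O y hy
  have hkW : Φ '' k ⊆ W := by
    rintro _ ⟨⟨t, δ⟩, hx, rfl⟩
    have hδ : δ = 0 := hx.2
    subst hδ
    refine ⟨Φ.map_source (hkΦ hx), ?_⟩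
    have e1 : X (Φ (t, 0)) = (t, 0) := Φ.left_inv (hkΦ hx)
    change A (X (Φ (t, 0))) ∈ Ψ.target
    have e2 : A (t, 0) = Ψ (t, 0) := by
      rw [eΨ]; simp [A, impactPhase_zero, h0]
    rw [e1, e2]
    exact Ψ.map_source (hkΨ hx)
  set l := γ 0 with hldef
  set Δ := J * l * (deriv γ' 0 - deriv γ 0) with hΔ
  set β := deriv (deriv γ') 0 - deriv (deriv γ) 0 with hβ
  set Δ₁ := 1 / 2 * J ^ 2 * l ^ 3 * β with hΔ₁
  let Z : ℝ × ℝ → ℝ := fun y => (J / 2 * M (X y)) ^ 2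
  let s₀ : ℝ × ℝ → ℝ := fun y => impactPhase γ (X y)
  have cZ : ContDiffOn ℝ ∞ Z W := (contDiffOn_const.mul (hOW hM)).pow 2
  have cs₀ : ContDiffOn ℝ ∞ s₀ W := hOW (contDiff_impactPhase hγ).contDiffOn
  obtain ⟨C, hC1, hC2, hC3⟩ := exists_contDiff_extension (k := Φ '' k) (F := ℝ × ℝ)
    (f := fun y => (Z y * (S' (X' y) - S (X y)),
      Z y * (- Δ * S (X y) - Δ₁ * y.2 * (S (X y) * (s₀ y + y.1 - 1)) + Y' (X' y) - Y (X y)) +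
        J * β * l ^ 2 * (J / 2) ^ 2 * (M (X y) * M₁ (X y)) * ((s₀ y - 1 / 2) ^ 2 - 1 / 12)))
    (hk.image_of_continuousOn (Φ.continuousOn.mono hkΦ)) hW hkW
    (by
      refine ContDiffOn.prodMk (cZ.mul ((hOW' hS').sub (hOW hS))) (ContDiffOn.add (cZ.mul ?_)
        ((contDiffOn_const.mul ((hOW hM).mul (hOW hM₁))).mul
          (((cs₀.sub contDiffOn_const).pow 2).sub contDiffOn_const)))
      refine ContDiffOn.sub (ContDiffOn.add (ContDiffOn.sub (contDiffOn_const.mul (hOW hS))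
        (ContDiffOn.mul (by fun_prop) ((hOW hS).mul ((cs₀.add (by fun_prop)).sub
        contDiffOn_const)))) (hOW' hY')) (hOW hY))
  obtain ⟨U, hU, hkU, hUP⟩ := mem_nhdsSet_iff_exists.1 (hC3.and (hW.mem_nhdsSet.2 hkW))
  have hnear : ∀ᶠ x in 𝓝ˢ k, x ∈ Φ.source ∧ Φ x ∈ U ∧ x ∈ Ψ.source := by
    have h1 : IsOpen (Φ.source ∩ Φ ⁻¹' U) := Φ.isOpen_inter_preimage hU
    have h2 : k ⊆ Φ.source ∩ Φ ⁻¹' U := fun x hx => ⟨hkΦ hx, hkU (mem_image_of_mem _ hx)⟩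
    filter_upwards [h1.mem_nhdsSet.2 h2, Ψ.open_source.mem_nhdsSet.2 hkΨ] with x hx hx'
    exact ⟨hx.1, hx.2, hx'⟩
  refine ⟨C, hC1, hC2, ?_⟩
  rcases lt_or_ge B 0 with hB0 | hB0
  -- For negative `B` the interval of admissible times is empty.
  · refine ⟨1, one_pos, fun v T T' _ _ h1 => ?_⟩
    exact absurd (h1.1.trans h1.2) (not_le.2 hB0)
  obtain ⟨ε, hε, hεP⟩ := exists_pos_of_eventually_nhdsSet hB0 hnear
  refine ⟨ε, hε, fun v T T' hv hvε hT hT' heq => ?_⟩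
  have hvi : 0 < v⁻¹ := inv_pos.2 hv
  have habs : |v⁻¹| < ε := by rwa [abs_of_pos hvi]
  obtain ⟨p1, p2, -⟩ := hεP (v * T) v⁻¹ ⟨by linarith [hT.1], by linarith [hT.2]⟩ habs
  obtain ⟨-, -, p3⟩ := hεP (v * T') v⁻¹ ⟨by linarith [hT'.1], by linarith [hT'.2]⟩ habs
  set x : ℝ × ℝ := (v * T, v⁻¹) with hx
  set x' : ℝ × ℝ := (v * T', v⁻¹) with hx'
  have hxO := hΦO p1
  have hxO' := hΨO p3
  obtain ⟨k1, k2⟩ := key v T hv hxO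
  obtain ⟨k1', k2'⟩ := key' v T' hv hxO'
  rw [← hx] at k1 k2
  rw [← hx'] at k1' k2'
  obtain ⟨c1, c2⟩ := hUP p2
  have eX : X (Φ x) = x := Φ.left_inv p1
  -- The quantity vT - γ(T) is v times the time of the bounce off the fixed wall, so it does not
  -- depend on the law of the moving wall. With γ' 0 = γ 0 the two phases agree exactly.
  have eAx : A x = Ψ x' := by
    rw [eΨ]
    simp only [A, impactPhase, hx, hx', mul_one, ← hldef, h0]
    have i1 : v⁻¹ * (v * T) = T := by field_simp
    have i2 : v⁻¹ * (v * T') = T' := by field_simp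
    rw [i1, i2, heq]
  have eX' : X' (Φ x) = x' := by
    change Ψ.symm (A (X (Φ x))) = x'
    rw [eX, eAx]
    exact Ψ.left_inv p3
  have eph : impactPhase γ' x' = impactPhase γ x := by
    have := congrArg Prod.fst eAx
    rw [eΨ] at this
    exact this.symm
  set I := J / 2 * M x * v with hI
  have hMx := Mpos x hxO
  have hIpos : 0 < I := by positivity
  have eΦx : Φ x = (impactPhase γ x + v⁻¹ ^ 2 * S x, I⁻¹) := by
    rw [eΦ]
    refine Prod.ext rfl ?_
    simp only [h, hI, hx]
    field_simp
  refine ⟨impactPhase γ x + v⁻¹ ^ 2 * S x, I, hIpos, k1, ?_⟩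
  rw [← eΦx, c1, k1', k2']
  simp only [Z, s₀, eX, eX']
  simp only [eΦx, eph, h0]
  have ev : v⁻¹ = I⁻¹ * (J / 2 * M x) := by rw [hI]; field_simp
  have ev2 : v⁻¹ ^ 2 = I⁻¹ ^ 2 * (J / 2 * M x) ^ 2 := by rw [ev]; ring
  have eMx := eM x hxO
  -- Replacing 1/v by Jl/(2I) up to O(I⁻²) turns the second order jump J l² β/v into Δ₁/I with Δ₁ =
  -- ½J²l³β.
  have ev3 : v⁻¹ = J / 2 * l * I⁻¹ + I⁻¹ ^ 2 * ((J / 2) ^ 2 * (M x * M₁ x)) := by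
    have : v⁻¹ = I⁻¹ * (J / 2 * (l + v⁻¹ * M₁ x)) := by
      conv_lhs => rw [ev, eMx]
    rw [this]
    linear_combination (J / 2 * M₁ x) * I⁻¹ * ev
  clear_value I
  refine Prod.ext ?_ ?_
  · simp only [Prod.fst_add, Prod.smul_fst, smul_eq_mul]
    linear_combination (S' x' - S x) * ev2
  · simp only [Prod.snd_add, Prod.smul_snd, smul_eq_mul]
    generalize impactPhase γ x = a at *
    linear_combination (-1) * k2 + (Y' x' - Y x - Δ * S x - I⁻¹ * Δ₁ * S x * (2 * a + v⁻¹ ^ 2 * S x - 1)) * ev2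
      + J * l ^ 2 * β * ((a - 1 / 2) ^ 2 - 1 / 12) * ev3

/-! ### Uniform jet bounds on compact sets -/

section Jets

variable {E F : Type*} [NormedAddCommGroup E] [NormedSpace ℝ E] [NormedAddCommGroup F]
  [NormedSpace ℝ F]

theorem JetBound.const_smul {K : ℕ} {f : E → F} {x : E} {C : ℝ} (hf : JetBound K f x C) (c : ℝ) :
    JetBound K (fun y => c • f y) x (|c| * C) := by
  refine ⟨contDiffAt_const.smul hf.1, fun k hk => ?_⟩
  have hk' : (k : ℕ∞ω) ≤ K := by exact_mod_cast hk
  change ‖iteratedFDeriv ℝ k (c • f) x‖ ≤ _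
  rw [iteratedFDeriv_const_smul_apply (hf.1.of_le hk'), norm_smul, Real.norm_eq_abs]
  exact mul_le_mul_of_nonneg_left (hf.2 k hk) (abs_nonneg _)

theorem exists_jetBound_of_isCompact (K : ℕ) {f : E → F} {O k : Set E} (hO : IsOpen O)
    (hk : IsCompact k) (hkO : k ⊆ O) (hf : ContDiffOn ℝ ∞ f O) :
    ∃ C, 0 < C ∧ ∀ x ∈ k, JetBound K f x C := by
  have hat : ∀ x ∈ k, ContDiffAt ℝ ∞ f x := fun x hx => hf.contDiffAt (hO.mem_nhds (hkO hx))
  have hb : ∀ i : ℕ, ∃ C, ∀ x ∈ k, ‖iteratedFDeriv ℝ i f x‖ ≤ C := fun i =>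
    hk.exists_bound_of_continuousOn fun x hx =>
      ((hat x hx).iteratedFDeriv_right (i := i) (m := 0)
        (by rw [zero_add]; exact_mod_cast le_top)).continuousAt.continuousWithinAt
  choose C hC using hb
  refine ⟨∑ i ∈ Finset.range (K + 1), |C i| + 1, by positivity, fun x hx =>
    ⟨(hat x hx).of_le (by exact_mod_cast le_top), fun i hi => ?_⟩⟩
  refine ((hC i x hx).trans (le_abs_self _)).trans ?_
  have := Finset.single_le_sum (f := fun i => |C i|) (fun j _ => abs_nonneg _)
    (Finset.mem_range.2 (Nat.lt_succ_of_le hi))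
  linarith

end Jets

/-! ### Iterates of a perturbed shift -/

/-- The error term `I⁻³ e(a/I, 1/I)`. -/
noncomputable def shiftError (e : ℝ × ℝ → ℝ × ℝ) (p : ℝ × ℝ) : ℝ × ℝ :=
  (p.2⁻¹ ^ 3) • e (p.1 / p.2, p.2⁻¹)

/-- The map `(a, I) ↦ (a + 1, I) + I⁻³ e(a/I, 1/I)`. -/
noncomputable def shiftMap (e : ℝ × ℝ → ℝ × ℝ) (p : ℝ × ℝ) : ℝ × ℝ :=
  (p.1 + 1, p.2) + shiftError e p

/-- A smooth function of `(a/I, 1/I)` has bounded jets in the region `|a| ≤ 3m`, `|I - m| ≤ m/2`. -/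
theorem exists_jetBound_rescale (K : ℕ) {F : Type*} [NormedAddCommGroup F] [NormedSpace ℝ F]
    {H : ℝ × ℝ × ℝ → F} (hH : ContDiffOn ℝ ∞ H {q | -1 < q.2.1}) :
    ∃ C, 0 < C ∧ ∀ m : ℕ, 1 ≤ m → ∀ p : ℝ × ℝ, |p.1| ≤ 3 * m → |p.2 - m| ≤ m / 2 →
      JetBound K (fun p : ℝ × ℝ => H (p.1 / m, (p.2 - m) / m, (m : ℝ)⁻¹)) p C := by
  have hO : IsOpen {q : ℝ × ℝ × ℝ | -1 < q.2.1} :=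
    isOpen_lt continuous_const (by fun_prop)
  obtain ⟨C, hC, hCb⟩ := exists_jetBound_of_isCompact K hO
    ((isCompact_Icc (a := (-3 : ℝ)) (b := 3)).prod
      ((isCompact_Icc (a := (-1 / 2 : ℝ)) (b := 1 / 2)).prod (isCompact_Icc (a := (0 : ℝ)) (b := 1))))
    (by rintro ⟨a, b, c⟩ ⟨-, hb, -⟩; change -1 < b; linarith [hb.1]) hH
  refine ⟨K.factorial * C * 1 ^ K, by positivity, fun m hm p h1 h2 => ?_⟩
  have hm0 : (0 : ℝ) < m := by exact_mod_cast hm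
  have hm1 : (1 : ℝ) ≤ m := by exact_mod_cast hm
  have hmem : (p.1 / m, (p.2 - m) / m, (m : ℝ)⁻¹) ∈
      Icc (-3 : ℝ) 3 ×ˢ Icc (-1 / 2 : ℝ) (1 / 2) ×ˢ Icc (0 : ℝ) 1 := by
    rw [abs_le] at h1 h2
    refine ⟨⟨?_, ?_⟩, ⟨?_, ?_⟩, ?_, ?_⟩
    · rw [le_div_iff₀ hm0]; linarith
    · rw [div_le_iff₀ hm0]; linarith
    · rw [le_div_iff₀ hm0]; linarith
    · rw [div_le_iff₀ hm0]; linarith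
    · positivity
    · exact inv_le_one_of_one_le₀ hm1
  -- The rescaling maps the region into a fixed compact box and has linear part of norm at most 1/m
  -- ≤ 1, so the composition costs no more than a constant.
  let L : ℝ × ℝ →L[ℝ] ℝ × ℝ × ℝ := (m : ℝ)⁻¹ • (ContinuousLinearMap.fst ℝ ℝ ℝ).prod
    ((ContinuousLinearMap.snd ℝ ℝ ℝ).prod 0)
  have hL : ‖L‖ ≤ 1 := by
    refine ContinuousLinearMap.opNorm_le_bound _ zero_le_one fun q => ?_
    have h3 : (m : ℝ)⁻¹ ≤ 1 := inv_le_one_of_one_le₀ hm1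
    have h4 : ‖((q.1, q.2, (0 : ℝ)) : ℝ × ℝ × ℝ)‖ ≤ ‖q‖ := by
      simp only [Prod.norm_def, norm_zero]
      exact max_le (le_max_left _ _) (max_le (le_max_right _ _)
        ((norm_nonneg q.1).trans (le_max_left _ _)))
    calc ‖L q‖ = (m : ℝ)⁻¹ * ‖((q.1, q.2, (0 : ℝ)) : ℝ × ℝ × ℝ)‖ := by
          simp only [L, smul_apply, norm_smul, norm_inv]
          simp
      _ ≤ 1 * ‖q‖ := by gcongr
  refine (JetBound.comp (f := fun p : ℝ × ℝ => L p + (0, -1, (m : ℝ)⁻¹)) (g := H) (C := C) (D := 1)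
    ?_ (DerivBound.affine L _ hL) le_rfl).congr ?_
  · have : L p + (0, -1, (m : ℝ)⁻¹) = (p.1 / m, (p.2 - m) / m, (m : ℝ)⁻¹) := by
      refine Prod.ext ?_ (Prod.ext ?_ ?_) <;> simp [L] <;> field_simp
      ring
    rw [this]
    exact hCb _ hmem
  · refine Eventually.of_forall fun q => ?_
    simp only
    congr 1
    refine Prod.ext ?_ (Prod.ext ?_ ?_) <;> simp [L] <;> field_simp
    ring

/-- With I = m(1 + y) the error is m⁻³ times a fixed smooth function of the rescaled variables a/m,
y and 1/m. -/
theorem exists_shiftError_bound (K : ℕ) {e : ℝ × ℝ → ℝ × ℝ} (he : ContDiff ℝ ∞ e) :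
    ∃ C, 0 < C ∧ ∀ m : ℕ, 1 ≤ m → ∀ p : ℝ × ℝ, |p.1| ≤ 3 * m → |p.2 - m| ≤ m / 2 →
      JetBound K (shiftError e) p (C / m ^ 3) := by
  have hH : ContDiffOn ℝ ∞ (fun q : ℝ × ℝ × ℝ =>
      ((1 + q.2.1)⁻¹ ^ 3) • e (q.1 / (1 + q.2.1), q.2.2 / (1 + q.2.1))) {q | -1 < q.2.1} := by
    have h0 : ∀ q ∈ {q : ℝ × ℝ × ℝ | -1 < q.2.1}, 1 + q.2.1 ≠ 0 := fun q hq => by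
      have : -1 < q.2.1 := hq
      linarith
    refine ContDiffOn.smul ((ContDiffOn.inv (by fun_prop) h0).pow 3) (he.comp_contDiffOn
      (ContDiffOn.prodMk (ContDiffOn.div (by fun_prop) (by fun_prop) h0)
        (ContDiffOn.div (by fun_prop) (by fun_prop) h0)))
  obtain ⟨C, hC, hb⟩ := exists_jetBound_rescale K hH
  refine ⟨C, hC, fun m hm p h1 h2 => ?_⟩
  have hm0 : (0 : ℝ) < m := by exact_mod_cast hm
  have := ((hb m hm p h1 h2).const_smul ((m : ℝ)⁻¹ ^ 3)).congr (g := shiftError e)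
    (Eventually.of_forall fun q => by
      simp only [shiftError]
      have e1 : 1 + (q.2 - m) / m = q.2 / m := by field_simp; ring
      rw [e1, smul_smul]
      have e2 : (m : ℝ)⁻¹ ^ 3 * (q.2 / m)⁻¹ ^ 3 = q.2⁻¹ ^ 3 := by
        rw [← mul_pow]; congr 1; rw [inv_div]; field_simp
      have e3 : q.1 / m / (q.2 / m) = q.1 / q.2 := by field_simp
      have e4 : (m : ℝ)⁻¹ / (q.2 / m) = q.2⁻¹ := by
        rw [div_div_eq_mul_div]; field_simp
      rw [e2, e3, e4])
  convert this using 1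
  rw [abs_of_nonneg (by positivity)]
  field_simp

theorem contDiffAt_shiftMap {e : ℝ × ℝ → ℝ × ℝ} (he : ContDiff ℝ ∞ e) {p : ℝ × ℝ}
    (hp : p.2 ≠ 0) : ContDiffAt ℝ ∞ (shiftMap e) p := by
  have h1 : ContDiffAt ℝ ∞ (fun p : ℝ × ℝ => p.2⁻¹) p := contDiffAt_snd.inv hp
  unfold shiftMap shiftError
  refine ContDiffAt.add (by fun_prop) ((h1.pow 3).smul (he.contDiffAt.comp p
    (ContDiffAt.prodMk (contDiffAt_fst.div contDiffAt_snd hp) h1)))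

/-- The iterates of `shiftMap e` are close to translations. -/
theorem exists_iterate_shiftMap_bound (K : ℕ) {e : ℝ × ℝ → ℝ × ℝ} (he : ContDiff ℝ ∞ e) (r : ℝ) :
    ∃ C, 0 < C ∧ ∀ᶠ m : ℕ in atTop, ∀ j ≤ 2 * m, ∀ p : ℝ × ℝ, |p.1| < r → |p.2 - m| < r →
      ContDiffAt ℝ ∞ (shiftMap e)^[j] p ∧
      JetBound K (fun q => (shiftMap e)^[j] q - (q.1 + j, q.2)) p (C * j / m ^ 3) := by
  obtain ⟨C₀, hC₀, hb⟩ := exists_shiftError_bound K he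
  set C := K.factorial * C₀ * 2 ^ K with hC
  have hCpos : 0 < C := by positivity
  refine ⟨C, hCpos, ?_⟩
  filter_upwards [eventually_ge_atTop 1, eventually_ge_atTop (⌈2 * C⌉₊),
    eventually_ge_atTop (⌈2 * (|r| + 1) + 2⌉₊)] with m hm1 hmC hmr
  have hm1' : (1 : ℝ) ≤ m := by exact_mod_cast hm1
  have hm0 : (0 : ℝ) < m := by linarith
  have hmC' : 2 * C ≤ m := Nat.ceil_le.1 hmC
  have hmr' : 2 * (|r| + 1) + 2 ≤ m := Nat.ceil_le.1 hmr
  have hr := le_abs_self r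
  -- After at most 2m steps the total drift is still at most 1. Hence the orbit stays where the
  -- one-step bound holds, and each iterate has derivatives bounded by 2, the constant that enters
  -- `C`.
  have small : ∀ j ≤ 2 * m, C * j / m ^ 3 ≤ 1 := by
    intro j hj
    have hj' : (j : ℝ) ≤ 2 * m := by exact_mod_cast hj
    rw [div_le_one (by positivity)]
    calc C * j ≤ C * (2 * m) := by gcongr
      _ = 2 * C * m := by ring
      _ ≤ m * m := by gcongr
      _ ≤ m * m * m := le_mul_of_one_le_right (by positivity) hm1'
      _ = m ^ 3 := by ring
  intro j
  induction j with
  | zero =>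
    intro _ p hp1 hp2
    refine ⟨by simpa using contDiffAt_id, ?_, fun k hk => ?_⟩
    · simpa using contDiffAt_const
    · simp only [Function.iterate_zero, id_eq, CharP.cast_eq_zero, add_zero, Prod.mk.eta, sub_self]
      rw [iteratedFDeriv_fun_zero]
      simp
  | succ j ih =>
    intro hj p hp1 hp2
    have hj2 : j ≤ 2 * m := by omega
    have hj' : (j : ℝ) ≤ 2 * m := by exact_mod_cast hj2
    obtain ⟨i1, i2⟩ := ih hj2 p hp1 hp2
    set x := (shiftMap e)^[j] p with hx
    have hn : ‖x - (p.1 + j, p.2)‖ ≤ 1 := i2.norm_le.trans (small j hj2)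
    rw [Prod.norm_def, max_le_iff] at hn
    simp only [Prod.fst_sub, Prod.snd_sub, Real.norm_eq_abs] at hn
    obtain ⟨n1, n2⟩ := hn
    rw [abs_lt] at hp1 hp2
    rw [abs_le] at n1 n2
    have hj0 : (0 : ℝ) ≤ j := Nat.cast_nonneg j
    have b1 : |x.1| ≤ 3 * m := abs_le.2 ⟨by linarith, by linarith⟩
    have b2 : |x.2 - m| ≤ m / 2 := abs_le.2 ⟨by linarith, by linarith⟩
    have hx2 : x.2 ≠ 0 := by
      have := (abs_le.1 b2).1
      intro h; rw [h] at this; linarith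
    have db : DerivBound K (shiftMap e)^[j] p 2 := by
      have h1 := (DerivBound.affine (K := K) (x := p) (ContinuousLinearMap.id ℝ (ℝ × ℝ))
        ((j : ℝ), (0 : ℝ)) ContinuousLinearMap.norm_id_le).add i2.derivBound
      refine (h1.mono (by linarith [small j hj2])).congr (Eventually.of_forall fun q => ?_)
      refine Prod.ext ?_ ?_ <;> simp
    have hcomp := (hb m hm1 x b1 b2).comp db one_le_two
    refine ⟨?_, (i2.add hcomp).mono ?_ |>.congr ?_⟩
    · rw [Function.iterate_succ']
      exact (contDiffAt_shiftMap he hx2).comp p i1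
    · apply le_of_eq
      rw [hC]; push_cast; field_simp
    · refine Eventually.of_forall fun q => ?_
      simp only [Function.iterate_succ_apply']
      rw [shiftMap]
      refine Prod.ext ?_ ?_ <;> simp <;> ring

/-! ### The curves bounding the pieces -/

theorem DerivBound.norm_fderiv_le {E F : Type*} [NormedAddCommGroup E] [NormedSpace ℝ E]
    [NormedAddCommGroup F] [NormedSpace ℝ F] {K : ℕ} {f : E → F} {x : E} {C : ℝ}
    (h : DerivBound K f x C) (hK : 1 ≤ K) : ‖fderiv ℝ f x‖ ≤ C := by
  have := h.2 1 le_rfl hK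
  rwa [norm_iteratedFDeriv_one] at this

/-- The zero set of a perturbation of `a + μ - I` is a graph over `a`. -/
theorem exists_root_curve (K : ℕ) (hK : 1 ≤ K) : ∃ C κ₀ : ℝ, 0 < C ∧ 0 < κ₀ ∧
    ∀ (μ κ : ℝ) (ε : ℝ × ℝ → ℝ), κ ≤ κ₀ →
      (∀ p : ℝ × ℝ, |p.1| < 4 → |p.2 - μ| < 8 → ContDiffAt ℝ ∞ ε p ∧ JetBound K ε p κ) →
      ∃ g : ℝ → ℝ, (∀ a, |a| < 3 → ContDiffAt ℝ ∞ g a ∧ JetBound K g a (C * κ)) ∧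
        ∀ a I, |a| < 3 → |I - μ| < 8 → (0 ≤ a + μ - I + ε (a, I) ↔ I ≤ a + μ - g a) := by
  have hfac : (0 : ℝ) < K.factorial := by exact_mod_cast K.factorial_pos
  have hfac1 : (1 : ℝ) ≤ K.factorial := by exact_mod_cast K.factorial_pos
  refine ⟨K.factorial * (2 ^ K) ^ K, (2 * K.factorial)⁻¹, by positivity, by positivity,
    fun μ κ ε hκ hε => ?_⟩
  have hκ2 : K.factorial * κ ≤ 1 / 2 := by
    calc K.factorial * κ ≤ K.factorial * (2 * K.factorial : ℝ)⁻¹ := by gcongr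
      _ = 1 / 2 := by field_simp
  have hκ3 : κ ≤ 1 / 2 := by
    rcases le_or_gt κ 0 with h | h
    · linarith
    · exact (le_mul_of_one_le_left h.le hfac1).trans hκ2
  set U : Set (ℝ × ℝ) := {p | |p.1| < 4 ∧ |p.2 - μ| < 8} with hUdef
  have hU : IsOpen U :=
    (isOpen_lt (f := fun p : ℝ × ℝ => |p.1|) (by fun_prop) continuous_const).inter
      (isOpen_lt (f := fun p : ℝ × ℝ => |p.2 - μ|) (by fun_prop) continuous_const)
  set s : ℝ × ℝ → ℝ := fun p => p.1 + μ - p.2 + ε p with hs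
  have hsat : ∀ p ∈ U, ContDiffAt ℝ ∞ s p := fun p hp => by
    have := (hε p hp.1 hp.2).1
    exact (by fun_prop : ContDiffAt ℝ ∞ (fun p : ℝ × ℝ => p.1 + μ - p.2) p).add this
  have hsec : ∀ p ∈ U, HasDerivAt (fun I => s (p.1, I)) (fderiv ℝ s p (0, 1)) p.2 := by
    intro p hp
    have h1 : HasFDerivAt s (fderiv ℝ s p) (p.1, p.2) :=
      ((hsat p hp).differentiableAt (by simp)).hasFDerivAt
    have h2 : HasDerivAt (fun I : ℝ => (p.1, I)) ((0 : ℝ), (1 : ℝ)) p.2 :=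
      (hasDerivAt_const _ _).prodMk (hasDerivAt_id _)
    exact h1.comp_hasDerivAt p.2 h2
  have hneg : ∀ p ∈ U, fderiv ℝ s p (0, 1) < 0 := by
    intro p hp
    obtain ⟨h1, h2⟩ := hε p hp.1 hp.2
    have h3 : HasFDerivAt s (ContinuousLinearMap.fst ℝ ℝ ℝ - ContinuousLinearMap.snd ℝ ℝ ℝ +
        fderiv ℝ ε p) p :=
      (((hasFDerivAt_fst (𝕜 := ℝ) (p := p)).add_const μ).sub hasFDerivAt_snd).add
        (h1.differentiableAt (by simp)).hasFDerivAt
    have h4 : ‖fderiv ℝ ε p (0, 1)‖ ≤ κ * 1 := by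
      refine (ContinuousLinearMap.le_of_opNorm_le _ (h2.derivBound.norm_fderiv_le hK) _).trans ?_
      gcongr
      · exact h2.nonneg
      · simp [Prod.norm_def]
    rw [h3.fderiv]
    rw [Real.norm_eq_abs, abs_le] at h4
    simp only [add_apply, sub_apply, ContinuousLinearMap.coe_fst',
      ContinuousLinearMap.coe_snd']
    linarith [h4.2]
  have hball : ∀ I, I ∈ Ioo (μ - 8) (μ + 8) ↔ |I - μ| < 8 := fun I => by
    rw [abs_lt, mem_Ioo]; constructor <;> rintro ⟨h1, h2⟩ <;> constructor <;> linarith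
  have hanti : ∀ a, |a| < 4 → StrictAntiOn (fun I => s (a, I)) (Ioo (μ - 8) (μ + 8)) := by
    intro a ha
    refine strictAntiOn_of_deriv_neg (convex_Ioo _ _) (fun I hI => ?_) fun I hI => ?_
    · exact (hsec (a, I) ⟨ha, (hball I).1 hI⟩).continuousAt.continuousWithinAt
    · rw [interior_Ioo] at hI
      rw [(hsec (a, I) ⟨ha, (hball I).1 hI⟩).deriv]
      exact hneg (a, I) ⟨ha, (hball I).1 hI⟩
  -- As s decreases strictly in I, (a, I) ↦ (a, s(a, I)) is a diffeomorphism onto its image; its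
  -- inverse on the line s = 0 gives the root as a smooth function of a.
  set f : ℝ × ℝ → ℝ × ℝ := fun p => (p.1, s p) with hf
  obtain ⟨Φ, hΦs, hΦ, hΦsm⟩ := exists_openPartialHomeomorph_of_injOn (f := f) hU
    (fun p hp => (contDiffAt_fst.prodMk (hsat p hp)).contDiffWithinAt)
    (by
      rintro ⟨a, I⟩ hp ⟨b, J⟩ hq h
      simp only [hf, Prod.mk.injEq] at h
      obtain ⟨rfl, h⟩ := h
      rw [(hanti a hp.1).injOn ((hball I).2 hp.2) ((hball J).2 hq.2) h])
    (fun p hp => by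
      have h1 : HasFDerivAt f ((ContinuousLinearMap.fst ℝ ℝ ℝ).prod (fderiv ℝ s p)) p :=
        hasFDerivAt_fst.prodMk ((hsat p hp).differentiableAt (by simp)).hasFDerivAt
      rw [h1.fderiv, det_prod_real]
      simpa using (hneg p hp).ne)
  have hroot : ∀ a, |a| < 3 → ∃ I, |I - μ| < 8 ∧ s (a, I) = 0 := by
    intro a ha
    rw [abs_lt] at ha
    have hin : ∀ I ∈ Icc (a + μ - 1) (a + μ + 1), (a, I) ∈ U := fun I hI =>
      ⟨abs_lt.2 ⟨by simp only; linarith, by simp only; linarith⟩,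
        abs_lt.2 ⟨by simp only; linarith [hI.1], by simp only; linarith [hI.2]⟩⟩
    have hle : a + μ - 1 ≤ a + μ + 1 := by linarith
    have hε1 : ∀ I ∈ Icc (a + μ - 1) (a + μ + 1), |ε (a, I)| ≤ 1 / 2 := fun I hI =>
      ((hε _ (hin I hI).1 (hin I hI).2).2.norm_le).trans hκ3
    have h0 : (0 : ℝ) ∈ (fun I => s (a, I)) '' Icc (a + μ - 1) (a + μ + 1) := by
      refine intermediate_value_Icc' hle (fun I hI =>
        (hsec (a, I) (hin I hI)).continuousAt.continuousWithinAt) ⟨?_, ?_⟩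
      · have := (abs_le.1 (hε1 _ (right_mem_Icc.2 hle))).2
        simp only [hs]; linarith
      · have := (abs_le.1 (hε1 _ (left_mem_Icc.2 hle))).1
        simp only [hs]; linarith
    obtain ⟨I, hI, hI0⟩ := h0
    exact ⟨I, (hin I hI).2, hI0⟩
  have htar : ∀ a, |a| < 3 → ∃ I, |I - μ| < 8 ∧ s (a, I) = 0 ∧ (a, (0 : ℝ)) ∈ Φ.target ∧
      Φ.symm (a, 0) = (a, I) := by
    intro a ha
    obtain ⟨I, h1, h2⟩ := hroot a ha
    have h3 : (a, I) ∈ Φ.source := by rw [hΦs]; exact ⟨by simp only; linarith, h1⟩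
    have h4 : Φ (a, I) = (a, 0) := by rw [hΦ]; simp only [hf, h2]
    refine ⟨I, h1, h2, ?_, ?_⟩
    · rw [← h4]; exact Φ.map_source h3
    · rw [← h4]; exact Φ.left_inv h3
  set g : ℝ → ℝ := fun a => a + μ - (Φ.symm (a, 0)).2 with hg
  have hgsm : ∀ a, |a| < 3 → ContDiffAt ℝ ∞ g a := by
    intro a ha
    obtain ⟨I, -, -, h3, -⟩ := htar a ha
    have h4 : ContDiffAt ℝ ∞ Φ.symm (a, 0) := hΦsm.contDiffAt (Φ.open_target.mem_nhds h3)
    have h5 : ContDiffAt ℝ ∞ (fun a : ℝ => (a, (0 : ℝ))) a := by fun_prop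
    exact (by fun_prop : ContDiffAt ℝ ∞ (fun a : ℝ => a + μ) a).sub
      (contDiffAt_snd.comp a (h4.comp a h5))
  have hgroot : ∀ a, |a| < 3 → (a, a + μ - g a) ∈ U ∧ g a = - ε (a, a + μ - g a) := by
    intro a ha
    obtain ⟨I, h1, h2, -, h4⟩ := htar a ha
    have h5 : a + μ - g a = I := by simp only [hg, h4]; ring
    rw [h5]
    simp only [hs] at h2
    exact ⟨⟨by simp only; linarith, h1⟩, by linarith⟩
  have hopen : ∀ a : ℝ, |a| < 3 → ∀ᶠ b in 𝓝 a, |b| < 3 := fun a ha =>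
    (isOpen_lt continuous_abs continuous_const).mem_nhds ha
  refine ⟨g, fun a ha => ⟨hgsm a ha, ?_⟩, fun a I ha hI => ?_⟩
  · obtain ⟨hu, he⟩ := hgroot a ha
    obtain ⟨-, hj⟩ := hε _ hu.1 hu.2
    set γ : ℝ → ℝ × ℝ := fun a => (a, a + μ - g a) with hγ
    have hγsm : ContDiffAt ℝ K γ a :=
      (contDiffAt_id.prodMk ((by fun_prop : ContDiffAt ℝ ∞ (fun a : ℝ => a + μ) a).sub
        (hgsm a ha))).of_le (by exact_mod_cast le_top)
    let L : ℝ →L[ℝ] ℝ × ℝ := (ContinuousLinearMap.id ℝ ℝ).prod (ContinuousLinearMap.id ℝ ℝ)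
    have hL : ‖L‖ ≤ 1 := ContinuousLinearMap.opNorm_le_bound _ zero_le_one fun x => by
      simp [L, Prod.norm_def]
    have hz : JetBound K (fun _ : ℝ × ℝ => (0 : ℝ)) (γ a) κ := by
      refine ⟨contDiffAt_const, fun k hk => ?_⟩
      rw [iteratedFDeriv_fun_zero]
      simpa using hj.nonneg
    -- The graph γ(a) = (a, a + μ - g(a)) solves γ = A + (0, ε) ∘ γ with A affine, so its
    -- derivatives are bounded independently of μ. Then g = -ε ∘ γ inherits the size of ε.
    have hd := DerivBound.of_eq_add_comp (φ := γ) (A := fun a => L a + (0, μ))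
      (ε := fun p => ((0 : ℝ), ε p)) hγsm (DerivBound.affine L _ hL) (hz.prodMk hj) (by
        filter_upwards [hopen a ha] with b hb
        have := (hgroot b hb).2
        refine Prod.ext ?_ ?_
        · simp [L, hγ]
        · simp only [L, hγ, Prod.snd_add, ContinuousLinearMap.prod_apply,
            ContinuousLinearMap.id_apply]
          linarith) hκ2
    refine ((JetBound.comp (f := γ) (g := ε) hj hd
      (one_le_pow₀ (by norm_num))).neg.mono (le_of_eq (by ring))).congr ?_
    filter_upwards [hopen a ha] with b hb
    exact (hgroot b hb).2
  · obtain ⟨hu, he⟩ := hgroot a ha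
    have h0 : s (a, a + μ - g a) = 0 := by simp only [hs]; linarith
    have := (hanti a (by linarith)).le_iff_ge ((hball _).2 hu.2) ((hball I).2 hI)
    simp only [h0] at this
    exact this

theorem JetBound.zero {E F : Type*} [NormedAddCommGroup E] [NormedSpace ℝ E]
    [NormedAddCommGroup F] [NormedSpace ℝ F] {K : ℕ} {x : E} {C : ℝ} (hC : 0 ≤ C) :
    JetBound K (fun _ : E => (0 : F)) x C := by
  refine ⟨contDiffAt_const, fun k _ => ?_⟩
  rw [iteratedFDeriv_fun_zero]
  simpa using hC

/-- The primitive of a function supported in `[-3,3]` inherits its jet bounds. -/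
theorem JetBound.primitive {K : ℕ} {G : ℝ → ℝ} {C : ℝ} (hG : ContDiff ℝ ∞ G)
    (hsupp : ∀ a, 3 ≤ |a| → G a = 0) (h : ∀ a, JetBound K G a C) (a : ℝ) :
    JetBound K (fun a => ∫ x in (0 : ℝ)..a, G x) a (6 * C) := by
  have hC := (h 0).nonneg
  have hder : deriv (fun a => ∫ x in (0 : ℝ)..a, G x) = G := by
    ext a
    exact (hG.continuous.integral_hasStrictDerivAt 0 a).hasDerivAt.deriv
  have hsm : ContDiff ℝ ∞ (fun a => ∫ x in (0 : ℝ)..a, G x) := by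
    rw [contDiff_infty_iff_deriv]
    exact ⟨fun a => (hG.continuous.integral_hasStrictDerivAt 0 a).hasDerivAt.differentiableAt,
      by rwa [hder]⟩
  refine ⟨hsm.contDiffAt.of_le (by exact_mod_cast le_top), fun k hk => ?_⟩
  rw [norm_iteratedFDeriv_eq_norm_iteratedDeriv]
  rcases Nat.eq_zero_or_pos k with rfl | hk0
  · rw [iteratedDeriv_zero]
    have hsub : ∀ x, x ∉ Icc (-3 : ℝ) 3 → G x = 0 := fun x hx => hsupp x (by
      by_contra hc
      exact hx (abs_le.1 (not_le.1 hc).le))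
    have hint : MeasureTheory.Integrable (fun x => ‖G x‖) := by
      refine (hG.continuous.integrable_of_hasCompactSupport
        (HasCompactSupport.intro isCompact_Icc hsub)).norm
    calc ‖∫ x in (0 : ℝ)..a, G x‖ ≤ ∫ x in uIoc 0 a, ‖G x‖ :=
          intervalIntegral.norm_integral_le_integral_norm_uIoc
      _ ≤ ∫ x, ‖G x‖ := MeasureTheory.setIntegral_le_integral hint
          (Eventually.of_forall fun x => norm_nonneg _)
      _ = ∫ x in Icc (-3 : ℝ) 3, ‖G x‖ :=
          (MeasureTheory.setIntegral_eq_integral_of_forall_compl_eq_zero fun x hx => by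
            rw [hsub x hx, norm_zero]).symm
      _ ≤ ‖∫ x in Icc (-3 : ℝ) 3, ‖G x‖‖ := le_abs_self _
      _ ≤ C * MeasureTheory.volume.real (Icc (-3 : ℝ) 3) :=
          MeasureTheory.norm_setIntegral_le_of_norm_le_const (by simp) fun x _ => by
            rw [norm_norm]; exact (h x).norm_le
      _ = 6 * C := by rw [Real.volume_real_Icc]; norm_num; ring
  · obtain ⟨j, rfl⟩ : ∃ j, k = j + 1 := ⟨k - 1, by omega⟩
    rw [iteratedDeriv_succ', hder, ← norm_iteratedFDeriv_eq_norm_iteratedDeriv]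
    refine ((h a).2 j (by omega)).trans (by linarith)

/-- The time to the next multiple of the period, after `m` steps. -/
noncomputable def slack (e : ℝ × ℝ → ℝ × ℝ) (m : ℕ) (p : ℝ × ℝ) : ℝ :=
  ((shiftMap e)^[m] p).1 - ((shiftMap e)^[m] p).2

theorem exists_curve_family (K : ℕ) (hK : 1 ≤ K) {e : ℝ × ℝ → ℝ × ℝ} (he : ContDiff ℝ ∞ e) :
    ∃ C, 0 < C ∧ ∀ δ, 0 < δ → ∃ G W : ℤ → ℝ → ℝ, (∀ n, ContDiff ℝ ∞ (G n)) ∧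
      (∀ n a, HasDerivAt (W n) (G n a) a) ∧ (∀ n, W n 0 = 0) ∧
      (∀ n a, JetBound K (G n) a (C / n ^ 2)) ∧ (∀ n a, JetBound K (W n) a (C / n ^ 2)) ∧
      (∀ n a, JetBound K (G n) a δ) ∧ (∀ n a, JetBound K (W n) a δ) ∧
      ∀ᶠ m : ℕ in atTop, ∀ a I : ℝ, |a| < 2 → |I - m| < 8 →
        (0 ≤ slack e m (a, I) ↔ I ≤ a + m - G m a) := by
  obtain ⟨C₁, κ₀, hC₁, hκ₀, hroot⟩ := exists_root_curve K hK
  obtain ⟨C₂, hC₂, hit⟩ := exists_iterate_shiftMap_bound K he 8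
  -- The curves are needed for |a| < 2 only and are cut off before |a| = 3, which makes them global
  -- functions with bounded primitives.
  obtain ⟨κ, hκ, hκc, hκs, hκ1, hκI⟩ := exists_contDiff_cutoff (E := ℝ)
    (isCompact_Icc (a := (-2 : ℝ)) (b := 2)) (isOpen_Ioo (a := (-3 : ℝ)) (b := 3))
    (fun x hx => ⟨by linarith [hx.1], by linarith [hx.2]⟩)
  have hκ0 : ∀ a, a ∉ Ioo (-3 : ℝ) 3 → κ =ᶠ[𝓝 a] 0 := fun a ha =>
    notMem_tsupport_iff_eventuallyEq.1 fun h => ha (hκs h)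
  obtain ⟨C₃, hC₃, hκb⟩ := exists_jetBound_of_isCompact K isOpen_univ
    (isCompact_Icc (a := (-3 : ℝ)) (b := 3)) (subset_univ _) hκ.contDiffOn
  let C := 2 ^ K * (C₃ * (C₁ * (2 * C₂)))
  have hC : 0 < C := by positivity
  have hG₀ : ∀ᶠ m : ℕ in atTop, ∃ G : ℝ → ℝ, ContDiff ℝ ∞ G ∧ (∀ a, 3 ≤ |a| → G a = 0) ∧
      (∀ a, JetBound K G a (C / m ^ 2)) ∧ ∀ a I : ℝ, |a| < 2 → |I - m| < 8 →
        (0 ≤ slack e m (a, I) ↔ I ≤ a + m - G a) := by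
    have hsmall : ∀ᶠ m : ℕ in atTop, 2 * C₂ / (m : ℝ) ^ 2 ≤ κ₀ := by
      have : Tendsto (fun m : ℕ => 2 * C₂ / (m : ℝ) ^ 2) atTop (𝓝 0) :=
        tendsto_const_nhds.div_atTop
          ((tendsto_pow_atTop two_ne_zero).comp tendsto_natCast_atTop_atTop)
      exact this.eventually (ge_mem_nhds hκ₀)
    filter_upwards [hit, hsmall, eventually_ge_atTop 1] with m hm hms hm1
    have hm0 : (0 : ℝ) < m := by exact_mod_cast hm1
    obtain ⟨g, hg1, hg2⟩ := hroot m (2 * C₂ / m ^ 2)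
      (fun p => slack e m p - (p.1 + m - p.2)) hms (by
        intro p hp1 hp2
        obtain ⟨h1, h2⟩ := hm m (by omega) p (by linarith) hp2
        have h3 : ContDiffAt ℝ ∞ (slack e m) p := h1.fst.sub h1.snd
        refine ⟨h3.sub (by fun_prop), ?_⟩
        have h4 := (h2.clm_comp (ContinuousLinearMap.fst ℝ ℝ ℝ)).sub
          (h2.clm_comp (ContinuousLinearMap.snd ℝ ℝ ℝ))
        refine (h4.mono ?_).congr (Eventually.of_forall fun q => ?_)
        · have hf := ContinuousLinearMap.norm_fst_le ℝ ℝ ℝ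
          have hs := ContinuousLinearMap.norm_snd_le ℝ ℝ ℝ
          have h5 : C₂ * m / (m : ℝ) ^ 3 = C₂ / m ^ 2 := by field_simp
          have h6 : 0 ≤ C₂ / (m : ℝ) ^ 2 := by positivity
          rw [h5]
          have e1 : 2 * C₂ / (m : ℝ) ^ 2 = 2 * (C₂ / m ^ 2) := by ring
          rw [e1]
          nlinarith
        · simp only [slack, ContinuousLinearMap.coe_fst', ContinuousLinearMap.coe_snd',
            Prod.fst_sub, Prod.snd_sub]
          ring)
    have hzero : ∀ a : ℝ, a ∉ Ioo (-3 : ℝ) 3 → (fun a => κ a * g a) =ᶠ[𝓝 a] fun _ => 0 :=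
      fun a ha => by
        filter_upwards [hκ0 a ha] with b hb
        simp [hb]
    have hIoo : ∀ a : ℝ, a ∈ Ioo (-3 : ℝ) 3 ↔ |a| < 3 := fun a => abs_lt.symm
    refine ⟨fun a => κ a * g a, contDiff_iff_contDiffAt.2 fun a => ?_, fun a ha => ?_,
      fun a => ?_, fun a I ha hI => ?_⟩
    · by_cases h : a ∈ Ioo (-3 : ℝ) 3
      · exact hκ.contDiffAt.mul (hg1 a ((hIoo a).1 h)).1
      · exact contDiffAt_const.congr_of_eventuallyEq (hzero a h)
    · exact (hzero a (by rw [hIoo]; exact not_lt.2 ha)).eq_of_nhds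
    · by_cases h : a ∈ Ioo (-3 : ℝ) 3
      · refine ((hκb a (Ioo_subset_Icc_self h)).mul (hg1 a ((hIoo a).1 h)).2).mono
          (le_of_eq ?_)
        simp only [C]; ring
      · exact (JetBound.zero (by positivity)).congr (hzero a h)
    · have h1 : κ a = 1 := by
        have := hκ1.self_of_nhdsSet a (by rw [abs_lt] at ha; exact ⟨ha.1.le, ha.2.le⟩)
        exact this
      simp only [h1, one_mul]
      rw [← hg2 a I (by linarith) hI]
      simp only [add_sub_cancel]
  refine ⟨6 * C, by positivity, fun δ hδ => ?_⟩
  have hsmall : ∀ᶠ m : ℕ in atTop, 6 * C / (m : ℝ) ^ 2 ≤ δ := by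
    have : Tendsto (fun m : ℕ => 6 * C / (m : ℝ) ^ 2) atTop (𝓝 0) :=
      tendsto_const_nhds.div_atTop ((tendsto_pow_atTop two_ne_zero).comp tendsto_natCast_atTop_atTop)
    exact this.eventually (ge_mem_nhds hδ)
  obtain ⟨M, hM⟩ := eventually_atTop.1 (hG₀.and (hsmall.and (eventually_ge_atTop 1)))
  have hex : ∀ n : ℤ, ∃ G : ℝ → ℝ, ContDiff ℝ ∞ G ∧ (∀ a, 3 ≤ |a| → G a = 0) ∧
      (∀ a, JetBound K G a (C / n ^ 2)) ∧ (∀ a, JetBound K G a (δ / 6)) ∧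
      (M ≤ n → ∀ a I : ℝ, |a| < 2 → |I - n| < 8 →
        (0 ≤ slack e n.toNat (a, I) ↔ I ≤ a + n - G a)) := by
    intro n
    by_cases hn : M ≤ n
    · obtain ⟨m, rfl⟩ : ∃ m : ℕ, n = m := ⟨n.toNat, by omega⟩
      obtain ⟨⟨G, h1, h2, h3, h4⟩, h5, -⟩ := hM m (by exact_mod_cast hn)
      refine ⟨G, h1, h2, by exact_mod_cast h3, fun a => (h3 a).mono ?_,
        fun _ => by exact_mod_cast h4⟩
      have : 6 * C / (m : ℝ) ^ 2 = 6 * (C / m ^ 2) := by ring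
      linarith
    · exact ⟨fun _ => 0, contDiff_const, fun _ _ => rfl, fun a => JetBound.zero (by positivity),
        fun a => JetBound.zero (by positivity), fun h => absurd h hn⟩
  choose G h1 h2 h3 h4 h5 using hex
  have e6 : ∀ n : ℤ, 6 * C / (n : ℝ) ^ 2 = 6 * (C / n ^ 2) := fun n => by ring
  have hpos : ∀ n : ℤ, 0 ≤ C / (n : ℝ) ^ 2 := fun n => by positivity
  refine ⟨G, fun n a => ∫ x in (0 : ℝ)..a, G n x, h1, fun n a =>
    ((h1 n).continuous.integral_hasStrictDerivAt 0 a).hasDerivAt, fun n => by simp,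
    fun n a => (h3 n a).mono (by rw [e6]; linarith [hpos n]),
    fun n a => ((JetBound.primitive (h1 n) (h2 n) (h3 n) a).mono (by rw [e6])),
    fun n a => (h4 n a).mono (by linarith),
    fun n a => ((JetBound.primitive (h1 n) (h2 n) (h4 n) a).mono (by linarith)), ?_⟩
  filter_upwards [eventually_ge_atTop M] with m hm
  have := h5 m (by exact_mod_cast hm)
  simpa using this

/-! ### Straightening the curves -/

/-- A smooth map close to the identity is a diffeomorphism. -/
theorem exists_homeomorph_of_jetBound (K : ℕ) (hK : 1 ≤ K) {ε : ℝ × ℝ → ℝ × ℝ} {κ : ℝ}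
    (hε : ContDiff ℝ ∞ ε) (h : ∀ x, JetBound K ε x κ) (hκ : K.factorial * κ ≤ 1 / 2) :
    ∃ H : (ℝ × ℝ) ≃ₜ (ℝ × ℝ), (∀ x, H x = x + ε x) ∧ ContDiff ℝ ∞ H ∧ ContDiff ℝ ∞ H.symm ∧
      (∀ y, H.symm y = y - ε (H.symm y)) ∧ ∀ y, DerivBound K H.symm y (2 ^ K) := by
  have hκ0 := (h 0).nonneg
  have hfac1 : (1 : ℝ) ≤ K.factorial := by exact_mod_cast K.factorial_pos
  have hκ2 : κ ≤ 1 / 2 := (le_mul_of_one_le_left hκ0 hfac1).trans hκ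
  have hlip : LipschitzWith (1 / 2) ε := by
    refine lipschitzWith_of_nnnorm_fderiv_le (𝕜 := ℝ) (hε.differentiable (by simp)) fun x => ?_
    rw [← NNReal.coe_le_coe]
    simpa using ((h x).derivBound.norm_fderiv_le hK).trans hκ2
  have happ : ApproximatesLinearOn (fun x => x + ε x)
      ((ContinuousLinearEquiv.refl ℝ (ℝ × ℝ) : (ℝ × ℝ) ≃L[ℝ] (ℝ × ℝ)) : (ℝ × ℝ) →L[ℝ] (ℝ × ℝ))
      univ (1 / 2) := by
    intro x _ y _
    have := hlip.norm_sub_le x y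
    have e : x + ε x - (y + ε y) - (x - y) = ε x - ε y := by abel
    simpa [e] using this
  let H := happ.toHomeomorph _ (Or.inr (by
    have : ‖((ContinuousLinearEquiv.refl ℝ (ℝ × ℝ)).symm : (ℝ × ℝ) →L[ℝ] (ℝ × ℝ))‖₊ = 1 := by
      have : ((ContinuousLinearEquiv.refl ℝ (ℝ × ℝ)).symm : (ℝ × ℝ) →L[ℝ] (ℝ × ℝ)) =
        ContinuousLinearMap.id ℝ (ℝ × ℝ) := rfl
      rw [this, ContinuousLinearMap.nnnorm_id]
    rw [this, inv_one]
    exact NNReal.half_lt_self one_ne_zero))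
  have hH : ∀ x, H x = x + ε x := fun x => rfl
  have hHs : ContDiff ℝ ∞ H := contDiff_id.add hε
  have hinv : ∀ y, H.symm y = y - ε (H.symm y) := fun y => by
    have := hH (H.symm y)
    rw [H.apply_symm_apply] at this
    rw [eq_sub_iff_add_eq]; exact this.symm
  have hder : ∀ x, ∃ L : (ℝ × ℝ) ≃L[ℝ] (ℝ × ℝ), HasFDerivAt H (L : (ℝ × ℝ) →L[ℝ] (ℝ × ℝ)) x := by
    intro x
    have h1 : HasFDerivAt H (fderiv ℝ H x) x := (hHs.differentiable (by simp) x).hasFDerivAt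
    have h2 : Function.Injective (fderiv ℝ H x) := by
      have h3 : HasFDerivAt H (ContinuousLinearMap.id ℝ _ + fderiv ℝ ε x) x :=
        (hasFDerivAt_id x).add (hε.differentiable (by simp) x).hasFDerivAt
      rw [h3.fderiv, injective_iff_map_eq_zero]
      intro v hv
      have h4 : v = - fderiv ℝ ε x v := by
        rw [eq_neg_iff_add_eq_zero]; simpa using hv
      have h5 : ‖v‖ ≤ κ * ‖v‖ := by
        conv_lhs => rw [h4, norm_neg]
        exact ContinuousLinearMap.le_of_opNorm_le _ ((h x).derivBound.norm_fderiv_le hK) _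
      have h6 := norm_nonneg v
      exact norm_eq_zero.1 (by nlinarith)
    have hdet : (fderiv ℝ H x).det ≠ 0 := by
      have := (LinearEquiv.ofInjectiveEndo (fderiv ℝ H x : (ℝ × ℝ) →ₗ[ℝ] (ℝ × ℝ)) h2).isUnit_det'
      exact this.ne_zero
    exact ⟨_, by
      rw [ContinuousLinearMap.coe_toContinuousLinearEquivOfDetNeZero _ hdet]
      exact h1⟩
  choose L hL using hder
  have hsymm : ContDiff ℝ ∞ H.symm := H.contDiff_symm (f₀' := L) hL hHs
  refine ⟨H, hH, hHs, hsymm, hinv, fun y => ?_⟩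
  exact DerivBound.of_eq_add_comp (A := fun y => ContinuousLinearMap.id ℝ (ℝ × ℝ) y + 0)
    (ε := fun x => - ε x) (hsymm.contDiffAt.of_le (by exact_mod_cast le_top))
    (DerivBound.affine _ _ ContinuousLinearMap.norm_id_le) (h _).neg
    (Eventually.of_forall fun z => by
      conv_lhs => rw [hinv z]
      simp [sub_eq_add_neg]) hκ

/-- The function `χ(a - K + n) G_n(a)`, where `-n` is the integer closest to `a - K`. -/
noncomputable def periodize (χ : ℝ → ℝ) (G : ℤ → ℝ → ℝ) (p : ℝ × ℝ) : ℝ :=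
  χ (p.1 - p.2 - round (p.1 - p.2)) * G (-round (p.1 - p.2)) p.1

section Periodize

variable {χ : ℝ → ℝ} {G : ℤ → ℝ → ℝ}

/-- If -n is not the nearest integer, then both p.1 - p.2 + n and the distance to the nearest
integer are at least 1/3 in size, and both cut-offs vanish. So near every point a single n serves,
which gives smoothness in spite of `round`. -/
theorem periodize_eq (hχ : ∀ x, 1 / 3 ≤ |x| → χ x = 0) {p : ℝ × ℝ} {n : ℤ}
    (h : |p.1 - p.2 + n| < 2 / 3) : periodize χ G p = χ (p.1 - p.2 + n) * G n p.1 := by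
  unfold periodize
  set x := p.1 - p.2
  have h1 := abs_sub_round x
  by_cases hn : round x = -n
  · rw [hn]; push_cast; simp
  · have h2 : (1 : ℝ) ≤ |(round x : ℝ) + n| := by
      have : (1 : ℤ) ≤ |round x + n| := Int.one_le_abs (by omega)
      exact_mod_cast this
    have h3 : |(round x : ℝ) + n| ≤ |x - round x| + |x + n| := by
      have := abs_sub (x + n) (x - round x)
      rw [show x + n - (x - round x) = (round x : ℝ) + n by ring] at this
      linarith
    rw [hχ _ (by linarith), hχ _ (by linarith), zero_mul, zero_mul]

theorem periodize_eventuallyEq (hχ : ∀ x, 1 / 3 ≤ |x| → χ x = 0) (p : ℝ × ℝ) :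
    periodize χ G =ᶠ[𝓝 p] fun q =>
      χ (q.1 - q.2 + (-round (p.1 - p.2) : ℤ)) * G (-round (p.1 - p.2)) q.1 := by
  have h1 := abs_sub_round (p.1 - p.2)
  have : ∀ᶠ q : ℝ × ℝ in 𝓝 p, |q.1 - q.2 + (-round (p.1 - p.2) : ℤ)| < 2 / 3 := by
    refine (isOpen_lt (by fun_prop) continuous_const).mem_nhds ?_
    change |p.1 - p.2 + (-round (p.1 - p.2) : ℤ)| < 2 / 3
    push_cast
    rw [← sub_eq_add_neg]
    linarith
  filter_upwards [this] with q hq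
  exact periodize_eq hχ hq

theorem contDiff_periodize (hχ : ∀ x, 1 / 3 ≤ |x| → χ x = 0) (hχs : ContDiff ℝ ∞ χ)
    (hG : ∀ n, ContDiff ℝ ∞ (G n)) : ContDiff ℝ ∞ (periodize χ G) := by
  refine contDiff_iff_contDiffAt.2 fun p => ContDiffAt.congr_of_eventuallyEq ?_
    (periodize_eventuallyEq hχ p)
  exact ((hχs.comp (by fun_prop)).mul ((hG _).comp contDiff_fst)).contDiffAt

theorem JetBound.periodize {K : ℕ} {A B : ℝ} (hχ : ∀ x, 1 / 3 ≤ |x| → χ x = 0) (p : ℝ × ℝ)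
    (hχb : ∀ x, JetBound K χ x A) (hG : ∀ a, JetBound K (G (-round (p.1 - p.2))) a B) :
    JetBound K (periodize χ G) p (2 ^ K * ((K.factorial * A * 2 ^ K) * (K.factorial * B))) := by
  set n := -round (p.1 - p.2) with hn
  have hL : ‖ContinuousLinearMap.fst ℝ ℝ ℝ - ContinuousLinearMap.snd ℝ ℝ ℝ‖ ≤ 2 := by
    refine (norm_sub_le _ _).trans ?_
    linarith [ContinuousLinearMap.norm_fst_le ℝ ℝ ℝ, ContinuousLinearMap.norm_snd_le ℝ ℝ ℝ]
  have h1 : JetBound K (fun q : ℝ × ℝ => χ (q.1 - q.2 + n)) p (K.factorial * A * 2 ^ K) :=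
    JetBound.comp (g := χ) (f := fun q : ℝ × ℝ =>
      (ContinuousLinearMap.fst ℝ ℝ ℝ - ContinuousLinearMap.snd ℝ ℝ ℝ) q + (n : ℝ)) (hχb _)
      (DerivBound.affine _ _ hL) one_le_two
  have h2 : JetBound K (fun q : ℝ × ℝ => G n q.1) p (K.factorial * B * 1 ^ K) :=
    JetBound.comp (g := G n) (f := fun q : ℝ × ℝ => ContinuousLinearMap.fst ℝ ℝ ℝ q) (hG _)
      (by
        simpa using DerivBound.affine (K := K) (x := p) (ContinuousLinearMap.fst ℝ ℝ ℝ) (0 : ℝ)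
          (ContinuousLinearMap.norm_fst_le ℝ ℝ ℝ)) le_rfl
  refine ((h1.mul h2).mono (by simp)).congr (periodize_eventuallyEq hχ p)

end Periodize

theorem exists_bump : ∃ χ : ℝ → ℝ, ContDiff ℝ ∞ χ ∧ (∀ x, 1 / 3 ≤ |x| → χ =ᶠ[𝓝 x] 0) ∧
    ∀ x, |x| ≤ 1 / 12 → χ x = 1 := by
  obtain ⟨χ, h1, -, h2, h3, -⟩ := exists_contDiff_cutoff (E := ℝ)
    (isCompact_Icc (a := (-1 / 12 : ℝ)) (b := 1 / 12)) (isOpen_Ioo (a := (-1 / 3 : ℝ)) (b := 1 / 3))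
    (fun x hx => ⟨by linarith [hx.1], by linarith [hx.2]⟩)
  refine ⟨χ, h1, fun x hx => notMem_tsupport_iff_eventuallyEq.1 fun h => ?_, fun x hx => ?_⟩
  · have := h2 h
    rw [mem_Ioo, neg_div, ← abs_lt] at this
    linarith
  · exact h3.self_of_nhdsSet x (by rw [mem_Icc, neg_div, ← abs_le]; exact hx)

theorem exists_jetBound_of_eventuallyEq_zero (K : ℕ) {χ : ℝ → ℝ} (h : ContDiff ℝ ∞ χ)
    (h0 : ∀ x, 1 / 3 ≤ |x| → χ =ᶠ[𝓝 x] 0) : ∃ A, 0 < A ∧ ∀ x, JetBound K χ x A := by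
  obtain ⟨A, hA, hb⟩ := exists_jetBound_of_isCompact K isOpen_univ
    (isCompact_Icc (a := (-1 : ℝ)) (b := 1)) (subset_univ _) h.contDiffOn
  refine ⟨A, hA, fun x => ?_⟩
  rcases le_total |x| 1 with hx | hx
  · exact hb x (abs_le.1 hx)
  · exact (JetBound.zero hA.le).congr (h0 x (by linarith))

theorem hasFDerivAt_periodize {χ : ℝ → ℝ} {G : ℤ → ℝ → ℝ} (hχ : ∀ x, 1 / 3 ≤ |x| → χ x = 0)
    (hχs : ContDiff ℝ ∞ χ) (hG : ∀ n, ContDiff ℝ ∞ (G n)) (p : ℝ × ℝ) {n : ℤ}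
    (hn : n = -round (p.1 - p.2)) :
    HasFDerivAt (periodize χ G) (χ (p.1 - p.2 + n) • (deriv (G n) p.1 •
      ContinuousLinearMap.fst ℝ ℝ ℝ) + G n p.1 • (deriv χ (p.1 - p.2 + n) •
        (ContinuousLinearMap.fst ℝ ℝ ℝ - ContinuousLinearMap.snd ℝ ℝ ℝ))) p := by
  subst hn
  refine HasFDerivAt.congr_of_eventuallyEq ?_ (periodize_eventuallyEq hχ p)
  set n := -round (p.1 - p.2)
  have h1 : HasFDerivAt (fun q : ℝ × ℝ => q.1 - q.2 + (n : ℝ))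
      (ContinuousLinearMap.fst ℝ ℝ ℝ - ContinuousLinearMap.snd ℝ ℝ ℝ) p :=
    (hasFDerivAt_fst.sub hasFDerivAt_snd).add_const _
  have h2 : HasDerivAt χ (deriv χ (p.1 - p.2 + n)) (p.1 - p.2 + n) :=
    (hχs.differentiable (by simp) _).hasDerivAt
  have h3 : HasDerivAt (G n) (deriv (G n) p.1) p.1 :=
    ((hG n).differentiable (by simp) _).hasDerivAt
  exact (h2.comp_hasFDerivAt p h1).mul (h3.comp_hasFDerivAt p hasFDerivAt_fst)

/-- Near-identity symplectic coordinates in which the curves `slack e m = 0` become lines. -/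
theorem exists_straightening (K : ℕ) (hK : 1 ≤ K) {e : ℝ × ℝ → ℝ × ℝ} (he : ContDiff ℝ ∞ e) :
    ∃ R : (ℝ × ℝ) ≃ₜ (ℝ × ℝ), ContDiff ℝ ∞ R ∧ ContDiff ℝ ∞ R.symm ∧
      (∀ p, ‖R p - p‖ ≤ 1) ∧ (∀ p, (fderiv ℝ R p).det = 1) ∧
      (∀ p, 0 ≤ (R p).1 ↔ 0 ≤ p.1) ∧
      (∃ C, 0 < C ∧ ∀ᶠ m : ℕ in atTop, ∀ p : ℝ × ℝ, |p.1| < 8 → |p.2 - m| < 8 →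
        JetBound K (fun q => R q - q) p (C / m ^ 2) ∧
        JetBound K (fun q => R.symm q - q) p (C / m ^ 2)) ∧
      ∀ᶠ m : ℕ in atTop, ∀ p : ℝ × ℝ, |p.1| < 2 → |p.2 - m| < 7 →
        (0 ≤ slack e m p ↔ -m ≤ (R p).1 - (R p).2) := by
  obtain ⟨C, hC, hGW⟩ := exists_curve_family K hK he
  obtain ⟨χ, hχs, hχ0, hχ1⟩ := exists_bump
  have hχ's : ContDiff ℝ ∞ (deriv χ) := (contDiff_infty_iff_deriv.1 hχs).2
  have hχ'0 : ∀ x, 1 / 3 ≤ |x| → deriv χ =ᶠ[𝓝 x] 0 := fun x hx => by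
    have := (hχ0 x hx).deriv
    filter_upwards [this] with y hy
    rw [hy]
    exact deriv_const y 0
  have z0 : ∀ x, 1 / 3 ≤ |x| → χ x = 0 := fun x hx => (hχ0 x hx).eq_of_nhds
  have z1 : ∀ x, 1 / 3 ≤ |x| → deriv χ x = 0 := fun x hx => (hχ'0 x hx).eq_of_nhds
  obtain ⟨A₀, hA₀, hb₀⟩ := exists_jetBound_of_eventuallyEq_zero K hχs hχ0
  obtain ⟨A₁, hA₁, hb₁⟩ := exists_jetBound_of_eventuallyEq_zero K hχ's hχ'0
  set A := max A₀ A₁ with hA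
  have hA0 : 0 < A := lt_max_of_lt_left hA₀
  have hb₀' : ∀ x, JetBound K χ x A := fun x => (hb₀ x).mono (le_max_left _ _)
  have hb₁' : ∀ x, JetBound K (deriv χ) x A := fun x => (hb₁ x).mono (le_max_right _ _)
  have hfac1 : (1 : ℝ) ≤ K.factorial := by exact_mod_cast K.factorial_pos
  have hfac : (0 : ℝ) < K.factorial := by linarith
  set P : ℝ := 2 ^ K * ((K.factorial * A * 2 ^ K) * K.factorial) with hP
  have hPpos : 0 < P := by positivity
  have hAP : A ≤ P := by
    have h2 : (1 : ℝ) ≤ 2 ^ K := one_le_pow₀ (by norm_num)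
    have h3 : (1 : ℝ) ≤ 2 ^ K * (K.factorial * 2 ^ K * K.factorial) :=
      one_le_mul_of_one_le_of_one_le h2 (one_le_mul_of_one_le_of_one_le
        (one_le_mul_of_one_le_of_one_le hfac1 h2) hfac1)
    calc A = A * 1 := (mul_one A).symm
      _ ≤ A * (2 ^ K * (K.factorial * 2 ^ K * K.factorial)) := by gcongr
      _ = P := by rw [hP]; ring
  -- So small that both perturbations have jets of size at most 1/100 after multiplication by K!:
  -- then `H₁` and `H₂` are global diffeomorphisms with controlled inverses.
  set δ : ℝ := min ((100 * K.factorial * P)⁻¹) (1 / 100) with hδ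
  have hδ0 : 0 < δ := by positivity
  have hPδ : K.factorial * (P * δ) ≤ 1 / 100 := by
    calc K.factorial * (P * δ) ≤ K.factorial * (P * (100 * K.factorial * P)⁻¹) := by
          gcongr; exact min_le_left _ _
      _ = 1 / 100 := by field_simp
  have hPδ' : P * δ ≤ 1 / 100 :=
    (le_mul_of_one_le_left (by positivity) hfac1).trans hPδ
  obtain ⟨G, W, hG, hWG, hW0, hGm, hWm, hGδ, hWδ, hslack⟩ := hGW δ hδ0
  have hWd : ∀ n, deriv (W n) = G n := fun n => funext fun a => (hWG n a).deriv
  have hW : ∀ n, ContDiff ℝ ∞ (W n) := fun n => by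
    rw [contDiff_infty_iff_deriv, hWd n]
    exact ⟨fun a => (hWG n a).differentiableAt, hG n⟩
  have pb : ∀ (ψ : ℝ → ℝ) (H : ℤ → ℝ → ℝ) (p : ℝ × ℝ) (B : ℝ), (∀ x, 1 / 3 ≤ |x| → ψ x = 0) →
      (∀ x, JetBound K ψ x A) → (∀ a, JetBound K (H (-round (p.1 - p.2))) a B) →
      JetBound K (periodize ψ H) p (P * B) := fun ψ H p B h1 h2 h3 =>
    (JetBound.periodize h1 p h2 h3).mono (le_of_eq (by rw [hP]; ring))
  -- The coordinate change is given through an intermediate action k: `H₁` sends (a, k) to the old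
  -- coordinates, `H₂` to the new ones. Near the n-th curve χ = 1 and χ' = 0, so `H₁` lowers the
  -- action by G_n(a) and `H₂` is the identity: R raises the action by G_n(a) and maps the curve to
  -- a line. Where χ varies, the terms with the primitive W_n restore the conservation of area.
  set ε₁ : ℝ × ℝ → ℝ × ℝ := fun p => (0, -periodize χ G p) with hε₁
  set ε₂ : ℝ × ℝ → ℝ × ℝ := fun p => (periodize (deriv χ) W p, periodize (deriv χ) W p) with hε₂
  have j₁ : ∀ p B, (∀ a, JetBound K (G (-round (p.1 - p.2))) a B) → JetBound K ε₁ p (P * B) :=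
    fun p B h => by
      have := pb χ G p B z0 hb₀' h
      exact (JetBound.zero this.nonneg).prodMk this.neg
  have j₂ : ∀ p B, (∀ a, JetBound K (W (-round (p.1 - p.2))) a B) → JetBound K ε₂ p (P * B) :=
    fun p B h => by
      have := pb _ W p B z1 hb₁' h
      exact this.prodMk this
  obtain ⟨H₁, h₁, s₁, t₁, i₁, d₁⟩ := exists_homeomorph_of_jetBound K hK
    (contDiff_const.prodMk (contDiff_periodize z0 hχs hG).neg) (fun p => j₁ p δ (hGδ _))
    (by linarith)
  obtain ⟨H₂, h₂, s₂, t₂, i₂, d₂⟩ := exists_homeomorph_of_jetBound K hK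
    ((contDiff_periodize z1 hχ's hW).prodMk (contDiff_periodize z1 hχ's hW))
    (fun p => j₂ p δ (hWδ _)) (by linarith)
  change ∀ x, H₁ x = x + ε₁ x at h₁
  change ∀ x, H₂ x = x + ε₂ x at h₂
  change ∀ y, H₁.symm y = y - ε₁ (H₁.symm y) at i₁
  change ∀ y, H₂.symm y = y - ε₂ (H₂.symm y) at i₂
  have n₁ : ∀ p, ‖ε₁ p‖ ≤ 1 / 100 := fun p => (j₁ p δ (hGδ _)).norm_le.trans hPδ'
  have n₂ : ∀ p, ‖ε₂ p‖ ≤ 1 / 100 := fun p => (j₂ p δ (hWδ _)).norm_le.trans hPδ'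
  have fst₁ : ∀ p, (H₁.symm p).1 = p.1 := fun p => by
    have := congrArg Prod.fst (i₁ p)
    simpa [hε₁] using this
  have snd₁ : ∀ p, (H₁.symm p).2 - periodize χ G (H₁.symm p) = p.2 := fun p => by
    have := congrArg Prod.snd (i₁ p)
    simp only [hε₁, Prod.snd_sub] at this
    linarith
  have eR : ∀ p, H₂ (H₁.symm p) - p = ε₂ (H₁.symm p) - ε₁ (H₁.symm p) := fun p => by
    rw [h₂]
    nth_rewrite 1 [i₁ p]
    abel
  have eR' : ∀ p, H₁ (H₂.symm p) - p = ε₁ (H₂.symm p) - ε₂ (H₂.symm p) := fun p => by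
    rw [h₁]
    nth_rewrite 1 [i₂ p]
    abel
  refine ⟨H₁.symm.trans H₂, s₂.comp t₁, s₁.comp t₂, fun p => ?_, fun p => ?_, fun p => ?_, ?_, ?_⟩
  · change ‖H₂ (H₁.symm p) - p‖ ≤ 1
    rw [eR]
    refine (norm_sub_le _ _).trans ?_
    linarith [n₁ (H₁.symm p), n₂ (H₁.symm p)]
  · obtain ⟨q, rfl⟩ : ∃ q, H₁ q = p := ⟨H₁.symm p, H₁.apply_symm_apply p⟩
    set n := -round (q.1 - q.2) with hn
    have g1 := hasFDerivAt_periodize z0 hχs hG q hn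
    have g2 := hasFDerivAt_periodize z1 hχ's hW q hn
    rw [hWd] at g2
    have g3 : HasFDerivAt H₁ _ q := ((hasFDerivAt_id q).add
      ((hasFDerivAt_const (0 : ℝ) q).prodMk g1.neg)).congr_of_eventuallyEq
        (Eventually.of_forall h₁)
    have g4 : HasFDerivAt H₂ _ q := ((hasFDerivAt_id q).add
      (g2.prodMk g2)).congr_of_eventuallyEq (Eventually.of_forall h₂)
    -- `H₁` and `H₂` have the same Jacobian 1 + χ'G_n: in that of `H₂` the terms with χ'' cancel
    -- since both components are shifted equally, and W_n' = G_n leaves χ'G_n. Hence `H₂ ∘ H₁⁻¹` has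
    -- Jacobian 1.
    have k1 : (fderiv ℝ H₁ q).det = 1 + deriv χ (q.1 - q.2 + n) * G n q.1 := by
      rw [g3.fderiv, det_prod_real]
      simp
      ring
    have k2 : (fderiv ℝ H₂ q).det = 1 + deriv χ (q.1 - q.2 + n) * G n q.1 := by
      rw [g4.fderiv, det_prod_real]
      simp
      ring
    have hD1 : HasFDerivAt H₁ (fderiv ℝ H₁ q) q :=
      (s₁.differentiable (by simp) q).hasFDerivAt
    have k3 : (fderiv ℝ H₁.symm (H₁ q)).det * (fderiv ℝ H₁ q).det = 1 := by
      have hS : HasFDerivAt H₁.symm (fderiv ℝ H₁.symm (H₁ q)) (H₁ q) :=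
        (t₁.differentiable (by simp) _).hasFDerivAt
      have hc := hS.comp q hD1
      have hc' : HasFDerivAt (H₁.symm ∘ H₁) (ContinuousLinearMap.id ℝ (ℝ × ℝ)) q := by
        have : (H₁.symm ∘ H₁) = id := funext fun x => H₁.symm_apply_apply x
        rw [this]; exact hasFDerivAt_id q
      have hu := hc.unique hc'
      have := congrArg ContinuousLinearMap.det hu
      simpa [ContinuousLinearMap.det, LinearMap.det_comp] using this
    have k4 : (fderiv ℝ (H₁.symm.trans H₂) (H₁ q)).det * (fderiv ℝ H₁ q).det =
        (fderiv ℝ H₂ q).det := by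
      have hS : HasFDerivAt (H₁.symm.trans H₂) (fderiv ℝ (H₁.symm.trans H₂) (H₁ q)) (H₁ q) :=
        ((s₂.comp t₁).differentiable (by simp) _).hasFDerivAt
      have hc := hS.comp q hD1
      have : ((H₁.symm.trans H₂ : (ℝ × ℝ) ≃ₜ (ℝ × ℝ)) ∘ H₁ : ℝ × ℝ → ℝ × ℝ) = H₂ :=
        funext fun x => congrArg H₂ (H₁.symm_apply_apply x)
      rw [this] at hc
      rw [hc.fderiv]
      simp [ContinuousLinearMap.det, LinearMap.det_comp]
    rw [k1] at k3 k4
    rw [k2] at k4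
    have hne : 1 + deriv χ (q.1 - q.2 + n) * G n q.1 ≠ 0 := right_ne_zero_of_mul (k3 ▸ one_ne_zero)
    exact mul_right_cancel₀ hne (k4.trans (one_mul _).symm)
  · change 0 ≤ (H₂ (H₁.symm p)).1 ↔ _
    rw [h₂]
    simp only [hε₂, Prod.fst_add, fst₁]
    set q := H₁.symm p
    set n := -round (q.1 - q.2)
    -- Since W_n(0) = 0, the shift of the angle is at most |a|/100, so the sign of a survives and
    -- the line a = 0 is fixed.
    have w1 : |W n p.1| ≤ δ * |p.1| := by
      have := (convex_univ (𝕜 := ℝ) (E := ℝ)).norm_image_sub_le_of_norm_hasDerivWithin_le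
        (f := W n) (f' := G n) (C := δ) (x := 0) (y := p.1)
        (fun a _ => (hWG n a).hasDerivWithinAt) (fun a _ => (hGδ n a).norm_le) (mem_univ _)
        (mem_univ _)
      simpa [hW0] using this
    have w2 : |periodize (deriv χ) W q| ≤ 1 / 100 * |p.1| := by
      change |deriv χ (q.1 - q.2 - round (q.1 - q.2)) * W n q.1| ≤ _
      have fq : q.1 = p.1 := fst₁ p
      rw [abs_mul, show W n q.1 = W n p.1 by rw [fq]]
      have h5 := (hb₁' (q.1 - q.2 - round (q.1 - q.2))).norm_le
      rw [Real.norm_eq_abs] at h5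
      calc _ ≤ A * (δ * |p.1|) := mul_le_mul h5 w1 (abs_nonneg _) hA0.le
        _ = A * δ * |p.1| := by ring
        _ ≤ 1 / 100 * |p.1| := by
          gcongr
          exact (mul_le_mul_of_nonneg_right hAP hδ0.le).trans hPδ'
    rw [abs_le] at w2
    constructor
    · intro h
      by_contra hc
      rw [abs_of_neg (not_le.1 hc)] at w2
      linarith [w2.2]
    · intro h
      rw [abs_of_nonneg h] at w2
      linarith [w2.1]
  · set B : ℝ := P * (C * 4) + P * (C * 4) with hB
    refine ⟨K.factorial * B * (2 ^ K) ^ K, by positivity, ?_⟩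
    filter_upwards [eventually_ge_atTop 40] with m hm p hp1 hp2
    have hm' : (40 : ℝ) ≤ m := by exact_mod_cast hm
    have hj : ∀ q : ℝ × ℝ, ‖q - p‖ ≤ 1 / 100 → JetBound K ε₁ q (P * (C * 4) / m ^ 2) ∧
        JetBound K ε₂ q (P * (C * 4) / m ^ 2) := by
      intro q hq
      rw [Prod.norm_def, max_le_iff] at hq
      simp only [Prod.fst_sub, Prod.snd_sub, Real.norm_eq_abs, abs_le] at hq
      rw [abs_lt] at hp1 hp2
      set n := -round (q.1 - q.2) with hn
      have hr := abs_sub_round (q.1 - q.2)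
      rw [abs_le] at hr
      -- In the window a and I - m are below 8 in size, so the nearest integer differs from -m by
      -- less than 20 ≤ m/2, and bounds in n become bounds in m.
      have hnm : (m : ℝ) / 2 ≤ n := by
        rw [hn]; push_cast
        linarith [hq.1.2, hq.2.1, hr.1]
      have hle : C / (n : ℝ) ^ 2 ≤ C * 4 / m ^ 2 := by
        have hn2 : (m : ℝ) ^ 2 / 4 ≤ n ^ 2 := by
          have := pow_le_pow_left₀ (by positivity) hnm 2
          linarith [this, (by ring : ((m : ℝ) / 2) ^ 2 = m ^ 2 / 4)]
        calc C / (n : ℝ) ^ 2 ≤ C / (m ^ 2 / 4) := by gcongr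
          _ = C * 4 / m ^ 2 := by field_simp
      have e : P * (C * 4) / (m : ℝ) ^ 2 = P * (C * 4 / m ^ 2) := by ring
      rw [e]
      exact ⟨j₁ q _ fun a => (hGm n a).mono hle, j₂ q _ fun a => (hWm n a).mono hle⟩
    have q1 : ‖H₁.symm p - p‖ ≤ 1 / 100 := by
      nth_rewrite 1 [i₁ p]
      simpa using n₁ (H₁.symm p)
    have q2 : ‖H₂.symm p - p‖ ≤ 1 / 100 := by
      nth_rewrite 1 [i₂ p]
      simpa using n₂ (H₂.symm p)
    have one2 : (1 : ℝ) ≤ 2 ^ K := one_le_pow₀ (by norm_num)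
    constructor
    · have := JetBound.comp (g := fun q => ε₂ q - ε₁ q) (f := H₁.symm)
        ((hj _ q1).2.sub (hj _ q1).1) (d₁ p) one2
      refine (this.mono (le_of_eq ?_)).congr (Eventually.of_forall eR)
      rw [hB]; ring
    · have := JetBound.comp (g := fun q => ε₁ q - ε₂ q) (f := H₂.symm)
        ((hj _ q2).1.sub (hj _ q2).2) (d₂ p) one2
      refine (this.mono (le_of_eq ?_)).congr (Eventually.of_forall eR')
      rw [hB]; ring
  · filter_upwards [hslack] with m hm p hp1 hp2
    have hs := hm p.1 p.2 hp1 (by linarith)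
    rw [Prod.mk.eta] at hs
    rw [hs]
    change _ ↔ -(m : ℝ) ≤ (H₂ (H₁.symm p)).1 - (H₂ (H₁.symm p)).2
    rw [h₂]
    simp only [hε₂, Prod.fst_add, Prod.snd_add]
    have e1 := fst₁ p
    have e2 := snd₁ p
    set q := H₁.symm p
    have e3 := n₁ q
    simp only [hε₁, Prod.norm_def, norm_neg, Real.norm_eq_abs, abs_zero, max_le_iff] at e3
    have e4 := (hGδ m p.1).norm_le.trans (min_le_right _ _)
    rw [Real.norm_eq_abs] at e4
    have e5 := abs_le.1 e3.2
    have e6 := abs_le.1 e4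
    have : -(m : ℝ) ≤ q.1 + periodize (deriv χ) W q - (q.2 + periodize (deriv χ) W q) ↔
        q.2 ≤ p.1 + m := by rw [e1]; constructor <;> intro h <;> linarith
    rw [this, ← e2]
    -- Close to the curve the cut-off is 1 and the two conditions are literally the same. Farther
    -- away than 1/12 the perturbations, at most 1/100, cannot change the sign.
    rcases le_or_gt |q.1 - q.2 + (m : ℤ)| (1 / 12) with hc | hc
    · rw [periodize_eq z0 (hc.trans_lt (by norm_num)), hχ1 _ hc, e1]
      constructor <;> intro h <;> linarith
    · rw [Int.cast_natCast, e1] at hc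
      rcases lt_abs.1 hc with hc | hc
      · exact ⟨fun _ => by linarith, fun _ => by linarith [e5.2]⟩
      · exact ⟨fun h => by linarith [e5.2], fun h => by linarith⟩

/-! ### The remainder -/

section Family

variable {E F G : Type*} [NormedAddCommGroup E] [NormedSpace ℝ E] [NormedAddCommGroup F]
  [NormedSpace ℝ F] [NormedAddCommGroup G] [NormedSpace ℝ G]

/-- The derivatives of `f m` up to order `K` are `O(m⁻ʲ)` on `S m`. -/
def JetO (K : ℕ) (S : ℕ → Set E) (f : ℕ → E → F) (j : ℕ) : Prop :=
  ∃ C, 0 < C ∧ ∀ᶠ m : ℕ in atTop, ∀ p ∈ S m, JetBound K (f m) p (C / m ^ j)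

/-- The derivatives of `f m` of orders `1, …, K` are bounded on `S m`. -/
def DerivO (K : ℕ) (S : ℕ → Set E) (f : ℕ → E → F) : Prop :=
  ∃ C, 1 ≤ C ∧ ∀ᶠ m : ℕ in atTop, ∀ p ∈ S m, DerivBound K (f m) p C

variable {K : ℕ} {S : ℕ → Set E} {f g : ℕ → E → F} {i j : ℕ}

theorem JetO.add (hf : JetO K S f j) (hg : JetO K S g j) :
    JetO K S (fun m p => f m p + g m p) j := by
  obtain ⟨C, hC, h1⟩ := hf
  obtain ⟨D, hD, h2⟩ := hg
  refine ⟨C + D, by positivity, ?_⟩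
  filter_upwards [h1, h2] with m h1 h2 p hp
  exact ((h1 p hp).add (h2 p hp)).mono (le_of_eq (by ring))

theorem JetO.clm_comp (L : F →L[ℝ] G) (hf : JetO K S f j) : JetO K S (fun m p => L (f m p)) j := by
  obtain ⟨C, hC, h1⟩ := hf
  refine ⟨(‖L‖ + 1) * C, by positivity, ?_⟩
  filter_upwards [h1] with m h1 p hp
  refine ((h1 p hp).clm_comp L).mono ?_
  rw [mul_div_assoc]
  exact mul_le_mul_of_nonneg_right (by linarith) (h1 p hp).nonneg

theorem JetO.prodMk {g : ℕ → E → G} (hf : JetO K S f j) (hg : JetO K S g j) :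
    JetO K S (fun m p => (f m p, g m p)) j := by
  obtain ⟨C, hC, h1⟩ := hf
  obtain ⟨D, hD, h2⟩ := hg
  refine ⟨max C D, lt_max_of_lt_left hC, ?_⟩
  filter_upwards [h1, h2] with m h1 h2 p hp
  refine ((h1 p hp).mono ?_).prodMk ((h2 p hp).mono ?_)
  · gcongr; exact le_max_left _ _
  · gcongr; exact le_max_right _ _

theorem JetO.mul {f g : ℕ → E → ℝ} (hf : JetO K S f i) (hg : JetO K S g j) :
    JetO K S (fun m p => f m p * g m p) (i + j) := by
  obtain ⟨C, hC, h1⟩ := hf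
  obtain ⟨D, hD, h2⟩ := hg
  refine ⟨2 ^ K * (C * D), by positivity, ?_⟩
  filter_upwards [h1, h2] with m h1 h2 p hp
  refine ((h1 p hp).mul (h2 p hp)).mono (le_of_eq ?_)
  rw [pow_add]; field_simp

theorem JetO.mono (hf : JetO K S f j) (hij : i ≤ j) : JetO K S f i := by
  obtain ⟨C, hC, h1⟩ := hf
  refine ⟨C, hC, ?_⟩
  filter_upwards [h1, eventually_ge_atTop 1] with m h1 hm p hp
  have hm1 : (1 : ℝ) ≤ m := by exact_mod_cast hm
  have hm0 : (0 : ℝ) < m := by linarith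
  refine (h1 p hp).mono ?_
  gcongr

theorem JetO.congr (hf : JetO K S f j) (h : ∀ m p, g m p = f m p) : JetO K S g j := by
  have : g = f := funext fun m => funext fun p => h m p
  rwa [this]

theorem JetO.const (c : F) : JetO K S (fun _ _ => c) 0 := by
  refine ⟨‖c‖ + 1, by positivity, Eventually.of_forall fun m p _ => ⟨contDiffAt_const, fun k _ => ?_⟩⟩
  rcases Nat.eq_zero_or_pos k with rfl | hk
  · simp
  · rw [iteratedFDeriv_const_of_ne (by omega)]
    simp
    positivity

theorem JetO.const_mul {f : ℕ → E → ℝ} (hf : JetO K S f j) (c : ℝ) :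
    JetO K S (fun m p => c * f m p) j := by
  simpa using (JetO.const (K := K) (S := S) c).mul hf

theorem JetO.sub (hf : JetO K S f j) (hg : JetO K S g j) :
    JetO K S (fun m p => f m p - g m p) j := by
  obtain ⟨C, hC, h1⟩ := hf
  obtain ⟨D, hD, h2⟩ := hg
  refine ⟨C + D, by positivity, ?_⟩
  filter_upwards [h1, h2] with m h1 h2 p hp
  exact ((h1 p hp).sub (h2 p hp)).mono (le_of_eq (by ring))

theorem JetO.fst {f : ℕ → E → F × G} (hf : JetO K S f j) : JetO K S (fun m p => (f m p).1) j :=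
  hf.clm_comp (ContinuousLinearMap.fst ℝ F G)

theorem JetO.snd {f : ℕ → E → F × G} (hf : JetO K S f j) : JetO K S (fun m p => (f m p).2) j :=
  hf.clm_comp (ContinuousLinearMap.snd ℝ F G)

theorem JetO.derivO (hf : JetO K S f j) : DerivO K S f := by
  obtain ⟨C, hC, h1⟩ := hf.mono (Nat.zero_le j)
  refine ⟨max C 1, le_max_right _ _, ?_⟩
  filter_upwards [h1] with m h1 p hp
  exact (h1 p hp).derivBound.mono (by simp)

theorem DerivO.add (hf : DerivO K S f) (hg : DerivO K S g) :
    DerivO K S (fun m p => f m p + g m p) := by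
  obtain ⟨C, hC, h1⟩ := hf
  obtain ⟨D, hD, h2⟩ := hg
  refine ⟨C + D, by linarith, ?_⟩
  filter_upwards [h1, h2] with m h1 h2 p hp
  exact (h1 p hp).add (h2 p hp)

theorem DerivO.affine (L : E →L[ℝ] F) (c : ℕ → F) : DerivO K S (fun m p => L p + c m) :=
  ⟨max ‖L‖ 1, le_max_right _ _, Eventually.of_forall fun m _ _ =>
    DerivBound.affine L (c m) (le_max_left _ _)⟩

theorem DerivO.congr (hf : DerivO K S f) (h : ∀ m p, g m p = f m p) : DerivO K S g := by
  have : g = f := funext fun m => funext fun p => h m p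
  rwa [this]

theorem DerivO.jetO (hf : DerivO K S f) {B : ℝ} (h : ∀ᶠ m : ℕ in atTop, ∀ p ∈ S m, ‖f m p‖ ≤ B) :
    JetO K S f 0 := by
  obtain ⟨C, hC, h1⟩ := hf
  refine ⟨max C B, lt_max_of_lt_left (by linarith), ?_⟩
  filter_upwards [h1, h] with m h1 h2 p hp
  refine ⟨(h1 p hp).1, fun k hk => ?_⟩
  rw [pow_zero, div_one]
  rcases Nat.eq_zero_or_pos k with rfl | hk0
  · simpa using Or.inr (h2 p hp)
  · exact ((h1 p hp).2 k hk0 hk).trans (le_max_left _ _)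

theorem JetO.norm_le (hf : JetO K S f j) :
    ∃ C, 0 < C ∧ ∀ᶠ m : ℕ in atTop, ∀ p ∈ S m, ‖f m p‖ ≤ C / m ^ j := by
  obtain ⟨C, hC, h1⟩ := hf
  exact ⟨C, hC, h1.mono fun m h p hp => (h p hp).norm_le⟩

theorem JetO.eventually_norm_le (hf : JetO K S f j) (hj : j ≠ 0) {δ : ℝ} (hδ : 0 < δ) :
    ∀ᶠ m : ℕ in atTop, ∀ p ∈ S m, ‖f m p‖ ≤ δ := by
  obtain ⟨C, hC, h1⟩ := hf.norm_le
  have : Tendsto (fun m : ℕ => C / (m : ℝ) ^ j) atTop (𝓝 0) :=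
    tendsto_const_nhds.div_atTop ((tendsto_pow_atTop hj).comp tendsto_natCast_atTop_atTop)
  filter_upwards [h1, this.eventually (ge_mem_nhds hδ)] with m h1 h2 p hp
  exact (h1 p hp).trans h2

theorem JetO.comp {T : ℕ → Set F} {g : ℕ → F → G} (hg : JetO K T g j) (hf : DerivO K S f)
    (hST : ∀ᶠ m : ℕ in atTop, ∀ p ∈ S m, f m p ∈ T m) : JetO K S (fun m p => g m (f m p)) j := by
  obtain ⟨C, hC, h1⟩ := hg
  obtain ⟨D, hD, h2⟩ := hf
  have : 0 < D := by linarith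
  refine ⟨K.factorial * C * D ^ K, by positivity, ?_⟩
  filter_upwards [h1, h2, hST] with m h1 h2 h3 p hp
  exact ((h1 _ (h3 p hp)).comp (h2 p hp) hD).mono (le_of_eq (by ring))

end Family

theorem jetO_inv_snd (K : ℕ) :
    JetO K (fun m => {p : ℝ × ℝ | |p.1| ≤ 3 * m ∧ |p.2 - m| ≤ m / 2}) (fun _ p => p.2⁻¹) 1 := by
  have hH : ContDiffOn ℝ ∞ (fun q : ℝ × ℝ × ℝ => (1 + q.2.1)⁻¹) {q | -1 < q.2.1} :=
    ContDiffOn.inv (by fun_prop) fun q hq => by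
      have : -1 < q.2.1 := hq
      linarith
  obtain ⟨C, hC, hb⟩ := exists_jetBound_rescale K hH
  refine ⟨C, hC, ?_⟩
  filter_upwards [eventually_ge_atTop 1] with m hm p hp
  have hm0 : (0 : ℝ) < m := by exact_mod_cast hm
  have := ((hb m hm p hp.1 hp.2).const_smul ((m : ℝ)⁻¹)).congr (g := fun p : ℝ × ℝ => p.2⁻¹)
    (Eventually.of_forall fun q => by
      have e1 : 1 + (q.2 - m) / m = q.2 / m := by field_simp; ring
      simp only [e1, smul_eq_mul, inv_div]
      field_simp)
  convert this using 1
  rw [abs_of_nonneg (by positivity)]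
  field_simp

/-- The leading part of the passage through the singularity. -/
noncomputable def crossMain (Δ Δ₁ : ℝ) (q : ℝ × ℝ) : ℝ × ℝ :=
  (q.1 - q.2, q.2 + Δ * (q.1 - q.2 - 1 / 2) + q.2⁻¹ * (Δ₁ * ((q.1 - q.2 - 1 / 2) ^ 2 - 1 / 12)))

/-- The passage through the singularity, in the coordinates `(a, I)`. -/
noncomputable def crossMap (Δ Δ₁ : ℝ) (c : ℝ × ℝ → ℝ × ℝ) (q : ℝ × ℝ) : ℝ × ℝ :=
  crossMain Δ Δ₁ q + (q.2⁻¹ ^ 2) • c (q.1 - q.2, q.2⁻¹)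

/-- Near-identity bounds hold on larger strips. -/
theorem jetO_sub_id_of_strip {K : ℕ} {R : ℝ × ℝ → ℝ × ℝ} {C : ℝ} (hC : 0 < C)
    (h : ∀ᶠ m : ℕ in atTop, ∀ p : ℝ × ℝ, |p.1| < 8 → |p.2 - m| < 8 →
      JetBound K (fun q => R q - q) p (C / m ^ 2)) (B : ℝ) :
    JetO K (fun m => {p : ℝ × ℝ | |p.1| < 8 ∧ |p.2 - m| ≤ B}) (fun _ q => R q - q) 2 := by
  obtain ⟨M, hM⟩ := eventually_atTop.1 h
  refine ⟨4 * C, by positivity, ?_⟩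
  filter_upwards [eventually_ge_atTop (2 * M), eventually_ge_atTop (⌈2 * B⌉₊ + 2)] with m h1 h2 p hp
  have h1' : (2 * M : ℝ) ≤ m := by exact_mod_cast h1
  have h2' : 2 * B + 2 ≤ m := by
    have h3 : ((⌈2 * B⌉₊ + 2 : ℕ) : ℝ) ≤ m := by exact_mod_cast h2
    push_cast at h3
    linarith [Nat.le_ceil (2 * B)]
  have hp2 := abs_le.1 hp.2
  have hm0 : (0 : ℝ) < m := by
    have : 0 < m := by omega
    exact_mod_cast this
  -- The bound is applied with the index ⌈p.2⌉ instead of m; the two are comparable on a strip of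
  -- fixed width.
  have hge : (m : ℝ) / 2 ≤ ⌈p.2⌉₊ := by linarith [Nat.le_ceil p.2]
  have hlt : (⌈p.2⌉₊ : ℝ) < p.2 + 1 := Nat.ceil_lt_add_one (by linarith)
  have hMn : M ≤ ⌈p.2⌉₊ := by
    have : (M : ℝ) ≤ ⌈p.2⌉₊ := by linarith
    exact_mod_cast this
  refine (hM _ hMn p hp.1 (abs_lt.2 ⟨by linarith, by linarith [Nat.le_ceil p.2]⟩)).mono ?_
  have hn2 : (m : ℝ) ^ 2 / 4 ≤ (⌈p.2⌉₊ : ℝ) ^ 2 := by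
    have := pow_le_pow_left₀ (by positivity) hge 2
    linarith [this, (by ring : ((m : ℝ) / 2) ^ 2 = m ^ 2 / 4)]
  calc C / (⌈p.2⌉₊ : ℝ) ^ 2 ≤ C / (m ^ 2 / 4) := by gcongr
    _ = 4 * C / m ^ 2 := by field_simp

/-- In straightened coordinates, the return map is its leading part up to `O(m⁻²)`. -/
theorem jetO_return_sub (K : ℕ) {e : ℝ × ℝ → ℝ × ℝ} (he : ContDiff ℝ ∞ e) {c : ℝ × ℝ → ℝ × ℝ}
    (hc : ContDiff ℝ ∞ c) (Δ Δ₁ : ℝ) {R R' : ℝ × ℝ → ℝ × ℝ} {C : ℝ} (hC : 0 < C)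
    (hR : ∀ᶠ m : ℕ in atTop, ∀ p : ℝ × ℝ, |p.1| < 8 → |p.2 - m| < 8 →
      JetBound K (fun q => R q - q) p (C / m ^ 2) ∧
      JetBound K (fun q => R' q - q) p (C / m ^ 2)) :
    JetO K (fun m => {p : ℝ × ℝ | |p.1| < 3 ∧ |p.1 - p.2 + m| < 3})
      (fun m p => R (crossMap Δ Δ₁ c ((shiftMap e)^[m] (R' p))) - crossMain Δ Δ₁ (p.1 + m, p.2))
      2 := by
  set S : ℕ → Set (ℝ × ℝ) := fun m => {p : ℝ × ℝ | |p.1| < 3 ∧ |p.1 - p.2 + m| < 3} with hS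
  have hS2 : ∀ m, ∀ p ∈ S m, |p.1| < 3 ∧ |p.2 - m| < 6 := fun m p hp => by
    refine ⟨hp.1, ?_⟩
    have h1 := abs_lt.1 hp.1
    have h2 := abs_lt.1 hp.2
    exact abs_lt.2 ⟨by linarith [h1.1, h2.2], by linarith [h1.2, h2.1]⟩
  have hη : JetO K S (fun _ p => R' p - p) 2 := by
    refine ⟨C, hC, hR.mono fun m h p hp => ?_⟩
    obtain ⟨h1, h2⟩ := hS2 m p hp
    exact (h p (by linarith) (by linarith)).2
  have hid : DerivO K S (fun _ p => p) := by
    simpa using DerivO.affine (K := K) (S := S) (ContinuousLinearMap.id ℝ (ℝ × ℝ)) 0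
  have hR' : DerivO K S (fun _ p => R' p) := (hη.derivO.add hid).congr fun m p => by simp
  have hε : JetO K (fun m => {p : ℝ × ℝ | |p.1| < 8 ∧ |p.2 - m| < 8})
      (fun m q => (shiftMap e)^[m] q - (q.1 + m, q.2)) 2 := by
    obtain ⟨C₂, hC₂, hit⟩ := exists_iterate_shiftMap_bound K he 8
    refine ⟨C₂, hC₂, ?_⟩
    filter_upwards [hit, eventually_ge_atTop 1] with m h hm p hp
    have hm0 : (0 : ℝ) < m := by exact_mod_cast hm
    refine (h m (by omega) p hp.1 hp.2).2.mono (le_of_eq ?_)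
    field_simp
  have hR'mem : ∀ᶠ m : ℕ in atTop, ∀ p ∈ S m, |(R' p).1| < 8 ∧ |(R' p).2 - m| < 8 := by
    filter_upwards [hη.eventually_norm_le two_ne_zero one_pos] with m h p hp
    obtain ⟨h1, h2⟩ := hS2 m p hp
    have h3 := h p hp
    rw [Prod.norm_def, max_le_iff] at h3
    simp only [Prod.fst_sub, Prod.snd_sub, Real.norm_eq_abs, abs_le] at h3
    rw [abs_lt] at h1 h2
    exact ⟨abs_lt.2 ⟨by linarith [h3.1.1], by linarith [h3.1.2]⟩,
      abs_lt.2 ⟨by linarith [h3.2.1], by linarith [h3.2.2]⟩⟩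
  set q : ℕ → ℝ × ℝ → ℝ × ℝ := fun m p => (shiftMap e)^[m] (R' p) with hq
  have hy : JetO K S (fun m p => q m p - (p.1 + m, p.2)) 2 :=
    ((hε.comp hR' hR'mem).add hη).congr fun m p => by
      refine Prod.ext ?_ ?_ <;> simp [hq]; ring
  have hqD : DerivO K S q := by
    refine (hy.derivO.add (DerivO.affine (ContinuousLinearMap.id ℝ (ℝ × ℝ))
      fun m => ((m : ℝ), (0 : ℝ)))).congr fun m p => ?_
    refine Prod.ext ?_ ?_ <;> simp
  have hynorm := hy.eventually_norm_le two_ne_zero one_pos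
  have hymem : ∀ᶠ m : ℕ in atTop, ∀ p ∈ S m, |(q m p).1 - (p.1 + m)| ≤ 1 ∧
      |(q m p).2 - p.2| ≤ 1 := by
    filter_upwards [hynorm] with m h p hp
    have h3 := h p hp
    rw [Prod.norm_def, max_le_iff] at h3
    simpa using h3
  -- reciprocals of the actions
  have hqi : JetO K S (fun m p => (q m p).2⁻¹) 1 := by
    refine (jetO_inv_snd K).comp hqD ?_
    filter_upwards [hymem, eventually_ge_atTop 20] with m h hm p hp
    have hm' : (20 : ℝ) ≤ m := by exact_mod_cast hm
    obtain ⟨h1, h2⟩ := hS2 m p hp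
    obtain ⟨h3, h4⟩ := h p hp
    rw [abs_lt] at h1 h2
    rw [abs_le] at h3 h4
    exact ⟨abs_le.2 ⟨by linarith, by linarith⟩, abs_le.2 ⟨by linarith, by linarith⟩⟩
  have hpi : JetO K S (fun m p => p.2⁻¹) 1 := by
    refine (jetO_inv_snd K).comp hid ?_
    filter_upwards [eventually_ge_atTop 20] with m hm p hp
    have hm' : (20 : ℝ) ≤ m := by exact_mod_cast hm
    obtain ⟨h1, h2⟩ := hS2 m p hp
    rw [abs_lt] at h1 h2
    exact ⟨abs_le.2 ⟨by linarith, by linarith⟩, abs_le.2 ⟨by linarith, by linarith⟩⟩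
  -- phases
  have hς : JetO K S (fun m p => p.1 - p.2 + m) 0 := by
    refine (DerivO.affine (ContinuousLinearMap.fst ℝ ℝ ℝ - ContinuousLinearMap.snd ℝ ℝ ℝ)
      fun m : ℕ => (m : ℝ)).jetO (B := 3) (Eventually.of_forall fun m p hp => ?_)
    exact hp.2.le
  have hy1 := hy.fst
  have hy2 := hy.snd
  simp only [Prod.fst_sub, Prod.snd_sub] at hy1 hy2
  have hσ := hy1.sub hy2
  have hs : JetO K S (fun m p => (q m p).1 - (q m p).2) 0 :=
    (hς.add (hσ.mono (Nat.zero_le 2))).congr fun m p => by ring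
  have hsmem : ∀ᶠ m : ℕ in atTop, ∀ p ∈ S m, |(q m p).1 - (q m p).2| ≤ 5 := by
    filter_upwards [hymem] with m h p hp
    obtain ⟨h3, h4⟩ := h p hp
    have h2 := abs_lt.1 hp.2
    rw [abs_le] at h3 h4 ⊢
    constructor <;> linarith
  -- the leading part
  have hhalf : JetO K S (fun m p => (p.1 - p.2 + m) - 1 / 2) 0 := hς.sub (JetO.const _)
  have hshalf : JetO K S (fun m p => (q m p).1 - (q m p).2 - 1 / 2) 0 := hs.sub (JetO.const _)
  have hmain2 : JetO K S (fun m p => (crossMain Δ Δ₁ (q m p)).2 -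
      (crossMain Δ Δ₁ (p.1 + m, p.2)).2) 2 := by
    -- With h = p.1 - p.2 + m - 1/2 and s the phase of the orbit minus 1/2, the difference of the
    -- second components is split by means of s² - h² = σ(s + h) and 1/q₂ - 1/p₂ = -(q₂ -
    -- p₂)/(q₂p₂). Each term contains a factor σ or q₂ - p₂ of size O(m⁻²).
    have a1 := hσ.const_mul Δ
    have a2 := ((hqi.mono (Nat.zero_le 1)).mul (hσ.mul (hshalf.add hhalf))).const_mul Δ₁
    have a3 := ((hy2.mul ((hqi.mono (Nat.zero_le 1)).mul (hpi.mono (Nat.zero_le 1)))).mul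
      ((hhalf.mul hhalf).sub (JetO.const (1 / 12)))).const_mul Δ₁
    obtain ⟨C', hC', hb⟩ := ((hy2.add a1).add a2).sub a3
    refine ⟨C', hC', ?_⟩
    obtain ⟨D, -, hd⟩ := hqD
    filter_upwards [hb, hymem, hd, eventually_ge_atTop 20] with m h hm1 hqc hm p hp
    have hm' : (20 : ℝ) ≤ m := by exact_mod_cast hm
    refine (h p hp).congr ?_
    have hpos : ∀ᶠ x in 𝓝 p, x.2 ≠ 0 ∧ (q m x).2 ≠ 0 := by
      obtain ⟨h1, h2⟩ := hS2 m p hp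
      obtain ⟨h3, h4⟩ := hm1 p hp
      rw [abs_lt] at h1 h2
      rw [abs_le] at h3 h4
      refine ContinuousAt.eventually_ne (by fun_prop) (by linarith) |>.and
        (ContinuousAt.eventually_ne ?_ (by linarith))
      exact (hqc p hp).1.continuousAt.snd
    filter_upwards [hpos] with x hx
    obtain ⟨hx1, hx2⟩ := hx
    simp only [crossMain]
    field_simp
    ring
  have hmain : JetO K S (fun m p => crossMain Δ Δ₁ (q m p) - crossMain Δ Δ₁ (p.1 + m, p.2)) 2 :=
    (hσ.prodMk hmain2).congr fun m p => by
      refine Prod.ext ?_ ?_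
      · simp only [crossMain, Prod.fst_sub]; ring
      · simp only [Prod.snd_sub]
  -- the error of the crossing
  have hcc : JetO K S (fun m p => c ((q m p).1 - (q m p).2, (q m p).2⁻¹)) 0 := by
    obtain ⟨C', hC', hb⟩ := exists_jetBound_of_isCompact K isOpen_univ
      ((isCompact_Icc (a := (-5 : ℝ)) (b := 5)).prod (isCompact_Icc (a := (-1 : ℝ)) (b := 1)))
      (subset_univ _) hc.contDiffOn
    have hout : JetO K (fun _ => Icc (-5 : ℝ) 5 ×ˢ Icc (-1 : ℝ) 1) (fun _ => c) 0 :=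
      ⟨C', hC', Eventually.of_forall fun m p hp => by simpa using hb p hp⟩
    refine hout.comp (hs.prodMk (hqi.mono (Nat.zero_le 1))).derivO ?_
    filter_upwards [hsmem, hqi.eventually_norm_le one_ne_zero one_pos] with m h1 h2 p hp
    exact ⟨abs_le.1 (h1 p hp), abs_le.1 (h2 p hp)⟩
  have herr : JetO K S (fun m p => ((q m p).2⁻¹ ^ 2) •
      c ((q m p).1 - (q m p).2, (q m p).2⁻¹)) 2 := by
    have := hqi.mul hqi
    refine ((this.mul hcc.fst).prodMk (this.mul hcc.snd)).congr fun m p => ?_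
    refine Prod.ext ?_ ?_ <;> simp [pow_two]
  have hz : JetO K S (fun m p => crossMap Δ Δ₁ c (q m p) - crossMain Δ Δ₁ (p.1 + m, p.2)) 2 :=
    (hmain.add herr).congr fun m p => by simp only [crossMap]; abel
  -- the straightening
  have hw : JetO K S (fun m p => crossMain Δ Δ₁ (p.1 + m, p.2) - (0, (m : ℝ))) 0 := by
    have b1 : JetO K S (fun m p => p.2 - (m : ℝ)) 0 := by
      refine ((DerivO.affine (ContinuousLinearMap.snd ℝ ℝ ℝ)
        fun m : ℕ => -(m : ℝ)).jetO (B := 6) (Eventually.of_forall fun m p hp => ?_)).congr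
          fun m p => sub_eq_add_neg _ _
      have := (hS2 m p hp).2.le
      simpa [sub_eq_add_neg] using this
    have b2 := ((hpi.mono (Nat.zero_le 1)).mul
      (((hhalf.mul hhalf).sub (JetO.const (1 / 12))).const_mul Δ₁))
    refine (hς.prodMk ((b1.add (hhalf.const_mul Δ)).add b2)).congr fun m p => ?_
    refine Prod.ext ?_ ?_ <;> simp only [crossMain, Prod.fst_sub, Prod.snd_sub] <;> ring
  have hzw : JetO K S (fun m p => crossMap Δ Δ₁ c (q m p) - (0, (m : ℝ))) 0 :=
    ((hz.mono (Nat.zero_le 2)).add hw).congr fun m p => by abel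
  have hzD : DerivO K S (fun m p => crossMap Δ Δ₁ c (q m p)) :=
    (hzw.derivO.add (DerivO.affine (0 : ℝ × ℝ →L[ℝ] ℝ × ℝ) fun m => (0, (m : ℝ)))).congr
      fun m p => by simp
  obtain ⟨B, hB, hzB⟩ := hzw.norm_le
  -- The kick moves the action away from m by an amount bounded by `B` but not necessarily below 8,
  -- so the bounds for R are needed on a wider strip.
  have hRz : JetO K S (fun m p => R (crossMap Δ Δ₁ c (q m p)) - crossMap Δ Δ₁ c (q m p)) 2 := by
    refine (jetO_sub_id_of_strip hC (hR.mono fun m h p h1 h2 => (h p h1 h2).1) B).comp hzD ?_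
    filter_upwards [hz.eventually_norm_le two_ne_zero one_pos, hzB] with m h1 h2 p hp
    have h3 := h1 p hp
    have h4 := h2 p hp
    rw [Prod.norm_def, max_le_iff] at h3 h4
    rw [pow_zero, div_one] at h4
    refine ⟨?_, h4.2⟩
    have h5 := abs_le.1 h3.1
    have h6 := abs_lt.1 hp.2
    simp only [crossMain, Prod.fst_sub] at h5
    exact abs_lt.2 ⟨by linarith [h5.1], by linarith [h5.2]⟩
  exact (hRz.add hz).congr fun m p => by abel

/-! ### The angle-action chart -/

section Chart

variable {g : ℝ → ℝ} {J : ℝ}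

theorem contDiff_deriv_infty {g : ℝ → ℝ} (hg : ContDiff ℝ ∞ g) : ContDiff ℝ ∞ (deriv g) :=
  (contDiff_infty_iff_deriv.1 hg).2

theorem contDiffAt_angleAction (hg : ContDiff ℝ ∞ g) (hpos : ∀ t, 0 < g t) {x : ℝ × ℝ}
    (hx : 0 < g x.1 ^ 2 * (x.2 + deriv g x.1) ^ 2 + actionCorrection g x.1) :
    ContDiffAt ℝ ∞ (angleAction g J) x := by
  have h1 := contDiff_deriv_infty hg
  have h2 := contDiff_actionCorrection hg
  have h3 := contDiff_conformalTime hg fun t => (hpos t).ne'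
  have hr : ContDiff ℝ ∞ fun x : ℝ × ℝ =>
      g x.1 ^ 2 * (x.2 + deriv g x.1) ^ 2 + actionCorrection g x.1 := by fun_prop
  have hW : ContDiffAt ℝ ∞ (fun x : ℝ × ℝ => wallAction g J x.1 (x.2 + deriv g x.1)) x :=
    contDiffAt_const.mul (hr.contDiffAt.sqrt hx.ne')
  have hθ : ContDiffAt ℝ ∞ (fun x : ℝ × ℝ => J⁻¹ * conformalTime g x.1) x :=
    (contDiff_const.mul (h3.comp contDiff_fst)).contDiffAt
  exact (hW.mul hθ).prodMk hW

/-- `(v + ġ) dt ∧ dv = (4/J) da ∧ dI`. -/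
theorem det_fderiv_angleAction (hg : ContDiff ℝ ∞ g) (hpos : ∀ t, 0 < g t) (hJ : 0 < J) {x : ℝ × ℝ}
    (hx : 0 < g x.1 ^ 2 * (x.2 + deriv g x.1) ^ 2 + actionCorrection g x.1) :
    (fderiv ℝ (angleAction g J) x).det = J / 4 * (x.2 + deriv g x.1) := by
  have h0 : ∀ t, g t ≠ 0 := fun t => (hpos t).ne'
  set W : ℝ × ℝ → ℝ := fun x => wallAction g J x.1 (x.2 + deriv g x.1) with hW
  have hf : ContDiffAt ℝ ∞ W x := (contDiffAt_angleAction (J := J) hg hpos hx).snd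
  have hWd : HasFDerivAt W (fderiv ℝ W x) x := (hf.differentiableAt (by simp)).hasFDerivAt
  have hθ : HasFDerivAt (fun x : ℝ × ℝ => J⁻¹ * conformalTime g x.1)
      (J⁻¹ • ((g x.1 ^ 2)⁻¹ • ContinuousLinearMap.fst ℝ ℝ ℝ)) x :=
    ((hasDerivAt_conformalTime hg.continuous h0 x.1).comp_hasFDerivAt x hasFDerivAt_fst).const_mul _
  have hQ : HasFDerivAt (angleAction g J) _ x := (hWd.mul hθ).prodMk hWd
  -- The first component is W times a function of t alone, so the terms with ∂W/∂t cancel and the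
  -- determinant is W·∂W/∂v/(J g²). Here W·∂W/∂v is half of ∂(W²)/∂v, to which the correction, a
  -- function of t, does not contribute.
  have hv : fderiv ℝ W x (0, 1) =
      (J / 2) ^ 2 * (g x.1 ^ 2 * (x.2 + deriv g x.1)) / W x := by
    have h2 : HasDerivAt (fun v : ℝ => (x.1, v)) ((0 : ℝ), (1 : ℝ)) x.2 :=
      (hasDerivAt_const _ _).prodMk (hasDerivAt_id _)
    have h3 : HasDerivAt (fun v => W (x.1, v)) (fderiv ℝ W x (0, 1)) x.2 :=
      HasFDerivAt.comp_hasDerivAt (f := fun v : ℝ => (x.1, v)) x.2 hWd h2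
    have h4 : HasDerivAt (fun v : ℝ => g x.1 ^ 2 * (v + deriv g x.1) ^ 2 + actionCorrection g x.1)
        (g x.1 ^ 2 * (2 * (x.2 + deriv g x.1))) x.2 := by
      have := ((((hasDerivAt_id x.2).add_const (deriv g x.1)).pow 2).const_mul
        (g x.1 ^ 2)).add_const (actionCorrection g x.1)
      simpa using this
    have h5 := (h4.sqrt hx.ne').const_mul (J / 2)
    rw [h3.unique h5, hW]
    simp only [wallAction]
    have : √(g x.1 ^ 2 * (x.2 + deriv g x.1) ^ 2 + actionCorrection g x.1) ≠ 0 :=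
      (Real.sqrt_pos.2 hx).ne'
    field_simp
  have hW0 : W x ≠ 0 := by
    have := Real.sqrt_pos.2 hx
    simp only [hW, wallAction]
    positivity
  have := h0 x.1
  rw [hQ.fderiv, det_prod_real]
  simp only [ContinuousLinearMap.prod_apply, add_apply, smul_apply, ContinuousLinearMap.coe_fst',
    smul_eq_mul, hv]
  field_simp
  ring

/-- The quotient a/I = J⁻¹∫₀ᵗ g⁻² determines t, and then I determines u², hence u > 0. -/
theorem angleAction_injective (hg : ContDiff ℝ ∞ g) (hpos : ∀ t, 0 < g t) (hJ : 0 < J)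
    {x y : ℝ × ℝ} (hx : 0 < g x.1 ^ 2 * (x.2 + deriv g x.1) ^ 2 + actionCorrection g x.1)
    (hux : 0 < x.2 + deriv g x.1) (huy : 0 < y.2 + deriv g y.1)
    (h : angleAction g J x = angleAction g J y) : x = y := by
  have h0 : ∀ t, g t ≠ 0 := fun t => (hpos t).ne'
  simp only [angleAction, Prod.mk.injEq] at h
  obtain ⟨h1, h2⟩ := h
  have hW : 0 < wallAction g J x.1 (x.2 + deriv g x.1) := by
    have := Real.sqrt_pos.2 hx
    unfold wallAction
    positivity
  rw [← h2] at h1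
  have h3 := mul_left_cancel₀ (inv_ne_zero hJ.ne') (mul_left_cancel₀ hW.ne' h1)
  have h4 := (strictMono_conformalTime hg.continuous h0).injective h3
  rw [← h4] at h2 huy
  simp only [wallAction] at h2
  have h5 := mul_left_cancel₀ (by positivity : J / 2 ≠ 0) h2
  have hy : 0 < g x.1 ^ 2 * (y.2 + deriv g x.1) ^ 2 + actionCorrection g x.1 := by
    by_contra hc
    rw [Real.sqrt_eq_zero_of_nonpos (not_lt.1 hc)] at h5
    exact (Real.sqrt_pos.2 hx).ne' h5
  rw [Real.sqrt_inj hx.le hy.le] at h5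
  have h6 : (x.2 + deriv g x.1) ^ 2 = (y.2 + deriv g x.1) ^ 2 :=
    mul_left_cancel₀ (pow_ne_zero 2 (h0 x.1)) (by linarith)
  have h7 := (sq_eq_sq₀ hux.le huy.le).1 h6
  exact Prod.ext h4 (by linarith)

theorem exists_forall_abs_le {f : ℝ → ℝ} (hf : Continuous f) (a b : ℝ) :
    ∃ M, 0 < M ∧ ∀ t ∈ Icc a b, |f t| ≤ M := by
  obtain ⟨M, hM⟩ := isCompact_Icc.exists_bound_of_continuousOn (s := Icc a b) hf.continuousOn
  exact ⟨max M 1, by positivity, fun t ht => (hM t ht).trans (le_max_left _ _)⟩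

theorem exists_forall_le_of_pos {f : ℝ → ℝ} (hf : Continuous f) (hpos : ∀ t, 0 < f t) (a b : ℝ) :
    ∃ μ, 0 < μ ∧ ∀ t ∈ Icc a b, μ ≤ f t := by
  rcases (Icc a b).eq_empty_or_nonempty with h | h
  · exact ⟨1, one_pos, fun t ht => by simp [h] at ht⟩
  · obtain ⟨t₀, -, h0⟩ := isCompact_Icc.exists_isMinOn h hf.continuousOn
    exact ⟨f t₀, hpos t₀, fun t ht => h0 ht⟩

/-- For large velocities the action is positive and comparable to the velocity. -/
theorem exists_action_bounds (hg : ContDiff ℝ ∞ g) (hpos : ∀ t, 0 < g t) (hJ : 0 < J) :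
    ∃ V c C : ℝ, 0 < V ∧ 0 < c ∧ 0 < C ∧ ∀ x : ℝ × ℝ, x.1 ∈ Icc (-1 : ℝ) 2 → V < x.2 →
      0 < x.2 + deriv g x.1 ∧
      0 < g x.1 ^ 2 * (x.2 + deriv g x.1) ^ 2 + actionCorrection g x.1 ∧
      c * x.2 ≤ (angleAction g J x).2 ∧ (angleAction g J x).2 ≤ C * x.2 := by
  obtain ⟨M, hM, hMb⟩ := exists_forall_abs_le hg.continuous (-1) 2
  obtain ⟨L, hL, hLb⟩ := exists_forall_abs_le (contDiff_deriv_infty hg).continuous (-1) 2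
  obtain ⟨K, hK, hKb⟩ := exists_forall_abs_le (contDiff_actionCorrection hg).continuous (-1) 2
  obtain ⟨μ, hμ, hμb⟩ := exists_forall_le_of_pos hg.continuous hpos (-1) 2
  -- Beyond 2L the relative velocity lies between v/2 and 2v; the term 8K/μ² makes the correction at
  -- most μ²v²/8, half of the lower bound μ²v²/4 for g²u².
  refine ⟨2 * L + 1 + 8 * K / μ ^ 2, J / 2 * (μ / 3), J / 2 * (3 * M), by positivity, by positivity,
    by positivity, fun x hx hv => ?_⟩
  have hq : 0 ≤ 8 * K / μ ^ 2 := by positivity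
  have b1 := hMb _ hx
  have b2 := abs_le.1 (hLb _ hx)
  have b3 := abs_le.1 (hKb _ hx)
  have b4 := hμb _ hx
  rw [abs_of_pos (hpos _)] at b1
  set u := x.2 + deriv g x.1 with hu
  have hv0 : 1 < x.2 := by linarith
  have u1 : x.2 / 2 ≤ u := by linarith
  have u2 : u ≤ 2 * x.2 := by linarith
  have hu0 : 0 < u := by linarith
  have hKv : K ≤ μ ^ 2 * x.2 ^ 2 / 8 := by
    have h1 : 8 * K / μ ^ 2 ≤ x.2 := by linarith
    rw [div_le_iff₀ (by positivity)] at h1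
    nlinarith [mul_le_mul_of_nonneg_left hv0.le (by positivity : 0 ≤ x.2 * μ ^ 2)]
  have lo : μ ^ 2 * (x.2 / 2) ^ 2 ≤ g x.1 ^ 2 * u ^ 2 := by gcongr
  have hi : g x.1 ^ 2 * u ^ 2 ≤ M ^ 2 * (2 * x.2) ^ 2 := by
    have := (hpos x.1).le
    gcongr
  have hμM : μ ^ 2 * x.2 ^ 2 ≤ M ^ 2 * x.2 ^ 2 := by
    have := b4.trans b1
    gcongr
  have hp2 : 0 < μ ^ 2 * x.2 ^ 2 := by positivity
  refine ⟨hu0, by nlinarith, ?_, ?_⟩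
  · change _ ≤ J / 2 * √_
    rw [mul_assoc]
    refine mul_le_mul_of_nonneg_left (Real.le_sqrt_of_sq_le ?_) (by positivity)
    nlinarith
  · change J / 2 * √_ ≤ _
    rw [mul_assoc]
    refine mul_le_mul_of_nonneg_left (Real.sqrt_le_iff.2 ⟨by positivity, ?_⟩) (by positivity)
    nlinarith

/-- A large action forces a large velocity. -/
theorem exists_lt_velocity (hg : ContDiff ℝ ∞ g) (hJ : 0 < J) (V : ℝ) :
    ∃ I₀, ∀ x : ℝ × ℝ, x.1 ∈ Icc (-1 : ℝ) 2 → 0 < x.2 + deriv g x.1 →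
      I₀ < (angleAction g J x).2 → V < x.2 := by
  obtain ⟨M, hM, hMb⟩ := exists_forall_abs_le hg.continuous (-1) 2
  obtain ⟨L, hL, hLb⟩ := exists_forall_abs_le (contDiff_deriv_infty hg).continuous (-1) 2
  obtain ⟨K, hK, hKb⟩ := exists_forall_abs_le (contDiff_actionCorrection hg).continuous (-1) 2
  refine ⟨J / 2 * √(M ^ 2 * (V + L) ^ 2 + K), fun x hx hu hI => ?_⟩
  by_contra hc
  refine absurd hI (not_lt.2 ?_)
  change J / 2 * √_ ≤ _
  have b2 := abs_le.1 (hLb _ hx)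
  have h1 : x.2 + deriv g x.1 ≤ V + L := by linarith [b2.2]
  have h2 : g x.1 ^ 2 ≤ M ^ 2 := by
    rw [← sq_abs]
    exact pow_le_pow_left₀ (abs_nonneg _) (hMb _ hx) 2
  have h3 := (abs_le.1 (hKb _ hx)).2
  gcongr

end Chart

/-! ### The ball and the moving wall -/

/-- A smooth extension is positive near [0,1]; averaging it with the constant 1 by a cut-off keeps
it positive everywhere. Positivity outside [0,1] matters since virtual collisions take place after t
= 1. -/
theorem IsWallMotion.exists_extension {ℓ : ℝ → ℝ} (hℓ : IsWallMotion ℓ) :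
    ∃ g : ℝ → ℝ, ContDiff ℝ ∞ g ∧ (∀ t, 0 < g t) ∧ EqOn ℓ g (Icc 0 1) := by
  obtain ⟨g, hg, hE⟩ := hℓ.smooth
  obtain ⟨χ, h1, -, h3, h4, h5⟩ := exists_contDiff_cutoff (isCompact_Icc (a := (0 : ℝ)) (b := 1))
    (isOpen_lt continuous_const hg.continuous) (fun t ht => by
      change 0 < g t
      rw [← hE ht]; exact hℓ.pos t)
  refine ⟨fun t => χ t * g t + (1 - χ t), by fun_prop, fun t => ?_, fun t ht => ?_⟩
  · have h6 := h5 t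
    by_cases ht : t ∈ tsupport χ
    · have h7 : 0 < g t := h3 ht
      rcases h6.2.lt_or_eq with h | h
      · have := mul_nonneg h6.1 h7.le
        linarith
      · simpa [h] using h7
    · simp [image_eq_zero_of_notMem_tsupport ht]
  · have := h4.self_of_nhdsSet t ht
    simp [this, hE ht]

section Motion

variable {ℓ g : ℝ → ℝ}

theorem IsWallMotion.fract (hℓ : IsWallMotion ℓ) (t : ℝ) : ℓ (Int.fract t) = ℓ t := by
  have := Function.Periodic.sub_int_mul_eq (f := ℓ) (c := 1) (x := t) hℓ.periodic ⌊t⌋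
  rwa [mul_one] at this

theorem wallJ_eq (hE : EqOn ℓ g (Icc 0 1)) : wallJ ℓ = conformalTime g 1 := by
  refine intervalIntegral.integral_congr fun t ht => ?_
  rw [uIcc_of_le zero_le_one] at ht
  simp only [hE ht]

theorem derivPlus_eq (hg : ContDiff ℝ ∞ g) (hE : EqOn ℓ g (Icc 0 1)) (k : ℕ) :
    derivPlus ℓ k = iteratedDeriv k g 0 := by
  have h0 : (0 : ℝ) ∈ Icc (0 : ℝ) 1 := left_mem_Icc.2 zero_le_one
  rw [derivPlus, iteratedDerivWithin_congr hE h0]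
  exact iteratedDerivWithin_eq_iteratedDeriv (uniqueDiffOn_Icc zero_lt_one)
    (hg.contDiffAt.of_le (by exact_mod_cast le_top)) h0

theorem derivMinus_eq (hℓ : IsWallMotion ℓ) (hg : ContDiff ℝ ∞ g) (hE : EqOn ℓ g (Icc 0 1))
    (k : ℕ) : derivMinus ℓ k = iteratedDeriv k (fun t => g (1 + t)) 0 := by
  have h0 : (0 : ℝ) ∈ Icc (-1 : ℝ) 0 := right_mem_Icc.2 (by norm_num)
  have hE' : EqOn ℓ (fun t => g (1 + t)) (Icc (-1) 0) := fun t ht => by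
    rw [← hℓ.periodic t, add_comm t 1]
    exact hE ⟨by linarith [ht.1], by linarith [ht.2]⟩
  rw [derivMinus, iteratedDerivWithin_congr hE' h0]
  have hg' : ContDiff ℝ ∞ fun t => g (1 + t) := by fun_prop
  exact iteratedDerivWithin_eq_iteratedDeriv (uniqueDiffOn_Icc (by norm_num))
    (hg'.contDiffAt.of_le (by exact_mod_cast le_top)) h0

theorem wallSpeed_eq (hg : ContDiff ℝ ∞ g) (hE : EqOn ℓ g (Icc 0 1)) {t : ℝ}
    (ht : t ∈ Ico (0 : ℝ) 1) : wallSpeed ℓ t = deriv g t := by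
  have h1 : ℓ =ᶠ[𝓝[Ici t] t] g := by
    filter_upwards [Icc_mem_nhdsGE ht.2] with s hs
    exact hE ⟨ht.1.trans hs.1, hs.2⟩
  rw [wallSpeed, h1.derivWithin_eq (hE ⟨ht.1, ht.2.le⟩)]
  exact (hg.differentiable (by simp) t).hasDerivAt.hasDerivWithinAt.derivWithin
    (uniqueDiffOn_Ici t t self_mem_Ici)

theorem IsWallMotion.wallSpeed_add_one (hℓ : IsWallMotion ℓ) (t : ℝ) :
    wallSpeed ℓ (t + 1) = wallSpeed ℓ t := by
  have : ℓ = fun x => ℓ (x + 1) := funext fun x => (hℓ.periodic x).symm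
  unfold wallSpeed
  conv_rhs => rw [this]
  rw [derivWithin_comp_add_const]
  congr 1
  ext x
  simp only [mem_vadd_set, mem_Ici, vadd_eq_add]
  exact ⟨fun h => ⟨x - 1, by linarith, by ring⟩, fun ⟨y, h, h'⟩ => by linarith⟩

theorem IsWallMotion.wallSpeed_fract (hℓ : IsWallMotion ℓ) (t : ℝ) :
    wallSpeed ℓ (Int.fract t) = wallSpeed ℓ t := by
  have := Function.Periodic.sub_int_mul_eq (f := wallSpeed ℓ) (c := 1) (x := t)
    hℓ.wallSpeed_add_one ⌊t⌋
  rwa [mul_one] at this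

theorem continuous_of_abs_sub_le {L : ℝ}
    (hL : ∀ s t, |ℓ s - ℓ t| ≤ L * |s - t|) : Continuous ℓ :=
  (LipschitzWith.of_dist_le' (K := L) fun s t => hL s t).continuous

theorem IsWallMotion.exists_lipschitz (hℓ : IsWallMotion ℓ) (hg : ContDiff ℝ ∞ g)
    (hE : EqOn ℓ g (Icc 0 1)) :
    ∃ L M : ℝ, 0 < L ∧ 0 < M ∧ (∀ s t, |ℓ s - ℓ t| ≤ L * |s - t|) ∧ (∀ t, ℓ t ≤ M) ∧
      (∀ t ∈ Icc (-1 : ℝ) 2, |deriv g t| ≤ L) := by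
  obtain ⟨M, hM, hMb⟩ := exists_forall_abs_le hg.continuous 0 1
  obtain ⟨L, hL, hLb⟩ := exists_forall_abs_le (contDiff_deriv_infty hg).continuous (-1) 2
  have hmem : ∀ t : ℝ, Int.fract t ∈ Icc (0 : ℝ) 1 := fun t =>
    ⟨Int.fract_nonneg t, (Int.fract_lt_one t).le⟩
  have hMl : ∀ t, ℓ t ≤ M := fun t => by
    rw [← hℓ.fract t, hE (hmem t)]
    exact (le_abs_self _).trans (hMb _ (hmem t))
  have hgL : ∀ s ∈ Icc (0 : ℝ) 1, ∀ t ∈ Icc (0 : ℝ) 1, |ℓ s - ℓ t| ≤ L * |s - t| := by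
    intro s hs t ht
    rw [hE hs, hE ht]
    exact (convex_Icc (0 : ℝ) 1).norm_image_sub_le_of_norm_deriv_le
      (fun x _ => hg.differentiable (by simp) x)
      (fun x hx => hLb x ⟨by linarith [hx.1], by linarith [hx.2]⟩) ht hs
  -- Over distances of at least 1 the bound on ℓ suffices. Shorter intervals are moved by a period
  -- to start in [0,1) and, if necessary, divided at 1.
  have key : ∀ s t, s ≤ t → |ℓ t - ℓ s| ≤ (L + M) * (t - s) := by
    intro s t hst
    rcases le_or_gt 1 (t - s) with h | h
    · have h1 := hℓ.pos s
      have h2 := hℓ.pos t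
      have : |ℓ t - ℓ s| ≤ M := abs_le.2 ⟨by linarith [hMl s], by linarith [hMl t]⟩
      nlinarith
    · have e : ∀ x, ℓ (x - ⌊s⌋) = ℓ x := fun x => by
        simpa using Function.Periodic.sub_int_mul_eq (f := ℓ) (c := 1) (x := x) hℓ.periodic ⌊s⌋
      rw [← e t, ← e s]
      set x := s - (⌊s⌋ : ℝ) with hx
      set y := t - (⌊s⌋ : ℝ) with hy
      have hxy : y - x = t - s := by rw [hx, hy]; ring
      have x0 : 0 ≤ x := Int.fract_nonneg s
      have x1 : x < 1 := Int.fract_lt_one s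
      rw [← hxy]
      have hxy0 : 0 ≤ y - x := by linarith
      have hML : L * (y - x) ≤ (L + M) * (y - x) := by nlinarith
      rcases le_or_gt y 1 with hy1 | hy1
      · have := hgL y ⟨by linarith, hy1⟩ x ⟨x0, x1.le⟩
        rw [abs_of_nonneg hxy0] at this
        linarith
      · have h1 := hgL 1 ⟨zero_le_one, le_rfl⟩ x ⟨x0, x1.le⟩
        have h2 := hgL (y - 1) ⟨by linarith, by linarith⟩ 0 ⟨le_rfl, zero_le_one⟩
        rw [abs_of_nonneg (show (0 : ℝ) ≤ 1 - x by linarith)] at h1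
        rw [sub_zero, abs_of_nonneg (show (0 : ℝ) ≤ y - 1 by linarith)] at h2
        have e1 : ℓ (y - 1) = ℓ y := by
          have := hℓ.periodic (y - 1)
          rw [sub_add_cancel] at this
          exact this.symm
        have e2 : ℓ 0 = ℓ 1 := by
          have := hℓ.periodic 0
          rw [zero_add] at this
          exact this.symm
        rw [e1, e2] at h2
        have := abs_sub_le (ℓ y) (ℓ 1) (ℓ x)
        linarith
  refine ⟨L + M, M, by positivity, hM, fun s t => ?_, hMl, fun t ht => (hLb t ht).trans (by linarith)⟩
  rcases le_total s t with h | h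
  · rw [abs_sub_comm, abs_sub_comm s, abs_of_nonneg (sub_nonneg.2 h)]
    exact key s t h
  · rw [abs_of_nonneg (sub_nonneg.2 h)]
    exact key t s h

theorem IsWallMotion.abs_wallSpeed_le (hℓ : IsWallMotion ℓ) (hg : ContDiff ℝ ∞ g)
    (hE : EqOn ℓ g (Icc 0 1)) {L : ℝ} (hL : ∀ t ∈ Icc (-1 : ℝ) 2, |deriv g t| ≤ L) (t : ℝ) :
    |wallSpeed ℓ t| ≤ L := by
  have h0 := Int.fract_nonneg t
  have h1 := Int.fract_lt_one t
  rw [← hℓ.wallSpeed_fract t, wallSpeed_eq hg hE ⟨h0, h1⟩]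
  exact hL _ ⟨by linarith, by linarith⟩

/-- For v > L the wall cannot catch the ball before it bounces off the fixed wall, and after the
bounce v·r - ℓ(t + r) is strictly increasing in r, so there is just one meeting. -/
theorem flightTime_eq (hpos : ∀ t, 0 < ℓ t) {L : ℝ} (hL : ∀ s t, |ℓ s - ℓ t| ≤ L * |s - t|)
    {t v s : ℝ} (hv : L < v) (hs : 0 < s) (h : v * s = ℓ t + ℓ (t + s)) :
    flightTime ℓ (t, v) = s := by
  have : {s : ℝ | 0 < s ∧ |ℓ t - v * s| = ℓ (t + s)} = {s} := by
    ext r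
    simp only [mem_ofPred_eq, mem_singleton_iff]
    constructor
    · rintro ⟨hr, hr'⟩
      rcases abs_choice (ℓ t - v * r) with h1 | h1
      · rw [h1] at hr'
        have h2 := hL t (t + r)
        rw [← hr', sub_sub_cancel, sub_add_cancel_left, abs_neg, abs_of_pos hr] at h2
        have h3 := le_abs_self (v * r)
        nlinarith
      · rw [h1] at hr'
        have h2 := hL (t + r) (t + s)
        have h3 : ℓ (t + r) - ℓ (t + s) = v * (r - s) := by linarith
        rw [h3, add_sub_add_left_eq_sub, abs_mul] at h2
        have hv' := le_abs_self v
        by_contra hne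
        have h4 : 0 < |r - s| := abs_pos.2 (sub_ne_zero.2 hne)
        nlinarith
    · rintro rfl
      refine ⟨hs, ?_⟩
      rw [h, sub_add_cancel_left, abs_neg, abs_of_pos (hpos _)]
  rw [flightTime]
  simp only [this, csInf_singleton]

theorem collisionMap_eq (hpos : ∀ t, 0 < ℓ t) {L : ℝ} (hL : ∀ s t, |ℓ s - ℓ t| ≤ L * |s - t|)
    {t v s : ℝ} (hv : L < v) (hs : 0 < s) (h : v * s = ℓ t + ℓ (t + s)) :
    collisionMap ℓ (t, v) = (Int.fract (t + s), v - 2 * wallSpeed ℓ (t + s)) := by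
  have h1 := flightTime_eq hpos hL hv hs h
  have h2 := hpos (t + s)
  simp only [collisionMap, h1]
  rw [if_pos (by linarith)]

theorem exists_flight (hpos : ∀ t, 0 < ℓ t) (hc : Continuous ℓ) {M : ℝ} (hM : ∀ t, ℓ t ≤ M)
    {v : ℝ} (hv : 0 < v) (t : ℝ) : ∃ s, 0 < s ∧ v * s = ℓ t + ℓ (t + s) := by
  have hM0 : 0 < M := (hpos 0).trans_le (hM 0)
  have hle : 0 ≤ 2 * M / v := by positivity
  have hcont : ContinuousOn (fun s => v * s - ℓ (t + s)) (Icc 0 (2 * M / v)) := by fun_prop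
  obtain ⟨s, hs, hs'⟩ := intermediate_value_Icc hle hcont (show ℓ t ∈ _ by
    refine ⟨?_, ?_⟩
    · simp only [mul_zero, add_zero]
      linarith [hpos t]
    · have : v * (2 * M / v) = 2 * M := by field_simp
      rw [this]
      linarith [hM t, hM (t + 2 * M / v)])
  refine ⟨s, ?_, by simp only at hs'; linarith⟩
  rcases hs.1.lt_or_eq with h | h
  · exact h
  · exfalso
    rw [← h] at hs'
    simp only [mul_zero, add_zero] at hs'
    linarith [hpos t]

/-- For large velocities, the strip is given by an explicit inequality. -/
theorem IsWallMotion.exists_mem_strip_iff (hℓ : IsWallMotion ℓ) (hg : ContDiff ℝ ∞ g)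
    (hE : EqOn ℓ g (Icc 0 1)) :
    ∃ V, 0 < V ∧ ∀ x : ℝ × ℝ, V < x.2 → (x ∈ strip ℓ ↔
      x.1 ∈ Ico (0 : ℝ) 1 ∧ x.1 * (x.2 + 2 * deriv g x.1) - g x.1 < g 0) := by
  obtain ⟨L, M, hL, hM, hlip, hMb, hgL⟩ := hℓ.exists_lipschitz hg hE
  have hg1 := contDiff_deriv_infty hg
  obtain ⟨D, hD, hDb⟩ := exists_forall_abs_le (contDiff_deriv_infty hg1).continuous (-1) 2
  have m0 : (0 : ℝ) ∈ Ico (0 : ℝ) 1 := ⟨le_rfl, zero_lt_one⟩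
  have hI : ∀ s ∈ Icc (0 : ℝ) 1, s ∈ Icc (-1 : ℝ) 2 := fun s hs =>
    ⟨by linarith [hs.1], by linarith [hs.2]⟩
  have hgM : ∀ s ∈ Icc (0 : ℝ) 1, 0 < g s ∧ g s ≤ M := fun s hs => by
    rw [← hE hs]; exact ⟨hℓ.pos s, hMb s⟩
  have g0 := hgM 0 ⟨le_rfl, zero_le_one⟩
  have g1 := hgM 1 ⟨zero_le_one, le_rfl⟩
  refine ⟨4 * M + 5 * L + 2 * D + 1, by positivity, fun x hx => ?_⟩
  -- At outgoing velocity v the incoming one is v + 2ġ(s), so this function equals g(0) exactly when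
  -- the preceding collision is at time 0. Being increasing, it is below g(0) to the left of f S.
  have hmono : StrictMonoOn (fun s => s * (x.2 + 2 * deriv g s) - g s) (Icc 0 1) := by
    have hd : ∀ s, HasDerivAt (fun s => s * (x.2 + 2 * deriv g s) - g s)
        (1 * (x.2 + 2 * deriv g s) + s * (2 * deriv (deriv g) s) - deriv g s) s := fun s => by
      have h1 := (hg.differentiable (by simp) s).hasDerivAt
      have h2 := (hg1.differentiable (by simp) s).hasDerivAt
      exact ((hasDerivAt_id s).mul ((h2.const_mul 2).const_add x.2)).sub h1
    refine strictMonoOn_of_deriv_pos (convex_Icc 0 1)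
      (fun s _ => (hd s).continuousAt.continuousWithinAt) fun s hs => ?_
    rw [(hd s).deriv]
    rw [interior_Icc] at hs
    have hs' := hI s (Ioo_subset_Icc_self hs)
    have h1 := abs_le.1 (hgL s hs')
    have h2 := abs_le.1 (hDb s hs')
    nlinarith [hs.1, hs.2, h1.1, h2.1]
  have hflight : ∀ s ∈ Ioo (0 : ℝ) 1, s * (x.2 + 2 * deriv g s) - g s = g 0 →
      collisionMap ℓ (0, x.2 + 2 * deriv g s) = (s, x.2) := by
    intro s hs h
    have hs' := hI s (Ioo_subset_Icc_self hs)
    have h1 := abs_le.1 (hgL s hs')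
    have h2 : (x.2 + 2 * deriv g s) * s = ℓ 0 + ℓ (0 + s) := by
      rw [zero_add, hE ⟨le_rfl, zero_le_one⟩, hE (Ioo_subset_Icc_self hs)]
      linarith
    rw [collisionMap_eq hℓ.pos hlip (by linarith) hs.1 h2, zero_add, Int.fract_eq_self.2
      ⟨hs.1.le, hs.2⟩, wallSpeed_eq hg hE (Ioo_subset_Ico_self hs)]
    simp
  constructor
  · rintro ⟨⟨hx1, -⟩, y, ⟨⟨t, w⟩, ⟨⟨-, hw⟩, ht⟩, rfl⟩, hy2, hy1⟩
    simp only at ht hw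
    subst ht
    refine ⟨hx1, ?_⟩
    have hws : ∀ t, |wallSpeed ℓ t| ≤ L := hℓ.abs_wallSpeed_le hg hE hgL
    have h1 := abs_le.1 (hws (0 + flightTime ℓ (0, w)))
    have h2 := abs_le.1 (hws 0)
    have hw' : w = x.2 + 2 * wallSpeed ℓ (0 + flightTime ℓ (0, w)) := by
      simp only [collisionMap] at hy2
      -- If the wall caught the ball from behind, the outgoing velocity -w - 2ℓ̇ would be at most
      -- 3L, too small.
      split_ifs at hy2
      · linarith
      · exfalso; linarith
    have hwL : L < w := by linarith
    have hw0 : 0 < w := by linarith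
    obtain ⟨s, hs, hs'⟩ := exists_flight hℓ.pos (continuous_of_abs_sub_le hlip) hMb hw0 0
    have hs1 : s < 1 := by
      by_contra hc
      have := hMb 0
      have := hMb (0 + s)
      nlinarith
    have hfl := flightTime_eq hℓ.pos hlip hwL hs hs'
    rw [hfl, zero_add, wallSpeed_eq hg hE ⟨hs.le, hs1⟩] at hw'
    rw [collisionMap_eq hℓ.pos hlip hwL hs hs', zero_add] at hy1
    simp only [Int.fract_eq_self.2 ⟨hs.le, hs1⟩] at hy1
    have h3 := hmono ⟨hx1.1, hx1.2.le⟩ ⟨hs.le, hs1.le⟩ hy1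
    rw [zero_add, hE ⟨le_rfl, zero_le_one⟩, hE ⟨hs.le, hs1.le⟩, hw'] at hs'
    simp only at h3
    linarith
  · rintro ⟨hx1, hx2⟩
    have h0 := abs_le.1 (hgL x.1 (hI _ (Ico_subset_Icc_self hx1)))
    refine ⟨⟨hx1, by rw [wallSpeed_eq hg hE hx1]; linarith⟩, ?_⟩
    have h1 := abs_le.1 (hgL 1 (hI 1 ⟨zero_le_one, le_rfl⟩))
    have hcont : ContinuousOn (fun s => s * (x.2 + 2 * deriv g s) - g s) (Icc x.1 1) := by
      have := hg.continuous
      have := hg1.continuous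
      fun_prop
    obtain ⟨s, hs, hs'⟩ := intermediate_value_Ioo hx1.2.le hcont (show g 0 ∈ _ by
      refine ⟨hx2, ?_⟩
      linarith)
    have hs0 : s ∈ Ioo (0 : ℝ) 1 := ⟨hx1.1.trans_lt hs.1, hs.2⟩
    have h2 := abs_le.1 (hgL s (hI _ (Ioo_subset_Icc_self hs0)))
    have h3 := abs_le.1 (hgL 0 (hI 0 ⟨le_rfl, zero_le_one⟩))
    refine ⟨(s, x.2), ⟨(0, x.2 + 2 * deriv g s), ⟨⟨m0, ?_⟩, rfl⟩, hflight s hs0 hs'⟩, rfl, hs.1⟩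
    simp only
    rw [wallSpeed_eq hg hE m0]
    linarith

end Motion

/-! ### Orbits between two passages through the singularity -/

/-- A period of conformal time is J, so moving the origin of time to t = 1 lowers the angle by
exactly the action. This identifies the phase at the crossing with a - I. -/
theorem angleAction_comp_one_add {g : ℝ → ℝ} (hg : Continuous g) (h0 : ∀ t, g t ≠ 0)
    (hJ : conformalTime g 1 ≠ 0) (T v : ℝ) :
    angleAction (fun t => g (1 + t)) (conformalTime g 1) (T, v) =
      ((angleAction g (conformalTime g 1) (1 + T, v)).1 -
        (angleAction g (conformalTime g 1) (1 + T, v)).2,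
        (angleAction g (conformalTime g 1) (1 + T, v)).2) := by
  have hd : deriv (fun t => g (1 + t)) = fun t => deriv g (1 + t) :=
    funext fun t => deriv_comp_const_add g 1 t
  have hd2 : deriv (fun t => deriv g (1 + t)) = fun t => deriv (deriv g) (1 + t) :=
    funext fun t => deriv_comp_const_add (deriv g) 1 t
  have hθ : conformalTime (fun t => g (1 + t)) T = conformalTime g (1 + T) - conformalTime g 1 := by
    have hi := continuous_inv_sq hg h0
    unfold conformalTime
    rw [intervalIntegral.integral_interval_sub_left (hi.intervalIntegrable _ _)
      (hi.intervalIntegrable _ _), intervalIntegral.integral_comp_add_left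
      (fun s => (g s ^ 2)⁻¹) 1, add_zero]
  have hW : ∀ u, wallAction (fun t => g (1 + t)) (conformalTime g 1) T u =
      wallAction g (conformalTime g 1) (1 + T) u := fun u => by
    simp only [wallAction, actionCorrection, hd, hd2]
  simp only [angleAction, hd, hW, hθ]
  refine Prod.ext ?_ rfl
  simp only
  field_simp

section Orbit

variable {ℓ g : ℝ → ℝ}

/-- For large velocities a collision with a smoothly moving wall is a perturbed shift. -/
theorem exists_collision_shift (hg : ContDiff ℝ ∞ g) (hpos : ∀ t, 0 < g t)
    (hJ : 0 < conformalTime g 1) :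
    ∃ e : ℝ × ℝ → ℝ × ℝ, ContDiff ℝ ∞ e ∧ ∃ V, 0 < V ∧ ∀ t v, t ∈ Ico (0 : ℝ) 1 → V < v →
      ∃ δ, 0 < δ ∧ δ < 1 / 2 ∧ v * δ = g t + g (t + δ) ∧ 0 < v - deriv g (t + δ) ∧
        angleAction g (conformalTime g 1) (t + δ, v - 2 * deriv g (t + δ)) =
          shiftMap e (angleAction g (conformalTime g 1) (t, v)) := by
  set J := conformalTime g 1 with hJdef
  obtain ⟨e, he, -, ε, hε, hstep⟩ := exists_step_normal_form hg hpos hJ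
    (show (0 : ℝ) < 1 / 2 by norm_num)
  obtain ⟨V, c, C, hV, hc, -, hb⟩ := exists_action_bounds hg hpos hJ
  refine ⟨e, he, max V (c⁻¹ * ε⁻¹), lt_max_of_lt_left hV, fun t v ht hv => ?_⟩
  rw [max_lt_iff] at hv
  have hmono := strictMono_conformalTime hg.continuous fun t => (hpos t).ne'
  obtain ⟨hu, hr, hI, -⟩ := hb (t, v) ⟨by simp only; linarith [ht.1], by simp only; linarith [ht.2]⟩
    hv.1
  set I := (angleAction g J (t, v)).2 with hIdef
  have ha : (angleAction g J (t, v)).1 = I * (J⁻¹ * conformalTime g t) := rfl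
  have hI1 : ε⁻¹ < I := by
    have := mul_lt_mul_of_pos_left hv.2 hc
    rw [mul_inv_cancel_left₀ hc.ne'] at this
    simp only at hI
    linarith
  have hI0 : 0 < I := (inv_pos.2 hε).trans hI1
  obtain ⟨t', δ, ht', hδ, hδ', hdep, harr, h1, h2⟩ := hstep (angleAction g J (t, v)).1 I hI0
    ((inv_lt_comm₀ hI0 hε).2 hI1) (by
      rw [ha, mul_div_cancel_left₀ _ hI0.ne']
      have h3 : 0 ≤ conformalTime g t := by
        have := hmono.monotone ht.1
        simpa [conformalTime] using this
      have h4 : J⁻¹ * conformalTime g t ≤ J⁻¹ * J :=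
        mul_le_mul_of_nonneg_left (hmono.monotone ht.2.le) (inv_nonneg.2 hJ.le)
      have h5 : 0 ≤ J⁻¹ * conformalTime g t := by positivity
      exact ⟨by linarith, by rw [← hJdef]; linarith⟩)
  -- The normal form yields some collision with the given angle and action; injectivity of the
  -- coordinates identifies it with the given one.
  have heq : (t, v) = (t', (g t' + g (t' + δ)) / δ) := by
    refine angleAction_injective hg hpos hJ hr hu ?_ h1.symm
    have : (g t' + g (t' + δ)) / δ + deriv g t' = departure g (t', δ) / δ := by
      simp only [departure]; field_simp
    simp only [this]
    positivity
  obtain ⟨rfl, hv'⟩ := Prod.mk.inj heq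
  refine ⟨δ, hδ, hδ', by rw [hv']; field_simp, ?_, ?_⟩
  · have : v - deriv g (t + δ) = arrival g (t, δ) / δ := by
      rw [hv']; simp only [arrival]; field_simp
    rw [this]
    positivity
  · rw [← hv'] at h2
    rw [h2]
    rfl

set_option maxHeartbeats 800000 in
theorem IsWallMotion.exists_return (hℓ : IsWallMotion ℓ) (hg : ContDiff ℝ ∞ g)
    (hpos : ∀ t, 0 < g t) (hE : EqOn ℓ g (Icc 0 1)) (hJ : 0 < conformalTime g 1) :
    ∃ e c : ℝ × ℝ → ℝ × ℝ, ContDiff ℝ ∞ e ∧ ContDiff ℝ ∞ c ∧ ∀ V', ∃ V I₀, 0 < V ∧ 0 < I₀ ∧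
      ∀ (x : ℝ × ℝ) (k : ℕ), x.1 ∈ Ico (0 : ℝ) 1 → V < x.2 →
        (∀ i ≤ k + 1, I₀ < ((shiftMap e)^[i] (angleAction g (conformalTime g 1) x)).2) →
        (∀ i ≤ k, slack e i (angleAction g (conformalTime g 1) x) < 0) →
        0 ≤ slack e (k + 1) (angleAction g (conformalTime g 1) x) →
        firstReturnTime (collisionMap ℓ) (strip ℓ) x = k + 1 ∧
        (collisionMap ℓ)^[k + 1] x ∈ strip ℓ ∧ V' < ((collisionMap ℓ)^[k + 1] x).2 ∧
        angleAction g (conformalTime g 1) ((collisionMap ℓ)^[k + 1] x) =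
          crossMap (wallDelta ℓ) (wallDelta₁ ℓ) c
            ((shiftMap e)^[k + 1] (angleAction g (conformalTime g 1) x)) := by
  set J := conformalTime g 1 with hJdef
  obtain ⟨e, he, V₁, hV₁, hshift⟩ := exists_collision_shift hg hpos hJ
  obtain ⟨L, M, hL, hM, hlip, hMb, hgL⟩ := hℓ.exists_lipschitz hg hE
  obtain ⟨M', hM', hgM'⟩ := exists_forall_abs_le hg.continuous (-1) 2
  obtain ⟨V₂, hV₂, hstrip⟩ := hℓ.exists_mem_strip_iff hg hE
  have hmono := strictMono_conformalTime hg.continuous fun t => (hpos t).ne'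
  have g01 : g 1 = g 0 := by
    rw [← hE ⟨zero_le_one, le_rfl⟩, ← hE ⟨le_rfl, zero_le_one⟩, ← hℓ.periodic 0, zero_add]
  obtain ⟨c, hc, -, ε, hε, hcross⟩ := exists_crossing_normal_form (γ := fun t => g (1 + t))
    (γ' := g) (by fun_prop) (fun t => hpos _) hg hpos (by simp [g01]) hJ (B := 2 * M + 2 * M')
  refine ⟨e, c, he, hc, fun V' => ?_⟩
  set V := |V'| + V₁ + V₂ + 2 * M + 2 * L + ε⁻¹ with hVdef
  have hε' : 0 < ε⁻¹ := inv_pos.2 hε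
  have hVp := abs_nonneg V'
  have hVp' := le_abs_self V'
  obtain ⟨I₀, hI₀⟩ := exists_lt_velocity hg hJ V
  refine ⟨V, max I₀ 1, by positivity, by positivity, fun x k hx hxv hI hs hs' => ?_⟩
  have hglip : ∀ s ∈ Icc (-1 : ℝ) 2, ∀ t ∈ Icc (-1 : ℝ) 2, |g s - g t| ≤ L * |s - t| :=
    fun s hs t ht => (convex_Icc (-1 : ℝ) 2).norm_image_sub_le_of_norm_deriv_le
      (fun x _ => hg.differentiable (by simp) x) hgL ht hs
  have hact : ∀ t v, (angleAction g J (t, v)).1 =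
      (angleAction g J (t, v)).2 * (J⁻¹ * conformalTime g t) := fun t v => rfl
  -- As a/I = J⁻¹∫₀ᵗ g⁻² reaches 1 at t = 1, the sign of `slack` tells whether a collision along `g`
  -- happens before the singular time.
  have hlt : ∀ t v, 0 < (angleAction g J (t, v)).2 →
      ((angleAction g J (t, v)).1 < (angleAction g J (t, v)).2 ↔ t < 1) := fun t v h => by
    rw [hact, mul_lt_iff_lt_one_right h, inv_mul_lt_iff₀ hJ, mul_one]
    exact hmono.lt_iff_lt
  have orbit : ∀ j ≤ k, ((collisionMap ℓ)^[j] x).1 ∈ Ico (0 : ℝ) 1 ∧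
      V < ((collisionMap ℓ)^[j] x).2 ∧
      angleAction g J ((collisionMap ℓ)^[j] x) = (shiftMap e)^[j] (angleAction g J x) ∧
      (0 < j → (collisionMap ℓ)^[j] x ∉ strip ℓ) := by
    intro j
    induction j with
    | zero => exact fun _ => ⟨hx, hxv, rfl, fun h => absurd h (lt_irrefl 0)⟩
    | succ j ih =>
      intro hj
      obtain ⟨h1, h2, h3, -⟩ := ih (by omega)
      set t := ((collisionMap ℓ)^[j] x).1 with ht
      set v := ((collisionMap ℓ)^[j] x).2 with hv
      have hxe : (collisionMap ℓ)^[j] x = (t, v) := rfl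
      obtain ⟨δ, hδ, hδ', hfl, hu, hQ⟩ := hshift t v h1 (by linarith)
      rw [hxe] at h3
      rw [h3, ← Function.iterate_succ_apply' (shiftMap e)] at hQ
      have hI1 := hI (j + 1) (by omega)
      have hs1 := hs (j + 1) hj
      rw [slack, ← hQ, sub_neg] at hs1
      rw [← hQ, max_lt_iff] at hI1
      have ht1 : t + δ < 1 := (hlt _ _ (by linarith)).1 hs1
      have hmem : t + δ ∈ Ico (0 : ℝ) 1 := ⟨by linarith [h1.1], ht1⟩
      have hstep : (collisionMap ℓ)^[j + 1] x = (t + δ, v - 2 * deriv g (t + δ)) := by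
        rw [Function.iterate_succ_apply', hxe, collisionMap_eq hℓ.pos hlip (by linarith) hδ
          (by rw [hE ⟨h1.1, h1.2.le⟩, hE ⟨hmem.1, hmem.2.le⟩]; exact hfl),
          Int.fract_eq_self.2 hmem, wallSpeed_eq hg hE hmem]
      have hv' : V < v - 2 * deriv g (t + δ) :=
        hI₀ (t + δ, v - 2 * deriv g (t + δ)) ⟨by simp only; linarith [h1.1], by simp only; linarith⟩
          (by simp only; linarith) hI1.1
      rw [hstep]
      refine ⟨hmem, hv', hQ, fun _ hmem' => ?_⟩
      rw [hstrip _ (by simp only; linarith)] at hmem'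
      have h4 := hmem'.2
      simp only at h4
      -- The preceding collision took place at time t ≥ 0, so the strip function equals vt + g(t),
      -- which is at least g(0) because v > L.
      have h5 := hglip t ⟨by linarith [h1.1], by linarith [h1.2]⟩ 0 ⟨by norm_num, by norm_num⟩
      rw [sub_zero, abs_of_nonneg h1.1] at h5
      have h6 := (abs_le.1 h5).1
      have h7 : L * t ≤ v * t := mul_le_mul_of_nonneg_right (by linarith) h1.1
      linarith
  obtain ⟨h1, h2, h3, -⟩ := orbit k le_rfl
  set t := ((collisionMap ℓ)^[k] x).1 with ht
  set w := ((collisionMap ℓ)^[k] x).2 with hw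
  have hxe : (collisionMap ℓ)^[k] x = (t, w) := rfl
  have hw0 : 0 < w := by linarith
  obtain ⟨δ, hδ, hδ', hfl, hu, hQ⟩ := hshift t w h1 (by linarith)
  rw [hxe] at h3
  rw [h3, ← Function.iterate_succ_apply' (shiftMap e)] at hQ
  have hI1 := hI (k + 1) le_rfl
  rw [slack, ← hQ, sub_nonneg] at hs'
  rw [← hQ, max_lt_iff] at hI1
  have ht1 : 1 ≤ t + δ := by
    by_contra hc
    exact absurd hs' (not_le.2 ((hlt _ _ (by linarith)).2 (not_le.1 hc)))
  obtain ⟨s, hsp, hfl'⟩ := exists_flight hℓ.pos (continuous_of_abs_sub_le hlip) hMb hw0 t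
  have hs1 : s < 1 := by
    by_contra hc
    have := hMb t
    have := hMb (t + s)
    nlinarith
  -- If the real collision came before time 1, it would solve the same equation as the virtual one,
  -- contrary to the uniqueness of the solution for w > L.
  have ht2 : 1 ≤ t + s := by
    by_contra hc
    have h4 := hglip (t + δ) ⟨by linarith [h1.1], by linarith [h1.2]⟩ (t + s)
      ⟨by linarith [h1.1], by linarith⟩
    rw [hE ⟨h1.1, h1.2.le⟩, hE ⟨by linarith [h1.1], by linarith⟩] at hfl'
    have h5 : 0 < δ - s := by linarith
    rw [add_sub_add_left_eq_sub, abs_of_pos h5] at h4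
    have h6 := (abs_le.1 h4).2
    have h7 : L * (δ - s) < w * (δ - s) := mul_lt_mul_of_pos_right (by linarith) h5
    linarith
  have hT' : t + s - 1 ∈ Ico (0 : ℝ) 1 := ⟨by linarith, by linarith [h1.2]⟩
  have hfr : Int.fract (t + s) = t + s - 1 := by
    rw [← Int.fract_sub_one, Int.fract_eq_self.2 hT']
  have hgT' : ℓ (t + s) = g (t + s - 1) := by
    rw [← hℓ.fract, hfr, hE ⟨hT'.1, hT'.2.le⟩]
  have hws : wallSpeed ℓ (t + s) = deriv g (t + s - 1) := by
    rw [← hℓ.wallSpeed_fract, hfr, wallSpeed_eq hg hE hT']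
  have hy : (collisionMap ℓ)^[k + 1] x = (t + s - 1, w - 2 * deriv g (t + s - 1)) := by
    rw [Function.iterate_succ_apply', hxe, collisionMap_eq hℓ.pos hlip (by linarith) hsp hfl',
      hfr, hws]
  have hLT := abs_le.1 (hgL (t + s - 1) ⟨by linarith [hT'.1], by linarith [hT'.2]⟩)
  rw [hgT', hE ⟨h1.1, h1.2.le⟩] at hfl'
  have hymem : (collisionMap ℓ)^[k + 1] x ∈ strip ℓ := by
    rw [hy, hstrip _ (by simp only; linarith)]
    refine ⟨hT', ?_⟩
    have h5 := hglip t ⟨by linarith [h1.1], by linarith [h1.2]⟩ 1 ⟨by norm_num, by norm_num⟩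
    rw [abs_sub_comm t, abs_of_nonneg (by linarith [h1.2] : 0 ≤ 1 - t), g01] at h5
    have h6 := (abs_le.1 h5).2
    have h7 : L * (1 - t) < w * (1 - t) := mul_lt_mul_of_pos_right (by linarith) (by linarith [h1.2])
    simp only
    linarith
  have hb1 : g t ≤ M' := (le_abs_self _).trans (hgM' t ⟨by linarith [h1.1], by linarith [h1.2]⟩)
  have hb2 : g (t + δ) ≤ M' :=
    (le_abs_self _).trans (hgM' _ ⟨by linarith [h1.1], by linarith [h1.2]⟩)
  have hb3 : g (t + s - 1) ≤ M' :=
    (le_abs_self _).trans (hgM' _ ⟨by linarith [hT'.1], by linarith [hT'.2]⟩)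
  have hwt : w * t ≤ w := by nlinarith [h1.2]
  -- With time counted from 1, the virtual collision under g(1 + ·) and the real one under the next
  -- period of the wall share the incoming velocity w, and both satisfy wT - γ(T) = w(t - 1) + g(t).
  obtain ⟨σ, I, hI0, hσ, hyQ⟩ := hcross w (t + δ - 1) (t + s - 1) hw0
    ((inv_lt_comm₀ hw0 hε).2 (by linarith))
    ⟨mul_nonneg hw0.le (by linarith), by linarith⟩
    ⟨mul_nonneg hw0.le (by linarith), by linarith⟩
    (by
      have : 1 + (t + δ - 1) = t + δ := by ring
      rw [this]; linarith)
  have hd : deriv (fun t => g (1 + t)) = fun t => deriv g (1 + t) :=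
    funext fun t => deriv_comp_const_add g 1 t
  rw [angleAction_comp_one_add hg.continuous (fun t => (hpos t).ne') hJ.ne', hd] at hσ
  simp only [add_sub_cancel, Prod.mk.injEq] at hσ
  rw [hQ] at hσ
  refine ⟨?_, hymem, by rw [hy]; simp only; linarith, ?_⟩
  · have hmem : k + 1 ∈ {n : ℕ | 0 < n ∧ (collisionMap ℓ)^[n] x ∈ strip ℓ} :=
      ⟨by omega, hymem⟩
    refine le_antisymm (Nat.sInf_le hmem) (le_csInf ⟨_, hmem⟩ fun n hn => ?_)
    by_contra hc
    exact (orbit n (by omega)).2.2.2 hn.1 hn.2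
  · have hΔ : wallDelta ℓ = J * (fun t => g (1 + t)) 0 *
        (deriv g 0 - deriv (fun t => g (1 + t)) 0) := by
      rw [wallDelta, wallJ_eq hE, derivPlus_eq hg hE, derivMinus_eq hℓ hg hE, iteratedDeriv_one,
        iteratedDeriv_one, hE ⟨le_rfl, zero_le_one⟩]
      simp only [add_zero, g01, hJdef]
    have hΔ₁ : wallDelta₁ ℓ = 1 / 2 * J ^ 2 * (fun t => g (1 + t)) 0 ^ 3 *
        (deriv (deriv g) 0 - deriv (deriv (fun t => g (1 + t))) 0) := by
      rw [wallDelta₁, wallJ_eq hE, derivPlus_eq hg hE, derivMinus_eq hℓ hg hE,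
        iteratedDeriv_succ (n := 1), iteratedDeriv_succ (n := 1), iteratedDeriv_one,
        iteratedDeriv_one, hE ⟨le_rfl, zero_le_one⟩]
      simp only [add_zero, g01, hJdef]
    rw [hy, hyQ, crossMap, crossMain, hΔ, hΔ₁, hσ.1, hσ.2]
end Orbit

/-! ### The coordinates on the strip -/

/-- The angle of a collision in the strip lies in `[0, 2)`. -/
theorem exists_angle_lt_two {g : ℝ → ℝ} (hg : ContDiff ℝ ∞ g) (hpos : ∀ t, 0 < g t) {J : ℝ}
    (hJ : 0 < J) :
    ∃ V, 0 < V ∧ ∀ x : ℝ × ℝ, V < x.2 → x.1 ∈ Ico (0 : ℝ) 1 →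
      x.1 * (x.2 + 2 * deriv g x.1) - g x.1 < g 0 → (angleAction g J x).1 < 2 := by
  obtain ⟨O, _, _, S, _, hO, hO0, -, -, hS, -, -, -, hexp⟩ := exists_collision_expansion hg hpos hJ
  obtain ⟨M, hM, hMb⟩ := exists_forall_abs_le hg.continuous 0 1
  obtain ⟨L, hL, hLb⟩ := exists_forall_abs_le (contDiff_deriv_infty hg).continuous 0 1
  have hev : ∀ᶠ y in 𝓝ˢ (Icc (0 : ℝ) (2 * M) ×ˢ {(0 : ℝ)}), y ∈ O ∧ y.2 ^ 2 * S y < 1 := by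
    rw [eventually_nhdsSet_iff_forall]
    rintro ⟨t, y⟩ ⟨-, hy⟩
    simp only [mem_singleton_iff] at hy
    subst hy
    have hmem := hO.mem_nhds (hO0 t)
    have hc : ContinuousAt (fun y : ℝ × ℝ => y.2 ^ 2 * S y) (t, 0) :=
      (by fun_prop : ContinuousAt (fun y : ℝ × ℝ => y.2 ^ 2) (t, 0)).mul
        (hS.contDiffAt hmem).continuousAt
    exact (show ∀ᶠ y in 𝓝 (t, (0 : ℝ)), y ∈ O from hmem).and
      (hc.eventually (gt_mem_nhds (by simp)))
  obtain ⟨ε, hε, hb⟩ := exists_pos_of_eventually_nhdsSet (by positivity) hev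
  have hε' : 0 < ε⁻¹ := inv_pos.2 hε
  refine ⟨ε⁻¹ + 2 * L, by positivity, fun x hx hx1 hx2 => ?_⟩
  obtain ⟨t, v⟩ := x
  simp only at hx hx1 hx2
  have h1 := abs_le.1 (hLb t (Ico_subset_Icc_self hx1))
  have h2 := (le_abs_self _).trans (hMb t (Ico_subset_Icc_self hx1))
  have h3 := (le_abs_self _).trans (hMb 0 ⟨le_rfl, zero_le_one⟩)
  set w := v + 2 * deriv g t with hw
  have hw0 : ε⁻¹ < w := by linarith
  have hwp : 0 < w := hε'.trans hw0
  have hwt : 0 ≤ w * t := mul_nonneg hwp.le hx1.1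
  obtain ⟨k1, k2⟩ := hb (w * t) w⁻¹ ⟨by linarith, by linarith⟩
    (by rw [abs_of_pos (inv_pos.2 hwp)]; exact (inv_lt_comm₀ hwp hε).2 hw0)
  have h4 := (hexp w t hwp k1).1
  have e1 : w - 2 * deriv g t = v := by rw [hw]; ring
  rw [e1] at h4
  rw [h4]
  -- The strip inequality says precisely that the phase is below 1; the O(w⁻²) difference between
  -- angle and phase is made less than 1. The bound 2 is the width of the window in which the curves
  -- are straightened.
  have e2 : impactPhase g (w * t, w⁻¹) < 1 := by
    simp only [impactPhase, inv_mul_cancel_left₀ hwp.ne']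
    rw [div_lt_one (by linarith [hpos 0])]
    linarith
  simp only at k2 ⊢
  linarith

theorem angle_nonneg_iff {g : ℝ → ℝ} (hg : Continuous g) (h0 : ∀ t, g t ≠ 0) {J : ℝ} (hJ : 0 < J)
    {x : ℝ × ℝ} (hx : 0 < (angleAction g J x).2) : 0 ≤ (angleAction g J x).1 ↔ 0 ≤ x.1 := by
  have h1 : (angleAction g J x).1 = (angleAction g J x).2 * (J⁻¹ * conformalTime g x.1) := rfl
  have h2 : conformalTime g 0 = 0 := by simp [conformalTime]
  rw [h1, mul_nonneg_iff_of_pos_left hx, mul_nonneg_iff_of_pos_left (inv_pos.2 hJ)]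
  nth_rewrite 1 [← h2]
  exact (strictMono_conformalTime hg h0).le_iff_le

theorem uniqueDiffOn_halfPlane : UniqueDiffOn ℝ {x : ℝ × ℝ | 0 ≤ x.1} := by
  refine uniqueDiffOn_convex (convex_halfSpace_ge (f := fun x : ℝ × ℝ => x.1)
    ⟨fun _ _ => rfl, fun _ _ => rfl⟩ 0) ⟨(1, 0), ?_⟩
  rw [mem_interior]
  exact ⟨{x : ℝ × ℝ | 0 < x.1}, fun x (hx : 0 < x.1) => hx.le, isOpen_lt continuous_const continuous_fst,
    show (0 : ℝ) < 1 from zero_lt_one⟩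

/-- The strip and the pieces contain part of their boundary. Each piece is relatively open in such a
wedge, so derivatives within it are the ordinary ones of a smooth extension. -/
theorem uniqueDiffOn_wedge (n : ℝ) : UniqueDiffOn ℝ {x : ℝ × ℝ | 0 ≤ x.1 ∧ n ≤ x.1 - x.2} := by
  refine uniqueDiffOn_convex ((convex_halfSpace_ge (f := fun x : ℝ × ℝ => x.1)
    ⟨fun _ _ => rfl, fun _ _ => rfl⟩ 0).inter (convex_halfSpace_ge (f := fun x : ℝ × ℝ => x.1 - x.2)
      (ContinuousLinearMap.fst ℝ ℝ ℝ - ContinuousLinearMap.snd ℝ ℝ ℝ).toLinearMap.isLinear n))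
      ⟨(1, -n), ?_⟩
  rw [mem_interior]
  refine ⟨{x : ℝ × ℝ | 0 < x.1} ∩ {x : ℝ × ℝ | n < x.1 - x.2},
    fun x (hx : 0 < x.1 ∧ n < x.1 - x.2) => ⟨hx.1.le, hx.2.le⟩,
    (isOpen_lt continuous_const continuous_fst).inter (isOpen_lt continuous_const (by fun_prop)),
    show (0 : ℝ) < 1 from zero_lt_one, ?_⟩
  change n < 1 - -n
  linarith

/-! ### The main theorem -/

theorem theorem1 (ℓ : ℝ → ℝ) (hℓ : IsWallMotion ℓ) :
    ∃ (v₀ v₁ c C : ℝ) (Φ : PartialEquiv (ℝ × ℝ) (ℝ × ℝ)),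
      0 < v₀ ∧ v₀ ≤ v₁ ∧ 0 < c ∧
      -- `Φ = (τ, I)` are smooth coordinates on the part `v > v₀` of the strip
      Φ.source = {x ∈ strip ℓ | v₀ < x.2} ∧
      ContDiffOn ℝ ∞ Φ Φ.source ∧
      ContDiffOn ℝ ∞ Φ.symm Φ.target ∧
      -- `I` is of the order of `v`
      (∀ x ∈ Φ.source, c * x.2 ≤ (Φ x).2 ∧ (Φ x).2 ≤ C * x.2) ∧
      -- `(v + ℓ̇) dt ∧ dv = (4 / 𝒥) dτ ∧ dI`
      (∀ x ∈ Φ.source,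
        x.2 + wallSpeed ℓ x.1 = 4 / wallJ ℓ * (fderivWithin ℝ Φ Φ.source x).det) ∧
      -- the first return map is defined for large `v`, with values in the coordinate domain
      (∀ x ∈ Φ.source, v₁ < x.2 →
        (∃ n : ℕ, 0 < n ∧ (collisionMap ℓ)^[n] x ∈ strip ℓ) ∧
        firstReturn (collisionMap ℓ) (strip ℓ) x ∈ Φ.source) ∧
      -- `F = F̂ + F₁ + r` with `r = O(I⁻²)` together with its derivatives up to order `5`
      (∀ n : ℤ, ContDiffOn ℝ 5 (remainder ℓ Φ) (piece Φ v₁ n) ∧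
        ∀ k : ℕ, k ≤ 5 → ∀ p ∈ piece Φ v₁ n,
          ‖iteratedFDerivWithin ℝ k (remainder ℓ Φ) (piece Φ v₁ n) p‖ ≤ C / p.2 ^ 2) := by
  obtain ⟨g, hg, hpos, hE⟩ := hℓ.exists_extension
  have h0 : ∀ t, g t ≠ 0 := fun t => (hpos t).ne'
  have hJ : 0 < conformalTime g 1 := by
    have := strictMono_conformalTime hg.continuous h0 zero_lt_one
    simpa [conformalTime] using this
  rw [wallJ_eq hE]
  set J := conformalTime g 1 with hJdef
  obtain ⟨e, b, he, hb, hreturn⟩ := hℓ.exists_return hg hpos hE hJ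
  obtain ⟨R, hR, hRs, hR1, hRdet, hRsign, ⟨C₁, hC₁, hRid⟩, hRslack⟩ :=
    exists_straightening 5 (by norm_num) he
  obtain ⟨C₂, hC₂, hrem⟩ := jetO_return_sub 5 he hb (wallDelta ℓ) (wallDelta₁ ℓ) hC₁ hRid
  obtain ⟨C₃, hC₃, hit⟩ := exists_iterate_shiftMap_bound 5 he 8
  obtain ⟨Va, c₁, c₂, hVa, hc₁, hc₂, hact⟩ := exists_action_bounds hg hpos hJ
  obtain ⟨Vb, hVb, hstrip⟩ := hℓ.exists_mem_strip_iff hg hE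
  obtain ⟨Vc, hVc, hangle⟩ := exists_angle_lt_two hg hpos hJ
  have hsmall : ∀ᶠ m : ℕ in atTop, 2 * C₃ / (m : ℝ) ^ 2 ≤ 1 / 4 := by
    have : Tendsto (fun m : ℕ => 2 * C₃ / (m : ℝ) ^ 2) atTop (𝓝 0) :=
      tendsto_const_nhds.div_atTop ((tendsto_pow_atTop two_ne_zero).comp tendsto_natCast_atTop_atTop)
    exact this.eventually (ge_mem_nhds (by norm_num))
  obtain ⟨M, hM⟩ := eventually_atTop.1
    (hRslack.and (hrem.and (hit.and (hsmall.and (eventually_ge_atTop 1)))))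
  set v₀ := Va + Vb + Vc + 1 + 2 / c₁ with hv₀
  have hq : 0 < 2 / c₁ := by positivity
  obtain ⟨Vd, I₀, hVd, hI₀, hret⟩ := hreturn v₀
  set v₁ := v₀ + Vd + (M + I₀ + 20) / c₁ with hv₁
  have hq' : 0 < (M + I₀ + 20) / c₁ := by positivity
  -- An open domain that extends beyond the boundary t = 0 of the strip; the chart is built on it
  -- and then restricted, so it is smooth up to the boundary.
  set D : Set (ℝ × ℝ) := {x | x.1 ∈ Ioo (-1 : ℝ) 2 ∧ v₀ < x.2} with hD
  have hDo : IsOpen D := (isOpen_Ioo.preimage continuous_fst).inter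
    (isOpen_lt continuous_const continuous_snd)
  have hDact : ∀ x ∈ D, _ := fun x (hx : x ∈ D) =>
    hact x ⟨hx.1.1.le, hx.1.2.le⟩ (by linarith [hx.2])
  have hQsm : ∀ x ∈ D, ContDiffAt ℝ ∞ (angleAction g J) x := fun x hx =>
    contDiffAt_angleAction hg hpos (hDact x hx).2.1
  set f : ℝ × ℝ → ℝ × ℝ := fun x => R (angleAction g J x) with hf
  have hfsm : ∀ x ∈ D, ContDiffAt ℝ ∞ f x := fun x hx => hR.contDiffAt.comp x (hQsm x hx)
  have hfdet : ∀ x ∈ D, (fderiv ℝ f x).det = J / 4 * (x.2 + deriv g x.1) := by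
    intro x hx
    have h1 : HasFDerivAt f _ x :=
      (hR.differentiable (by simp) (angleAction g J x)).hasFDerivAt.comp x
        ((hQsm x hx).differentiableAt (by simp)).hasFDerivAt
    rw [h1.fderiv, ← det_fderiv_angleAction hg hpos hJ (hDact x hx).2.1]
    have := hRdet (angleAction g J x)
    simp only [ContinuousLinearMap.det] at this ⊢
    rw [ContinuousLinearMap.toLinearMap_comp, LinearMap.det_comp, this, one_mul]
  obtain ⟨Ψ, hΨs, hΨ, hΨsm⟩ := exists_openPartialHomeomorph_of_injOn hDo
    (fun x hx => (hfsm x hx).contDiffWithinAt)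
    (fun x hx y hy hxy => angleAction_injective hg hpos hJ (hDact x hx).2.1 (hDact x hx).1
      (hDact y hy).1 (R.injective hxy))
    (fun x hx => by rw [hfdet x hx]; exact (mul_pos (by positivity) (hDact x hx).1).ne')
  have hΨf : (Ψ : ℝ × ℝ → ℝ × ℝ) = f := funext hΨ
  have hmemiff : ∀ x : ℝ × ℝ, v₀ < x.2 → (x ∈ strip ℓ ↔ x.1 ∈ Ico (0 : ℝ) 1 ∧
      x.1 * (x.2 + 2 * deriv g x.1) - g x.1 < g 0) := fun x hx => hstrip x (by linarith)
  have hstripD : ∀ x : ℝ × ℝ, v₀ < x.2 → x ∈ strip ℓ → x ∈ D := fun x hx hs => by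
    have h1 := ((hmemiff x hx).1 hs).1
    exact ⟨⟨by linarith [h1.1], by linarith [h1.2]⟩, hx⟩
  set Φ : PartialEquiv (ℝ × ℝ) (ℝ × ℝ) := Ψ.toPartialEquiv.restr (strip ℓ) with hΦ
  have hΦf : (Φ : ℝ × ℝ → ℝ × ℝ) = f := hΨf
  have hΦsymm : (Φ.symm : ℝ × ℝ → ℝ × ℝ) = Ψ.symm := rfl
  have hsource : Φ.source = {x ∈ strip ℓ | v₀ < x.2} := by
    ext x
    change x ∈ Ψ.source ∩ strip ℓ ↔ x ∈ strip ℓ ∧ v₀ < x.2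
    rw [hΨs]
    exact ⟨fun h => ⟨h.2, h.1.2⟩, fun h => ⟨hstripD x h.2 h.1, h.1⟩⟩
  have hsourceD : ∀ x ∈ Φ.source, x ∈ D := fun x hx => by
    rw [hsource] at hx
    exact hstripD x hx.2 hx.1
  have htarget : ∀ p, p ∈ Φ.target ↔ p ∈ Ψ.target ∧ Ψ.symm p ∈ strip ℓ := fun p => Iff.rfl
  have hHcont : Continuous fun x : ℝ × ℝ => x.1 * (x.2 + 2 * deriv g x.1) - g x.1 := by
    have := hg.continuous
    have := (contDiff_deriv_infty hg).continuous
    fun_prop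
  have hHopen : ∀ v, IsOpen {x : ℝ × ℝ | x.1 < 1 ∧ v < x.2 ∧
      x.1 * (x.2 + 2 * deriv g x.1) - g x.1 < g 0} := fun v =>
    (isOpen_lt continuous_fst continuous_const).inter ((isOpen_lt continuous_const
      continuous_snd).inter (isOpen_lt hHcont continuous_const))
  have hud : UniqueDiffOn ℝ Φ.source := by
    have : Φ.source = {x : ℝ × ℝ | 0 ≤ x.1} ∩ {x : ℝ × ℝ | x.1 < 1 ∧ v₀ < x.2 ∧
      x.1 * (x.2 + 2 * deriv g x.1) - g x.1 < g 0} := by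
      rw [hsource]
      ext x
      constructor
      · rintro ⟨h1, h2⟩
        have h3 := (hmemiff x h2).1 h1
        exact ⟨h3.1.1, h3.1.2, h2, h3.2⟩
      · rintro ⟨h1, h2, h3, h4⟩
        exact ⟨(hmemiff x h3).2 ⟨⟨h1, h2⟩, h4⟩, h3⟩
    rw [this]
    exact uniqueDiffOn_halfPlane.inter (hHopen v₀)
  have hRp : ∀ q : ℝ × ℝ, |(R q).1 - q.1| ≤ 1 ∧ |(R q).2 - q.2| ≤ 1 := fun q => by
    have := hR1 q
    rw [Prod.norm_def, max_le_iff] at this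
    exact this
  -- the first return
  have hmain : ∀ x ∈ Φ.source, v₁ < x.2 → ∃ m : ℕ, M ≤ m ∧ ⌊(f x).1 - (f x).2⌋ = -(m : ℤ) ∧
      |(f x).1| < 3 ∧ 0 < (f x).2 ∧ (f x).2 ≤ 7 * m ∧
      firstReturnTime (collisionMap ℓ) (strip ℓ) x = m ∧ 0 < m ∧
      (collisionMap ℓ)^[m] x ∈ Φ.source ∧
      f ((collisionMap ℓ)^[m] x) = R (crossMap (wallDelta ℓ) (wallDelta₁ ℓ) b
        ((shiftMap e)^[m] (angleAction g J x))) := by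
    intro x hx hxv
    have hxD := hsourceD x hx
    rw [hsource] at hx
    obtain ⟨hx1, hx2⟩ := (hmemiff x hx.2).1 hx.1
    obtain ⟨-, -, hIlo, -⟩ := hDact x hxD
    have hI : M + I₀ + 20 < (angleAction g J x).2 := by
      have h1 : (M + I₀ + 20) / c₁ < x.2 := by linarith [hx.2]
      rw [div_lt_iff₀ hc₁] at h1
      linarith
    have hM0 : (0 : ℝ) ≤ M := Nat.cast_nonneg M
    have ha0 := (angle_nonneg_iff hg.continuous h0 hJ (x := x) (by linarith)).2 hx1.1
    have ha2 := hangle x (by linarith [hx.2]) hx1 hx2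
    set q := angleAction g J x with hqdef
    obtain ⟨r1, r2⟩ := hRp q
    have hfx : f x = R q := rfl
    rw [abs_le] at r1 r2
    rw [hfx]
    set σ := (R q).1 - (R q).2 with hσ
    have hσ1 : σ < -(M : ℝ) - 1 := by linarith [r1.2, r2.1]
    have hfl : ⌊σ⌋ < 0 := by
      rw [Int.floor_lt]
      push_cast
      linarith
    -- In straightened coordinates -m ≤ τ - I < -m + 1 says that `slack` is nonnegative at m and
    -- negative at m - 1, so m is the return time.
    obtain ⟨m, hm⟩ : ∃ m : ℕ, ⌊σ⌋ = -(m : ℤ) := ⟨(-⌊σ⌋).toNat, by omega⟩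
    have hm1 : -(m : ℝ) ≤ σ := by
      have := Int.floor_le σ
      rw [hm] at this
      push_cast at this
      exact this
    have hm2 : σ < -(m : ℝ) + 1 := by
      have := Int.lt_floor_add_one σ
      rw [hm] at this
      push_cast at this
      exact this
    have hMm : M + 1 ≤ m := by
      have : (M : ℝ) + 1 < m := by linarith
      exact_mod_cast this.le
    obtain ⟨k, rfl⟩ : ∃ k, m = k + 1 := ⟨m - 1, by omega⟩
    obtain ⟨s1, -, i1, n1, -⟩ := hM (k + 1) (by omega)
    obtain ⟨s2, -⟩ := hM k (by omega)
    push_cast at hm1 hm2 s1 n1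
    have hk0 : (0 : ℝ) ≤ k := Nat.cast_nonneg k
    have hq1 : |q.1| < 2 := abs_lt.2 ⟨by linarith, ha2⟩
    have hq2 : |q.2 - (k + 1)| < 5 :=
      abs_lt.2 ⟨by linarith [r1.1, r1.2, r2.1, r2.2], by linarith [r1.1, r1.2, r2.1, r2.2]⟩
    have hq2' := abs_lt.1 hq2
    have hs1 : 0 ≤ slack e (k + 1) q := (s1 q hq1 (by linarith)).2 (by linarith)
    have hs2 : slack e k q < 0 := by
      by_contra hc
      have := (s2 q hq1 (abs_lt.2 ⟨by linarith, by linarith⟩)).1 (not_lt.1 hc)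
      linarith
    have hiter : ∀ i ≤ k + 1, |((shiftMap e)^[i] q).1 - (q.1 + i)| ≤ 1 / 4 ∧
        |((shiftMap e)^[i] q).2 - q.2| ≤ 1 / 4 := by
      intro i hi
      have h1 := (i1 i (by omega) q (by linarith) (by push_cast; linarith)).2.norm_le
      have h2 : C₃ * i / ((k + 1 : ℕ) : ℝ) ^ 3 ≤ 1 / 4 := by
        have h3 : (i : ℝ) ≤ k + 1 := by exact_mod_cast hi
        refine le_trans ?_ n1
        push_cast
        calc C₃ * i / ((k : ℝ) + 1) ^ 3 ≤ C₃ * (k + 1) / ((k : ℝ) + 1) ^ 3 := by gcongr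
          _ = C₃ / ((k : ℝ) + 1) ^ 2 := by field_simp
          _ ≤ 2 * C₃ / ((k : ℝ) + 1) ^ 2 := by gcongr; linarith
      have h3 := h1.trans h2
      rw [Prod.norm_def, max_le_iff] at h3
      exact h3
    obtain ⟨t1, t2, t3, t4⟩ := hret x k hx1 (by linarith)
      (fun i hi => by
        have := (abs_le.1 (hiter i hi).2).1
        rw [← hqdef]
        linarith)
      (fun i hi => by
        rw [← hqdef]
        -- For earlier indices: `slack` grows by 1 per step up to a total error of 4·(1/4) = 1, so
        -- its negativity at k propagates to all i < k.
        rcases hi.lt_or_eq with h | rfl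
        · have h1 := hiter i (by omega)
          have h2 := hiter k (by omega)
          rw [abs_le, abs_le] at h1 h2
          have h3 : (i : ℝ) + 1 ≤ k := by exact_mod_cast h
          simp only [slack] at hs2 ⊢
          linarith [h1.1.2, h1.2.1, h2.1.1, h2.2.2]
        · exact hs2) hs1
    refine ⟨k + 1, by omega, hm, abs_lt.2 ⟨by linarith, by linarith⟩, by linarith, ?_, t1, by omega,
      ?_, ?_⟩
    · push_cast
      linarith
    · rw [hsource]; exact ⟨t2, t3⟩
    · change R (angleAction g J ((collisionMap ℓ)^[k + 1] x)) = _
      rw [t4]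
  have hreturn' : ∀ x ∈ Φ.source, v₁ < x.2 →
      (∃ n : ℕ, 0 < n ∧ (collisionMap ℓ)^[n] x ∈ strip ℓ) ∧
      firstReturn (collisionMap ℓ) (strip ℓ) x ∈ Φ.source := by
    intro x hx hxv
    obtain ⟨m, -, -, -, -, -, h1, h2, h3, -⟩ := hmain x hx hxv
    rw [firstReturn, h1]
    refine ⟨⟨m, h2, ?_⟩, h3⟩
    rw [hsource] at h3
    exact h3.1
  -- the remainder
  set ρ : ℕ → ℝ × ℝ → ℝ × ℝ := fun m p =>
    R (crossMap (wallDelta ℓ) (wallDelta₁ ℓ) b ((shiftMap e)^[m] (R.symm p))) -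
      crossMain (wallDelta ℓ) (wallDelta₁ ℓ) (p.1 + m, p.2) with hρ
  have hpiece : ∀ n : ℤ, ∀ p ∈ piece Φ v₁ n, remainder ℓ Φ p = ρ (-n).toNat p ∧
      JetBound 5 (ρ (-n).toNat) p (49 * C₂ / p.2 ^ 2) := by
    rintro n p ⟨hp1, hp2, hp3⟩
    have hx := Φ.map_target hp1
    obtain ⟨m, k1, k2, k3, k4, k5, k6, k7, -, k9⟩ := hmain _ hx hp2
    have hfp : f (Φ.symm p) = p := by
      have := Φ.right_inv hp1
      rwa [hΦf] at this
    rw [hfp] at k2 k3 k4 k5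
    have hn : n = -(m : ℤ) := by rw [← hp3, k2]
    have hnm : (-n).toNat = m := by omega
    rw [hnm]
    have hfr : Int.fract (p.1 - p.2) = p.1 - p.2 + m := by
      rw [Int.fract, k2]; push_cast; ring
    have hRsymm : R.symm p = angleAction g J (Φ.symm p) := by
      rw [Homeomorph.symm_apply_eq]; exact hfp.symm
    constructor
    · rw [remainder, firstReturn, k6, hΦf, k9]
      simp only [hρ, hRsymm]
      congr 1
      simp only [normalForm, normalFormCorrection, crossMain, hfr]
      refine Prod.ext ?_ ?_
      · simp; ring
      · simp only [Prod.snd_add, Prod.smul_mk, smul_eq_mul]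
        ring
    · have hmem : |p.1 - p.2 + m| < 3 := by
        rw [← hfr]
        have := Int.fract_nonneg (p.1 - p.2)
        have := Int.fract_lt_one (p.1 - p.2)
        exact abs_lt.2 ⟨by linarith, by linarith⟩
      -- Bounds in m become bounds in I through I ≤ 7m, whence 49 = 7².
      refine ((hM m k1).2.1 p ⟨k3, hmem⟩).mono ?_
      have hm0 : (0 : ℝ) < m := by exact_mod_cast k7
      rw [div_le_div_iff₀ (by positivity) (by positivity)]
      have : p.2 ^ 2 ≤ (7 * m) ^ 2 := pow_le_pow_left₀ k4.le k5 2
      nlinarith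
  have hudp : ∀ n : ℤ, UniqueDiffOn ℝ (piece Φ v₁ n) := by
    intro n
    have hO := (Ψ.isOpen_inter_preimage_symm (hHopen v₁)).inter
      (isOpen_lt (f := fun p : ℝ × ℝ => p.1 - p.2) (g := fun _ => (n : ℝ) + 1) (by fun_prop)
        continuous_const)
    have heq : piece Φ v₁ n = {p : ℝ × ℝ | 0 ≤ p.1 ∧ (n : ℝ) ≤ p.1 - p.2} ∩
        (Ψ.target ∩ Ψ.symm ⁻¹' {x : ℝ × ℝ | x.1 < 1 ∧ v₁ < x.2 ∧
          x.1 * (x.2 + 2 * deriv g x.1) - g x.1 < g 0} ∩ {p | p.1 - p.2 < (n : ℝ) + 1}) := by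
      ext p
      -- R and `angleAction` preserve the sign of the first coordinate, so the edge t ≥ 0 of the
      -- strip becomes the exact half-plane τ ≥ 0.
      have hsign : p ∈ Ψ.target → (0 ≤ (Ψ.symm p).1 ↔ 0 ≤ p.1) := by
        intro hp
        have h1 : Ψ.symm p ∈ D := by rw [← hΨs]; exact Ψ.map_target hp
        have h2 : f (Ψ.symm p) = p := by rw [← hΨ]; exact Ψ.right_inv hp
        have h3 := (hDact _ h1).2.2.1
        have h4 : 0 < (Ψ.symm p).2 := by linarith [h1.2]
        rw [← angle_nonneg_iff hg.continuous h0 hJ (x := Ψ.symm p)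
          (lt_of_lt_of_le (by positivity) h3), ← hRsign]
        change 0 ≤ (f (Ψ.symm p)).1 ↔ _
        rw [h2]
      constructor
      · rintro ⟨h1, h2, h3⟩
        rw [htarget] at h1
        rw [hΦsymm] at h2
        rw [Int.floor_eq_iff] at h3
        obtain ⟨h4, h5⟩ := (hmemiff _ (by linarith)).1 h1.2
        exact ⟨⟨(hsign h1.1).1 h4.1, h3.1⟩, ⟨h1.1, h4.2, h2, h5⟩, h3.2⟩
      · rintro ⟨⟨h1, h2⟩, ⟨h3, h4, h5, h6⟩, h7⟩
        exact ⟨(htarget p).2 ⟨h3, (hmemiff _ (by linarith)).2 ⟨⟨(hsign h3).2 h1, h4⟩, h6⟩⟩, h5,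
          Int.floor_eq_iff.2 ⟨h2, h7⟩⟩
    rw [heq]
    exact (uniqueDiffOn_wedge n).inter hO
  refine ⟨v₀, v₁, c₁ / 2, max (c₂ + 1) (49 * C₂), Φ, by positivity, by linarith, by positivity,
    hsource, fun x hx => ?_, fun p hp => ?_, fun x hx => ?_, fun x hx => ?_, hreturn', fun n =>
    ⟨fun p hp => ?_, fun k hk p hp => ?_⟩⟩
  · rw [hΦf]
    exact (hfsm x (hsourceD x hx)).contDiffWithinAt
  · exact (hΨsm.contDiffAt (Ψ.open_target.mem_nhds ((htarget p).1 hp).1)).contDiffWithinAt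
  · have hxD := hsourceD x hx
    obtain ⟨-, -, h1, h2⟩ := hDact x hxD
    have h3 := abs_le.1 (hRp (angleAction g J x)).2
    rw [hΦf]
    have h4 : 2 / c₁ < x.2 := by linarith [hxD.2]
    rw [div_lt_iff₀ hc₁] at h4
    have h5 : 1 < x.2 := by linarith [hxD.2]
    simp only [hf]
    constructor
    · linarith
    · calc _ ≤ (c₂ + 1) * x.2 := by linarith
        _ ≤ _ := mul_le_mul_of_nonneg_right (le_max_left _ _) (by linarith)
  · have hxD := hsourceD x hx
    rw [hΦf, ((hfsm x hxD).differentiableAt (by simp)).fderivWithin (hud x hx), hfdet x hxD]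
    rw [hsource] at hx
    rw [wallSpeed_eq hg hE ((hmemiff x hx.2).1 hx.1).1]
    field_simp
  · have h1 := (hpiece n p hp).2.1.contDiffWithinAt (s := piece Φ v₁ n)
    exact h1.congr (fun y hy => (hpiece n y hy).1) (hpiece n p hp).1
  · obtain ⟨h1, h2⟩ := hpiece n p hp
    rw [iteratedFDerivWithin_congr (fun y hy => (hpiece n y hy).1) hp,
      iteratedFDerivWithin_eq_iteratedFDeriv (hudp n) (h2.1.of_le (by exact_mod_cast hk)) hp]
    refine (h2.2 k hk).trans ?_
    gcongr
    exact le_max_right _ _
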